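/- An instance of the (decision version of the) \emph{two-level rectilinear Steiner tree problem} consists of $k \ge 1$ nonempty, pairwise disjoint finite sets $P_1,\dots,P_k \subset \mathbb{Q}^2$ (a partition of the terminal set $P = P_1 \cup \dots \cup P_k$) and a number $B \in \mathbb{Q}$. Each $P_i$ is given by a list of its points (repetitions are allowed), and all rational numbers are given as fractions $a/b$ with $a \in \mathbb{Z}$, $b \in \mathbb{Z}_{\ge 1}$ written in binary (not necessarily in lowest terms). A Steiner tree for a set $S \subset \mathbb{R}^2$ is a finite tree whose vertices are points of $\mathbb{R}^2$ and whose vertex set contains $S$; its length is $l(T) = \sum_{\{x,y\} \in E(T)} \lVert x - y\rVert_1$. A two-level rectilinear Steiner tree for $P_1,\dots,P_k$ is a tuple $T = (T_{top}, T_1, \dots, T_k)$ for which there are connection points $q_1,\dots,q_k \in \mathbb{R}^2$ such that $T_{top}$ is a Steiner tree for $\{q_1,\dots,q_k\}$ and $T_i$ is a Steiner tree for $P_i \cup \{q_i\}$ for each $i \in \{1,\dots,k\}$; its length is $l(T) = l(T_{top}) + \sum_{i=1}^k l(T_i)$. The question is whether there is a two-level rectilinear Steiner tree for $P_1,\dots,P_k$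 of length $l(T) \le B$. This problem, as the language of all words that encode a yes-instance, is in NP: there are a polynomial-time (multi-stack) Turing machine verifier $V$ and a polynomial $p$ such that a word $x$ encodes a yes-instance if and only if $V$ accepts $(x,w)$ for some certificate $w$ (a word over a fixed finite alphabet) of length at most $p(|x|)$. -/

import Mathlib

/-! ### The class NP -/

/-- A language `L` over a finite alphabet `Γ` is in NP: there are a finite alphabet `Δ` for the
certificates, a polynomial `p`, and a verifier `V`, computed in polynomial time by a (multi-stack)
Turing machine, such that a word `x` is in `L` iff `V` accepts `(x, w)` for some certificate `w`
of length at most `p |x|`. The machine reads the word `x` followed by the word `w`, and its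
running time is bounded by a polynomial in the total length `|x| + |w|`. -/
def InNP {Γ : Type} [Fintype Γ] (L : Language Γ) : Prop :=
  ∃ (Δ : Type) (_ : Fintype Δ) (V : List Γ × List Δ → Bool) (p : Polynomial ℕ),
    Nonempty (Turing.TM2ComputableInPolyTime
      (Computability.encodingProd (Computability.encodingList Γ)
        (Computability.encodingList Δ)).encode
      Computability.encodeBool V) ∧
    ∀ x : List Γ, x ∈ L ↔ ∃ w : List Δ, w.length ≤ p.eval x.length ∧ V (x, w) = true

namespace TwoLevelSteiner

/-! ### Two-level rectilinear Steiner trees -/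

/-- The `ℓ₁`-distance of two points of the plane. -/
def dist₁ (x y : ℝ × ℝ) : ℝ := |x.1 - y.1| + |x.2 - y.2|

theorem dist₁_comm (x y : ℝ × ℝ) : dist₁ x y = dist₁ y x := by
  simp only [dist₁, abs_sub_comm]

/-- A finite tree whose vertices are points of the plane. It is nonempty, since trees are
connected. -/
structure PlaneTree where
  verts : Finset (ℝ × ℝ)
  graph : SimpleGraph verts
  isTree : graph.IsTree

/-- The `ℓ₁`-length of an edge `{x, y}`. -/
def edgeLength {V : Finset (ℝ × ℝ)} : Sym2 V → ℝ :=
  Sym2.lift ⟨fun x y => dist₁ x y, fun x y => dist₁_comm x y⟩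

open Classical in
/-- The `ℓ₁`-length of a tree: the sum of `‖x - y‖₁` over its edges `{x, y}`. -/
noncomputable def PlaneTree.length (T : PlaneTree) : ℝ :=
  ∑ e ∈ T.graph.edgeFinset, edgeLength e

/-- `T` is a Steiner tree for the terminals `S`: all points of `S` are vertices of `T`
(the other vertices of `T` are its Steiner points). -/
def PlaneTree.IsSteinerTreeFor (T : PlaneTree) (S : Set (ℝ × ℝ)) : Prop :=
  S ⊆ (T.verts : Set (ℝ × ℝ))

/-- A two-level rectilinear Steiner tree for terminal sets `P₁, …, Pₖ`: a Steiner tree `Tᵢ` for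
each `Pᵢ` and a top-level tree, such that the top-level tree shares with each `Tᵢ` a connection
point `qᵢ`. The connection points are vertices of the trees; this is no restriction, since the
trees may have Steiner points of degree two. -/
structure TwoLevelTree {k : ℕ} (P : Fin k → Set (ℝ × ℝ)) where
  top : PlaneTree
  bottom : Fin k → PlaneTree
  connected : ∃ q : Fin k → ℝ × ℝ,
    top.IsSteinerTreeFor (Set.range q) ∧ ∀ i, (bottom i).IsSteinerTreeFor (P i ∪ {q i})

/-- The total length `l(T_top) + ∑ᵢ l(Tᵢ)` of a two-level tree. -/
noncomputable def TwoLevelTree.length {k : ℕ} {P : Fin k → Set (ℝ × ℝ)}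
    (T : TwoLevelTree P) : ℝ :=
  T.top.length + ∑ i, (T.bottom i).length

/-! ### The decision problem -/

/-- A fraction, not necessarily in lowest terms. -/
structure Frac where
  num : ℤ
  den : ℕ
  den_pos : 0 < den

/-- The real number denoted by a fraction. -/
noncomputable def Frac.val (a : Frac) : ℝ := (a.num : ℝ) / (a.den : ℝ)

/-- The raw data of an instance: the lists of the terminals of `P₁, …, Pₖ`, with rational
coordinates, and a rational bound on the length. -/
structure Instance where
  bound : Frac
  groups : List (List (Frac × Frac))

/-- The terminal set `Pᵢ`. -/
def Instance.terminals (I : Instance) (i : Fin I.groups.length) : Set (ℝ × ℝ) :=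
  {x | ∃ a ∈ I.groups.get i, x = (a.1.val, a.2.val)}

/-- The terminal sets `P₁, …, Pₖ`, `k ≥ 1`, form a partition of their union `P`: they are nonempty
and pairwise disjoint. -/
def Instance.IsPartition (I : Instance) : Prop :=
  I.groups ≠ [] ∧ (∀ i, (I.terminals i).Nonempty) ∧
    Pairwise fun i j => Disjoint (I.terminals i) (I.terminals j)

/-- The question: is there a two-level rectilinear Steiner tree of total length at most the given
bound? -/
def Instance.IsYes (I : Instance) : Prop :=
  ∃ T : TwoLevelTree I.terminals, T.length ≤ I.bound.val

/-! ### Instances as words -/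

/-- The symbols used to write down instances. -/
inductive Sym
  | bit (b : Bool)
  | minus
  | slash
  | comma
  | semicolon
  deriving DecidableEq, Fintype

/-- A natural number in binary, least significant bit first, without superfluous zeros. -/
def natWord (n : ℕ) : List Sym := (Computability.encodeNat n).map Sym.bit

/-- A fraction, written as `±num/den,` with `num` and `den` in binary. -/
def Frac.word (a : Frac) : List Sym :=
  (if a.num < 0 then [Sym.minus] else []) ++ natWord a.num.natAbs ++
    Sym.slash :: natWord a.den ++ [Sym.comma]

/-- A set of terminals: the coordinates of its points, followed by `;`. -/
def groupWord (g : List (Frac × Frac)) : List Sym :=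
  (g.flatMap fun a => a.1.word ++ a.2.word) ++ [Sym.semicolon]

/-- An instance: the bound, followed by the sets of terminals. -/
def Instance.word (I : Instance) : List Sym :=
  I.bound.word ++ I.groups.flatMap groupWord

/-- The two-level rectilinear Steiner tree problem (decision version), as the language of all words
that describe a yes-instance. -/
def problem : Language Sym :=
  {w | ∃ I : Instance, I.IsPartition ∧ I.IsYes ∧ I.word = w}

/-! An instance is determined by its word. -/

theorem natWord_append_cons {n m : ℕ} {c d : Sym} {s t : List Sym} (hc : ∀ b, c ≠ Sym.bit b)
    (hd : ∀ b, d ≠ Sym.bit b) (h : natWord n ++ c :: s = natWord m ++ d :: t) :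
    n = m ∧ c = d ∧ s = t := by
  have key : ∀ u v : List Bool, u.map Sym.bit ++ c :: s = v.map Sym.bit ++ d :: t →
      u = v ∧ c = d ∧ s = t := by
    intro u
    induction u with
    | nil =>
      intro v h
      cases v with
      | nil => simpa using h
      | cons b v => exact absurd (by simpa using (List.cons.inj h).1) (hc b)
    | cons a u ih =>
      intro v h
      cases v with
      | nil => exact absurd (by simpa using (List.cons.inj h).1.symm) (hd a)
      | cons b v =>
        simp only [List.map_cons, List.cons_append, List.cons.injEq, Sym.bit.injEq] at h
        obtain ⟨h1, h2⟩ := ih v h.2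
        exact ⟨by rw [h.1, h1], h2⟩
  obtain ⟨h1, h2⟩ := key _ _ h
  exact ⟨Computability.encodingNatBool.encode_injective h1, h2⟩

theorem minus_cons_ne {n : ℕ} {s t : List Sym} :
    Sym.minus :: t ≠ natWord n ++ Sym.slash :: s := by
  unfold natWord
  cases Computability.encodeNat n <;> simp

theorem Frac.word_append {a b : Frac} {s t : List Sym} (h : a.word ++ s = b.word ++ t) :
    a = b ∧ s = t := by
  have key : (a.num < 0 ↔ b.num < 0) ∧
      natWord a.num.natAbs ++ Sym.slash :: (natWord a.den ++ Sym.comma :: s) =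
      natWord b.num.natAbs ++ Sym.slash :: (natWord b.den ++ Sym.comma :: t) := by
    unfold Frac.word at h
    by_cases ha : a.num < 0 <;> by_cases hb : b.num < 0 <;>
      simp only [ha, hb, if_true, if_false, List.append_assoc, List.cons_append,
        List.nil_append, List.cons.injEq, true_and] at h ⊢
    · exact h
    · exact absurd h minus_cons_ne
    · exact absurd h.symm minus_cons_ne
    · exact h
  obtain ⟨h1, -, h2⟩ := natWord_append_cons (by simp) (by simp) key.2
  obtain ⟨h3, -, h4⟩ := natWord_append_cons (by simp) (by simp) h2
  refine ⟨?_, h4⟩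
  have h5 := key.1
  clear key h
  obtain ⟨an, ad, ha⟩ := a
  obtain ⟨bn, bd, hb⟩ := b
  simp only at h1 h3 h5
  have : an = bn := by omega
  subst this h3
  rfl

theorem Frac.word_append_ne {a : Frac} {s t : List Sym} : a.word ++ s ≠ Sym.semicolon :: t := by
  unfold Frac.word natWord
  split_ifs
  · simp
  · cases Computability.encodeNat a.num.natAbs <;> simp

theorem groupWord_append : ∀ {g g' : List (Frac × Frac)} {s t : List Sym},
    groupWord g ++ s = groupWord g' ++ t → g = g' ∧ s = t := by
  intro g
  induction g with
  | nil =>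
    intro g' s t h
    cases g' with
    | nil => simpa [groupWord] using h
    | cons b g' =>
      simp only [groupWord, List.flatMap_cons, List.flatMap_nil, List.append_assoc,
        List.nil_append, List.cons_append] at h
      exact absurd h.symm Frac.word_append_ne
  | cons a g ih =>
    intro g' s t h
    cases g' with
    | nil =>
      simp only [groupWord, List.flatMap_cons, List.flatMap_nil, List.append_assoc,
        List.nil_append, List.cons_append] at h
      exact absurd h Frac.word_append_ne
    | cons b g' =>
      simp only [groupWord, List.flatMap_cons, List.append_assoc] at h
      obtain ⟨h1, h⟩ := Frac.word_append h
      obtain ⟨h2, h⟩ := Frac.word_append h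
      obtain ⟨h3, h⟩ := ih (g' := g') (s := s) (t := t) (by simpa [groupWord] using h)
      exact ⟨by rw [Prod.ext h1 h2, h3], h⟩

theorem Instance.word_injective : Function.Injective Instance.word := by
  rintro ⟨a, g⟩ ⟨b, g'⟩ h
  obtain ⟨h1, h⟩ := Frac.word_append h
  have ne : ∀ (x : List (Frac × Frac)) (s : List Sym), groupWord x ++ s ≠ [] := by
    simp [groupWord]
  have key : ∀ g g' : List (List (Frac × Frac)),
      g.flatMap groupWord = g'.flatMap groupWord → g = g' := by
    intro g
    induction g with
    | nil =>
      intro g' h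
      cases g' with
      | nil => rfl
      | cons x g' => exact absurd h.symm (ne _ _)
    | cons y g ih =>
      intro g' h
      cases g' with
      | nil => exact absurd h (ne _ _)
      | cons x g' =>
        simp only [List.flatMap_cons] at h
        obtain ⟨h1, h⟩ := groupWord_append h
        rw [h1, ih g' h]
  have h1 : a = b := h1
  rw [h1, key g g' h]

end TwoLevelSteiner

/-!
The problem is in NP because a two-level tree of polynomial size can be guessed and checked. The
proof has a geometric and a computational part.

**Geometry.** Let `A` be the finite set of all coordinates of terminals. In a two-level tree, every
coordinate can be rounded to an element of `A` without increasing the total length and without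
moving a terminal (`exists_rounding_plane`): while a single coordinate value moves between two
neighbouring values, the `ℓ₁`-length is an affine function of it, so one of the two directions does
not increase it. After rounding, all vertices are in the grid `A ×ˢ A`, and repeated vertices are
omitted, so that each tree has at most `A.card ^ 2` vertices (`TwoLevelTree.exists_grid`). The
product of all denominators is a common denominator of all numbers of the instance; together with
an offset that makes numerators nonnegative, it lets natural numbers of polynomial length represent
the coordinates (`exists_common_grid`). Trees enter the verification as growing processes `Grows`,
which attach each new vertex to an earlier one. A tree yields such a process along its edges
(`PlaneTree.exists_grows`), and conversely a process contains a tree that is not longer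
(`Grows.exists_planeTree`), so that the verifier does not have to test for cycles.

**Computation.** Verifiers are nondeterministic programs `Prog`, which are regular expressions over
elementary operations. The choices in a run form the certificate.
* A program whose operations act on stacks becomes a multi-stack Turing machine: one stack holds the
  pending subprograms, and the certificate resolves the choices (`verifier_computable`,
  `inNP_of_run`).
* Stacks implement a register machine. The bits of equal significance of all registers form a
  column, the columns are swept from one stack to another, and a sweep performs a serial addition
  (`RegOp.sound`, `RegOp.complete`, `inNP_of_nat_program`).
* The register machine implements the operations `Op` of the verifier, in particular reading a
  fraction and comparing it with a coordinate (`Op.sound`, `Op.complete`, `inNP_of_op_program`).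

Each level represents the states of the next one, and `Ex.of_bind` and `RunLE.bind` transfer runs
between the levels. Finally, `mainProg` guesses the grid and the trees while it reads the instance,
and charges each edge to a budget. Accepted words are yes-instances (`mem_problem_of_ex`), and every
yes-instance is accepted within polynomial bounds (`runLE_of_mem_problem`).
-/

set_option linter.unusedSectionVars false

/-! ### Nondeterministic programs -/

/-- Nondeterministic programs over the elementary operations `ι`: regular expressions whose letters
are operations. -/
inductive Prog (ι : Type) : Type
  | prim (i : ι)
  | skip
  | fail
  | seq (p q : Prog ι)
  | alt (p q : Prog ι)
  | star (p : Prog ι)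

namespace Prog

variable {ι κ S T : Type}

/-- `Run sem p s t n`: the program `p` has a run of `n` steps from the state `s` to the state `t`,
where `sem i s t` says that the operation `i` may lead from `s` to `t`. Every operation and every
control decision counts as one step. -/
inductive Run (sem : ι → S → S → Prop) : Prog ι → S → S → ℕ → Prop
  | prim {i s t} : sem i s t → Run sem (prim i) s t 1
  | skip {s} : Run sem skip s s 1
  | seq {p q s t u m n} : Run sem p s t m → Run sem q t u n → Run sem (seq p q) s u (m + n + 1)
  | altl {p q s t n} : Run sem p s t n → Run sem (alt p q) s t (n + 1)
  | altr {p q s t n} : Run sem q s t n → Run sem (alt p q) s t (n + 1)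
  | star_nil {p s} : Run sem (star p) s s 1
  | star_cons {p s t u m n} : Run sem p s t m → Run sem (star p) t u n →
      Run sem (star p) s u (m + n + 1)

/-! ### Stack machines -/

/-- The elementary operations on a family of stacks: push a symbol, pop a given symbol, and test
for emptiness. The last two fail if the stack does not have the required form. -/
inductive StackOp (K A : Type)
  | push (k : K) (a : A)
  | pop (k : K) (a : A)
  | isEmpty (k : K)

variable {K A : Type} [DecidableEq K]

/-- The effect of a stack operation. -/
def StackOp.sem : StackOp K A → (K → List A) → (K → List A) → Prop
  | .push k a, s, t => t = Function.update s k (a :: s k)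
  | .pop k a, s, t => ∃ l, s k = a :: l ∧ t = Function.update s k l
  | .isEmpty k, s, t => s k = [] ∧ t = s

/-- `RunList c s t n`: executing the programs of the list `c` in succession. -/
inductive RunList : List (Prog (StackOp K A)) → (K → List A) → (K → List A) → ℕ → Prop
  | nil {s} : RunList [] s s 0
  | cons {p c s t u m n} : Run StackOp.sem p s t m → RunList c t u n → RunList (p :: c) s u (m + n)

theorem RunList.exists_of_cons {p : Prog (StackOp K A)} {c : List (Prog (StackOp K A))}
    {s t : K → List A} {k : ℕ} (h : RunList (p :: c) s t k) :
    ∃ u m n, k = m + n ∧ Run StackOp.sem p s u m ∧ RunList c u t n := by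
  generalize hc : p :: c = c' at h
  cases h with
  | nil => cases hc
  | cons h1 h2 => cases hc; exact ⟨_, _, _, rfl, h1, h2⟩

variable [DecidableEq A]

/-- One step of the machine that executes a stack of pending programs, resolving every choice by
the bit `b`. -/
def ctlStep (b : Bool) :
    List (Prog (StackOp K A)) × (K → List A) → Option (List (Prog (StackOp K A)) × (K → List A))
  | ([], _) => none
  | (prim (.push k a) :: c, s) => some (c, Function.update s k (a :: s k))
  | (prim (.pop k a) :: c, s) =>
      if (s k).head? = some a then some (c, Function.update s k (s k).tail) else none
  | (prim (.isEmpty k) :: c, s) => if (s k).head? = none then some (c, s) else none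
  | (skip :: c, s) => some (c, s)
  | (fail :: _, _) => none
  | (seq p q :: c, s) => some (p :: q :: c, s)
  | (alt p q :: c, s) => some ((if b then p else q) :: c, s)
  | (star p :: c, s) => some (if b then p :: star p :: c else c, s)

/-- The machine of `ctlStep`, run on a word of choices. -/
def runCtl : List Bool → List (Prog (StackOp K A)) × (K → List A) →
    Option (List (Prog (StackOp K A)) × (K → List A))
  | [], c => some c
  | b :: w, c => (ctlStep b c).bind (runCtl w)

theorem runCtl_append (v w : List Bool) (c : List (Prog (StackOp K A)) × (K → List A)) :
    runCtl (v ++ w) c = (runCtl v c).bind (runCtl w) := by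
  induction v generalizing c with
  | nil => rfl
  | cons b v ih =>
    simp only [List.cons_append, runCtl, Option.bind_assoc]
    congr 1; funext c; exact ih c

/-- Every run of a program is executed by the machine for a suitable word of choices. -/
theorem Run.exists_runCtl {p : Prog (StackOp K A)} {s t : K → List A} {n : ℕ}
    (h : Run StackOp.sem p s t n) (c : List (Prog (StackOp K A))) :
    ∃ w : List Bool, w.length = n ∧ runCtl w (p :: c, s) = some (c, t) := by
  induction h generalizing c with
  | @prim i s t h =>
    refine ⟨[true], rfl, ?_⟩
    cases i with
    | push k a => simp only [StackOp.sem] at h; simp [runCtl, ctlStep, h]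
    | pop k a =>
      obtain ⟨l, h1, rfl⟩ := h
      simp [runCtl, ctlStep, h1]
    | isEmpty k =>
      obtain ⟨h1, rfl⟩ := h
      simp [runCtl, ctlStep, h1]
  | skip => exact ⟨[true], rfl, rfl⟩
  | @seq p q _ _ _ _ _ _ _ ih1 ih2 =>
    obtain ⟨v, hv, h1⟩ := ih1 (q :: c)
    obtain ⟨w, hw, h2⟩ := ih2 c
    exact ⟨true :: (v ++ w), by simp [hv, hw], by simp [runCtl, ctlStep, runCtl_append, h1, h2]⟩
  | altl _ ih =>
    obtain ⟨w, hw, h⟩ := ih c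
    exact ⟨true :: w, by simp [hw], by simp [runCtl, ctlStep, h]⟩
  | altr _ ih =>
    obtain ⟨w, hw, h⟩ := ih c
    exact ⟨false :: w, by simp [hw], by simp [runCtl, ctlStep, h]⟩
  | star_nil => exact ⟨[false], rfl, rfl⟩
  | @star_cons p _ _ _ _ _ _ _ ih1 ih2 =>
    obtain ⟨v, hv, h1⟩ := ih1 (star p :: c)
    obtain ⟨w, hw, h2⟩ := ih2 c
    exact ⟨true :: (v ++ w), by simp [hv, hw], by simp [runCtl, ctlStep, runCtl_append, h1, h2]⟩

/-- A successful computation of the machine is a run of the pending programs. -/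
theorem RunList.of_runCtl {w : List Bool} {c : List (Prog (StackOp K A))} {s t : K → List A}
    (h : runCtl w (c, s) = some ([], t)) : RunList c s t w.length := by
  induction w generalizing c s with
  | nil => cases h; exact .nil
  | cons b w ih =>
    obtain ⟨⟨c', s'⟩, h1, h2⟩ := Option.bind_eq_some_iff.1 h
    replace ih := ih h2
    clear h h2
    have one : ∀ {p c}, Run StackOp.sem p s s' 1 → RunList c s' t w.length →
        RunList (p :: c) s t (w.length + 1) := fun h h' => by
      rw [add_comm]; exact .cons h h'
    rw [List.length_cons]
    match c with
    | [] => cases h1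
    | prim (.push k a) :: c => cases h1; exact one (.prim rfl) ih
    | prim (.pop k a) :: c =>
      rw [ctlStep] at h1
      split_ifs at h1 with h3
      cases h1
      cases hk : s k with
      | nil => simp [hk] at h3
      | cons x l =>
        have : x = a := by simpa [hk] using h3
        subst this
        simp only [hk, List.tail_cons] at ih one
        exact one (.prim ⟨l, hk, rfl⟩) ih
    | prim (.isEmpty k) :: c =>
      rw [ctlStep] at h1
      split_ifs at h1 with h3
      cases h1
      exact one (.prim ⟨List.head?_eq_none_iff.1 h3, rfl⟩) ih
    | skip :: c => cases h1; exact one .skip ih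
    | fail :: c => cases h1
    | seq p q :: c =>
      cases h1
      obtain ⟨_, _, _, e1, i1, ih⟩ := ih.exists_of_cons
      obtain ⟨_, _, _, e2, i2, i3⟩ := ih.exists_of_cons
      convert RunList.cons (.seq i1 i2) i3 using 1
      omega
    | alt p q :: c =>
      cases h1
      obtain ⟨_, m, n, e, i1, i2⟩ := ih.exists_of_cons
      rw [show w.length + 1 = (m + 1) + n by omega]
      cases b with
      | true => exact .cons (.altl (by simpa using i1)) i2
      | false => exact .cons (.altr (by simpa using i1)) i2
    | star p :: c =>
      cases h1
      cases b with
      | false => exact one .star_nil (by simpa using ih)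
      | true =>
        obtain ⟨_, _, _, e1, i1, ih⟩ := ih.exists_of_cons
        obtain ⟨_, _, _, e2, i2, i3⟩ := ih.exists_of_cons
        convert RunList.cons (.star_cons i1 i2) i3 using 1
        omega

/-- The initial stacks: the input, in reversed order, on the stack `k`. -/
def inputStacks {Γ : Type} (k : K) (emb : Γ → A) (x : List Γ) : K → List A :=
  Function.update (fun _ => []) k (x.map emb).reverse

/-- Whether the pending programs are completed exactly at the end of the word of choices. -/
def result (w : List Bool) (c : List (Prog (StackOp K A)) × (K → List A)) : Bool :=
  ((runCtl w c).map fun c => c.1.isEmpty).getD false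

/-- The verifier belonging to a program: it executes the program on `x`, with `w` as the word of
choices, and accepts if the program is completed exactly at the end of `w`. -/
def verifier {Γ : Type} (p : Prog (StackOp K A)) (k : K) (emb : Γ → A)
    (x : List Γ × List Bool) : Bool :=
  result x.2 ([p], inputStacks k emb x.1)

theorem exists_verifier_iff {Γ : Type} {p : Prog (StackOp K A)} {k : K} {emb : Γ → A}
    {x : List Γ} {n : ℕ} :
    (∃ w : List Bool, w.length = n ∧ verifier p k emb (x, w) = true) ↔
      ∃ t, Run StackOp.sem p (inputStacks k emb x) t n := by
  constructor
  · rintro ⟨w, rfl, h⟩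
    unfold verifier result at h
    cases h1 : runCtl w ([p], inputStacks k emb x) with
    | none => simp [h1] at h
    | some c =>
      obtain ⟨c, t⟩ := c
      obtain rfl : c = [] := by simpa [h1] using h
      obtain ⟨u, m, n, e, i1, i2⟩ := (RunList.of_runCtl h1).exists_of_cons
      cases i2
      exact ⟨_, (show m = w.length by omega) ▸ i1⟩
  · rintro ⟨t, h⟩
    obtain ⟨w, hw, h⟩ := h.exists_runCtl []
    exact ⟨w, hw, by simp [verifier, result, h]⟩

end Prog

/-! ### Programs as multi-stack Turing machines -/

namespace Prog

/-- The subprograms of a program. -/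
def subs {ι : Type} : Prog ι → List (Prog ι)
  | prim i => [prim i]
  | skip => [skip]
  | fail => [fail]
  | seq p q => seq p q :: (subs p ++ subs q)
  | alt p q => alt p q :: (subs p ++ subs q)
  | star p => star p :: subs p

theorem self_mem_subs {ι : Type} (p : Prog ι) : p ∈ p.subs := by
  cases p <;> simp [subs]

theorem subs_subset {ι : Type} {p q : Prog ι} (h : p ∈ q.subs) : p.subs ⊆ q.subs := by
  induction q with
  | prim i => rw [subs, List.mem_singleton] at h; rw [h]; exact fun _ => id
  | skip => rw [subs, List.mem_singleton] at h; rw [h]; exact fun _ => id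
  | fail => rw [subs, List.mem_singleton] at h; rw [h]; exact fun _ => id
  | seq a b iha ihb =>
    rw [subs, List.mem_cons, List.mem_append] at h
    rcases h with rfl | h | h
    · exact fun _ => id
    · exact fun x hx => by simp [subs, iha h hx]
    · exact fun x hx => by simp [subs, ihb h hx]
  | alt a b iha ihb =>
    rw [subs, List.mem_cons, List.mem_append] at h
    rcases h with rfl | h | h
    · exact fun _ => id
    · exact fun x hx => by simp [subs, iha h hx]
    · exact fun x hx => by simp [subs, ihb h hx]
  | star a iha =>
    rw [subs, List.mem_cons] at h
    rcases h with rfl | h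
    · exact fun _ => id
    · exact fun x hx => by simp [subs, iha h hx]

/-- The subprograms of `p` as a finite type. -/
def Sub {ι : Type} (p : Prog ι) : Type := {q // q ∈ p.subs}

noncomputable instance {ι : Type} (p : Prog ι) : Fintype p.Sub :=
  haveI : Finite p.Sub := List.finite_toSet p.subs
  Fintype.ofFinite _

open Classical in
/-- A program as a subprogram of `p`; a program that is none is replaced by `p`. -/
noncomputable def toSub {ι : Type} (p q : Prog ι) : p.Sub :=
  if h : q ∈ p.subs then ⟨q, h⟩ else ⟨p, p.self_mem_subs⟩

theorem toSub_val {ι : Type} {p q : Prog ι} (h : q ∈ p.subs) : (p.toSub q).1 = q := by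
  simp [toSub, h]

/-- The stacks of the Turing machine: input, output, pending programs, and the stacks `K`. -/
inductive MStack (K : Type)
  | inp
  | out
  | ctl
  | data (k : K)
  deriving DecidableEq, Fintype

/-- The labels of the Turing machine. -/
inductive MLabel (Γ C : Type)
  | load
  | store (a : Γ)
  | fetch
  | dispatch
  | exec (c : C) (b : Bool)
  | clean (r : Bool)
  deriving Fintype

/-- The alphabets of the stacks. -/
@[reducible] def MAlph (Γ K A C : Type) : MStack K → Type
  | .inp => Γ ⊕ Bool
  | .out => Bool
  | .ctl => C
  | .data _ => A

/-- The local variables of the Turing machine: the symbols read last from the input, from the stack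
of pending programs and from another stack, and a flag. -/
structure MVar (Γ A C : Type) where
  i : Option (Γ ⊕ Bool) := none
  c : Option C := none
  a : Option A := none
  flag : Bool := false

noncomputable instance {Γ A C : Type} [Fintype Γ] [Fintype A] [Fintype C] :
    Fintype (MVar Γ A C) :=
  Fintype.ofInjective (fun v => (v.i, v.c, v.a, v.flag)) fun v w h => by
    cases v; cases w; simpa using h

open Turing TM2.Stmt

section Machine

variable {Γ K A : Type} [DecidableEq K]

/-- The statements of the Turing machine. -/
abbrev MStmt (Γ K A C : Type) : Type :=
  TM2.Stmt (MAlph Γ K A C) (MLabel Γ C) (MVar Γ A C)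

/-- Pop a symbol from each stack of a list; the flag records whether there was one. -/
def popAll {C : Type} (l : List (MStack K)) (q : MStmt Γ K A C) : MStmt Γ K A C :=
  l.foldr (fun k q => pop k (fun v o => { v with flag := v.flag || o.isSome }) q) q

/-- The contents of all stacks. -/
def stk {C : Type} (i : List (Γ ⊕ Bool)) (o : List Bool) (c : List C) (d : K → List A) :
    ∀ k, List (MAlph Γ K A C k)
  | .inp => i
  | .out => o
  | .ctl => c
  | .data k => d k

section stk

variable {C : Type} {i : List (Γ ⊕ Bool)} {o : List Bool} {c : List C} {d : K → List A}

theorem update_stk_inp (i') : Function.update (stk i o c d) .inp i' = stk i' o c d := by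
  funext k; cases k <;> simp [Function.update, stk]

theorem update_stk_ctl (c') : Function.update (stk i o c d) .ctl c' = stk i o c' d := by
  funext k; cases k <;> simp [Function.update, stk]

theorem update_stk_data (k l) :
    Function.update (stk i o c d) (.data k) l = stk i o c (Function.update d k l) := by
  funext j
  cases j with
  | data j =>
    by_cases h : j = k
    · subst h; simp [stk]
    · simp [stk, h]
  | _ => simp [stk]

end stk

/-- `StepsLE M a b n`: the machine gets from `a` to `b` in at most `n` steps. -/
def StepsLE {Λ σ : Type} {G : MStack K → Type} (M : Λ → TM2.Stmt G Λ σ)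
    (a b : TM2.Cfg G Λ σ) (n : ℕ) : Prop :=
  ∃ m ≤ n, (flip bind (TM2.step M))^[m] (some a) = some b

namespace StepsLE

variable {Λ σ : Type} {G : MStack K → Type} {M : Λ → TM2.Stmt G Λ σ} {a b c : TM2.Cfg G Λ σ}
  {m n : ℕ}

theorem refl : StepsLE M a a n := ⟨0, Nat.zero_le _, rfl⟩

theorem head {l : Λ} {v : σ} {S : ∀ k, List (G k)} (h : TM2.stepAux (M l) v S = b)
    (h' : StepsLE M b c n) : StepsLE M ⟨some l, v, S⟩ c (n + 1) := by
  obtain ⟨m, hm, h'⟩ := h'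
  refine ⟨m + 1, by omega, ?_⟩
  rw [Function.iterate_succ_apply]
  show (flip bind (TM2.step M))^[m] (some (TM2.stepAux (M l) v S)) = _
  rw [h, h']

theorem mono (h : StepsLE M a b m) (hmn : m ≤ n) : StepsLE M a b n := by
  obtain ⟨k, hk, h⟩ := h
  exact ⟨k, hk.trans hmn, h⟩

end StepsLE

theorem stepAux_popAll {C : Type} {l : List (MStack K)} (hl : l.Nodup) (q : MStmt Γ K A C)
    (v : MVar Γ A C) (S : ∀ k, List (MAlph Γ K A C k)) :
    TM2.stepAux (popAll l q) v S =
      TM2.stepAux q { v with flag := v.flag || l.any fun k => (S k).head?.isSome }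
        fun k => if k ∈ l then (S k).tail else S k := by
  induction l generalizing v S with
  | nil => simp [popAll]
  | cons k l ih =>
    rw [List.nodup_cons] at hl
    show TM2.stepAux (popAll l q) _ _ = _
    have h : (l.any fun j => (Function.update S k (S k).tail j).head?.isSome) =
        l.any fun j => (S j).head?.isSome := by
      rw [Bool.eq_iff_iff]
      simp only [List.any_eq_true]
      refine exists_congr fun j => and_congr_right fun hj => ?_
      rw [Function.update_of_ne (fun h => hl.1 (by rwa [← h]))]
    rw [ih hl.2, h]
    congr 1
    · simp only [List.any_cons, Bool.or_assoc]
    · funext j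
      by_cases h : j = k
      · subst h; simp [hl.1]
      · simp [h]

variable [Fintype K]

/-- All stacks but the output. -/
noncomputable def workStacks (K : Type) [Fintype K] [DecidableEq K] : List (MStack K) :=
  (Finset.univ.erase MStack.out).toList

theorem workStacks_nodup : (workStacks K).Nodup := Finset.nodup_toList _

open Classical in
/-- The program of the Turing machine that executes `p` on the input: it moves the input word to the
stack `k`, then executes `p` with the rest of the input as the word of choices, and finally empties
all stacks and outputs the result. -/
noncomputable def mstmt (p : Prog (StackOp K A)) (k : K) (emb : Γ → A) :
    MLabel Γ p.Sub → MStmt Γ K A p.Sub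
  | .load => pop .inp (fun v o => { v with i := o }) <|
      branch (fun v => (v.i.bind Sum.getLeft?).isSome)
        (goto fun v => match v.i with
          | some (.inl a) => .store a
          | _ => .load)
        (push .ctl (fun _ => p.toSub p) <| goto fun _ => .dispatch)
  | .store a => push (.data k) (fun _ => emb a) <| goto fun _ => .load
  | .fetch => pop .inp (fun v o => { v with i := o }) <| goto fun _ => .dispatch
  | .dispatch => pop .ctl (fun v o => { v with c := o }) <| goto fun v =>
      match v.i, v.c with
      | none, none => .clean true
      | some (.inr b), some c => .exec c b
      | _, _ => .clean false
  | .exec c b => match c.1 with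
    | prim (.push k a) => push (.data k) (fun _ => a) <| goto fun _ => .fetch
    | prim (.pop k a) => pop (.data k) (fun v o => { v with a := o }) <|
        goto fun v => if v.a = some a then .fetch else .clean false
    | prim (.isEmpty k) => peek (.data k) (fun v o => { v with a := o }) <|
        goto fun v => if v.a = none then .fetch else .clean false
    | skip => goto fun _ => .fetch
    | fail => goto fun _ => .clean false
    | seq q r => push .ctl (fun _ => p.toSub r) <| push .ctl (fun _ => p.toSub q) <|
        goto fun _ => .fetch
    | alt q r => push .ctl (fun _ => p.toSub (if b then q else r)) <| goto fun _ => .fetch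
    | star q =>
        if b then push .ctl (fun _ => p.toSub (star q)) <| push .ctl (fun _ => p.toSub q) <|
          goto fun _ => .fetch
        else goto fun _ => .fetch
  | .clean r => popAll (workStacks K) <|
      branch (fun v => v.flag) (load (fun _ => {}) <| goto fun _ => .clean r)
        (load (fun _ => {}) <| push .out (fun _ => r) <| halt)

/-- The Turing machine of a program. -/
noncomputable def machine [Fintype Γ] [Fintype A] (p : Prog (StackOp K A)) (k : K) (emb : Γ → A) :
    FinTM2 where
  K := MStack K
  k₀ := .inp
  k₁ := .out
  Γ := MAlph Γ K A p.Sub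
  Λ := MLabel Γ p.Sub
  main := .load
  σ := MVar Γ A p.Sub
  initialState := {}
  Γk₀Fin := inferInstanceAs (Fintype (Γ ⊕ Bool))
  m := mstmt p k emb

variable {p : Prog (StackOp K A)} {k : K} {emb : Γ → A}

/-- Emptying the stacks takes a time proportional to their height. -/
theorem stepsLE_clean {r : Bool} {n : ℕ} {v : MVar Γ A p.Sub}
    {S : ∀ k, List (MAlph Γ K A p.Sub k)} (hv : v.flag = false) (hS : ∀ k, (S k).length ≤ n)
    (ho : S .out = []) :
    StepsLE (mstmt p k emb) ⟨some (.clean r), v, S⟩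
      ⟨none, {}, stk [] [r] [] fun _ => []⟩ (n + 1) := by
  induction n generalizing v S with
  | zero =>
    have h0 : ∀ k, S k = [] := fun k => List.eq_nil_of_length_eq_zero (Nat.le_zero.1 (hS k))
    refine .head ?_ .refl
    rw [mstmt, stepAux_popAll workStacks_nodup]
    have h1 : ((workStacks K).any fun k => (S k).head?.isSome) = false := by simp [h0]
    simp only [h1, hv, Bool.or_false, TM2.stepAux, cond_false]
    congr 1
    funext j; cases j <;> simp [stk, h0]
  | succ n ih =>
    by_cases hf : ((workStacks K).any fun k => (S k).head?.isSome) = true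
    · refine .head (b := ⟨some (.clean r), {}, fun k => if k ∈ workStacks K then (S k).tail
        else S k⟩) ?_ (ih rfl ?_ ?_)
      · rw [mstmt, stepAux_popAll workStacks_nodup]
        simp [hf]
      · intro k
        split_ifs with h
        · have := hS k; simp; omega
        · have : k = .out := by simpa [workStacks] using h
          subst this; simp [ho]
      · simp [workStacks, ho]
    · have h0 : ∀ k, S k = [] := by
        intro k
        by_cases hk : k = .out
        · rw [hk, ho]
        · simp only [List.any_eq_true, not_exists, not_and] at hf
          have := hf k (by simp [workStacks, hk])
          simpa using this
      refine (ih hv (fun k => by simp [h0]) ho).mono (by omega)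

end Machine

section Machine

variable {Γ K A : Type} [DecidableEq K] {p : Prog (StackOp K A)} {k : K} {emb : Γ → A}

theorem length_update_le {s : K → List A} {N : ℕ} {j : K} {l : List A}
    (hs : ∀ k, (s k).length ≤ N) (hl : l.length ≤ N) (k : K) :
    (Function.update s j l k).length ≤ N := by
  by_cases h : k = j
  · subst h; simpa using hl
  · simpa [h] using hs k

variable [Fintype K] [DecidableEq A]

/-- The Turing machine executes the pending programs in linear time. -/
theorem stepsLE_dispatch {w : List Bool} {c : List (Prog (StackOp K A))} {s : K → List A}
    {v : MVar Γ A p.Sub} {N : ℕ} (hv : v.flag = false) (hi : v.i = (w.map Sum.inr).head?)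
    (hc : ∀ q ∈ c, q ∈ p.subs) (hw : w.length ≤ N) (hcN : c.length ≤ N)
    (hs : ∀ k, (s k).length ≤ N) :
    StepsLE (mstmt p k emb)
      ⟨some .dispatch, v, stk (w.map Sum.inr).tail [] (c.map p.toSub) s⟩
      ⟨none, {}, stk [] [result w (c, s)] [] fun _ => []⟩ (4 * w.length + N + 3) := by
  induction w generalizing c s v N with
  | nil =>
    cases c with
    | nil =>
      refine StepsLE.mono (m := N + 1 + 1) (.head
        (b := ⟨some (.clean true), { v with c := none }, stk [] [] [] s⟩) ?_
        (stepsLE_clean (n := N) (v := { v with c := none }) hv ?_ rfl)) (by omega)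
      · simp [mstmt, stk, hi, update_stk_ctl]
      · intro k; cases k <;> simp [stk, hs]
    | cons q c =>
      refine StepsLE.mono (m := N + 1 + 1) (.head
        (b := ⟨some (.clean false), { v with c := some (p.toSub q) },
        stk [] [] (c.map p.toSub) s⟩) ?_
        (stepsLE_clean (n := N) (v := { v with c := some (p.toSub q) }) hv ?_ rfl)) (by omega)
      · simp [mstmt, stk, hi, update_stk_ctl]
      · rw [List.length_cons] at hcN
        intro k; cases k <;> simp [stk, hs]; omega
  | cons b w ih =>
    rw [List.length_cons] at hw
    cases c with
    | nil =>
      refine StepsLE.mono (m := N + 1 + 1) (.head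
        (b := ⟨some (.clean false), { v with c := none }, stk (w.map Sum.inr) [] [] s⟩) ?_
        (stepsLE_clean (n := N) (v := { v with c := none }) hv ?_ rfl)) (by omega)
      · simp [mstmt, stk, hi, update_stk_ctl]
      · intro k; cases k <;> simp [stk, hs]; omega
    | cons q c =>
      rw [List.length_cons] at hcN
      have hq : (p.toSub q).1 = q := toSub_val (hc q (by simp))
      have hqs : q.subs ⊆ p.subs := subs_subset (hc q (by simp))
      refine StepsLE.head (n := 4 * (w.length + 1) + N + 2) (b := ⟨some (.exec (p.toSub q) b),
        { v with c := some (p.toSub q) }, stk (w.map Sum.inr) [] (c.map p.toSub) s⟩) ?_ ?_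
      · simp [mstmt, stk, hi, update_stk_ctl]
      have hc' : ∀ q ∈ c, q ∈ p.subs := fun q hq => hc q (by simp [hq])
      -- if the step fails, the machine rejects
      have bad : ∀ {s' : K → List A} {v' : MVar Γ A p.Sub}, v'.flag = false →
          (∀ k, (s' k).length ≤ N) →
          TM2.stepAux (mstmt p k emb (.exec (p.toSub q) b)) { v with c := some (p.toSub q) }
            (stk (w.map Sum.inr) [] (c.map p.toSub) s) =
            ⟨some (.clean false), v', stk (w.map Sum.inr) [] (c.map p.toSub) s'⟩ →
          ctlStep b (q :: c, s) = none →
          StepsLE (mstmt p k emb) ⟨some (.exec (p.toSub q) b), { v with c := some (p.toSub q) },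
            stk (w.map Sum.inr) [] (c.map p.toSub) s⟩
            ⟨none, {}, stk [] [result (b :: w) (q :: c, s)] [] fun _ => []⟩
            (4 * (w.length + 1) + N + 2) := by
        intro s' v' hv' hs' h1 h2
        have : result (b :: w) (q :: c, s) = false := by simp [result, runCtl, h2]
        rw [this]
        refine .head h1 ((stepsLE_clean (n := N) hv' ?_ rfl).mono (by omega))
        intro k; cases k <;> simp [stk, hs'] <;> omega
      -- if the step succeeds, the machine goes on
      have good : ∀ {c' : List (Prog (StackOp K A))} {s' : K → List A} {v' : MVar Γ A p.Sub},
          v'.flag = false → (∀ q ∈ c', q ∈ p.subs) → c'.length ≤ N + 1 →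
          (∀ k, (s' k).length ≤ N + 1) →
          TM2.stepAux (mstmt p k emb (.exec (p.toSub q) b)) { v with c := some (p.toSub q) }
            (stk (w.map Sum.inr) [] (c.map p.toSub) s) =
            ⟨some .fetch, v', stk (w.map Sum.inr) [] (c'.map p.toSub) s'⟩ →
          ctlStep b (q :: c, s) = some (c', s') →
          StepsLE (mstmt p k emb) ⟨some (.exec (p.toSub q) b), { v with c := some (p.toSub q) },
            stk (w.map Sum.inr) [] (c.map p.toSub) s⟩
            ⟨none, {}, stk [] [result (b :: w) (q :: c, s)] [] fun _ => []⟩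
            (4 * (w.length + 1) + N + 2) := by
        intro c' s' v' hv' hc'' hcl hs' h1 h2
        have : result (b :: w) (q :: c, s) = result w (c', s') := by simp [result, runCtl, h2]
        rw [this]
        refine (StepsLE.head h1 (StepsLE.head (n := 4 * w.length + (N + 1) + 3)
          (b := ⟨some .dispatch, { v' with i := (w.map Sum.inr).head? },
          stk (w.map Sum.inr).tail [] (c'.map p.toSub) s'⟩) ?_ ?_)).mono (by omega)
        · simp [mstmt, stk, update_stk_inp]
        · exact ih hv' rfl hc'' (by omega) hcl hs'
      have hs1 : ∀ k, (s k).length ≤ N + 1 := fun k => (hs k).trans (by omega)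
      match q with
      | prim (.push j a) =>
        exact good (c' := c) (s' := Function.update s j (a :: s j))
          (v' := { v with c := some (p.toSub (prim (.push j a))) }) hv hc' (by omega)
          (length_update_le hs1 (by simpa using hs j))
          (by simp [mstmt, hq, stk, update_stk_data]) rfl
      | prim (.pop j a) =>
        by_cases h : (s j).head? = some a
        · exact good (c' := c) (s' := Function.update s j (s j).tail)
            (v' := { v with c := some (p.toSub (prim (.pop j a))), a := some a }) hv hc'
            (by omega) (length_update_le hs1 (by have := hs j; simp; omega))
            (by simp [mstmt, hq, stk, update_stk_data, h]) (by simp [ctlStep, h])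
        · exact bad (s' := Function.update s j (s j).tail)
            (v' := { v with c := some (p.toSub (prim (.pop j a))), a := (s j).head? }) hv
            (length_update_le hs (by have := hs j; simp; omega))
            (by simp [mstmt, hq, stk, update_stk_data, h]) (by simp [ctlStep, h])
      | prim (.isEmpty j) =>
        by_cases h : (s j).head? = none
        · exact good (c' := c) (s' := s)
            (v' := { v with c := some (p.toSub (prim (.isEmpty j))), a := none }) hv hc'
            (by omega) hs1
            (by simp [mstmt, hq, stk, h]) (by rw [ctlStep, if_pos h])
        · exact bad (s' := s)
            (v' := { v with c := some (p.toSub (prim (.isEmpty j))), a := (s j).head? }) hv hs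
            (by simpa [mstmt, hq, stk] using h) (by rw [ctlStep, if_neg h])
      | skip =>
        exact good (c' := c) (s' := s)
          (v' := { v with c := some (p.toSub skip) }) hv hc' (by omega) hs1
          (by simp [mstmt, hq]) rfl
      | fail =>
        exact bad (s' := s)
          (v' := { v with c := some (p.toSub fail) }) hv hs (by simp [mstmt, hq]) rfl
      | seq q r =>
        refine good (c' := q :: r :: c) (s' := s)
          (v' := { v with c := some (p.toSub (seq q r)) }) hv ?_ (by simp; omega) hs1
          (by simp [mstmt, hq, stk, update_stk_ctl]) rfl
        intro x hx
        rcases List.mem_cons.1 hx with rfl | hx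
        · exact hqs (show x ∈ (seq x r).subs by simp [subs, self_mem_subs])
        rcases List.mem_cons.1 hx with rfl | hx
        · exact hqs (show x ∈ (seq q x).subs by simp [subs, self_mem_subs])
        · exact hc' x hx
      | alt q r =>
        refine good (c' := (if b then q else r) :: c) (s' := s)
          (v' := { v with c := some (p.toSub (alt q r)) }) hv ?_ (by simp; omega) hs1
          (by simp [mstmt, hq, stk, update_stk_ctl]) rfl
        intro x hx
        rcases List.mem_cons.1 hx with rfl | hx
        · cases b
          · exact hqs (show r ∈ (alt q r).subs by simp [subs, self_mem_subs])
          · exact hqs (show q ∈ (alt q r).subs by simp [subs, self_mem_subs])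
        · exact hc' x hx
      | star q =>
        cases b with
        | true =>
          refine good (c' := q :: star q :: c) (s' := s)
            (v' := { v with c := some (p.toSub (star q)) }) hv ?_ (by simp; omega) hs1
            (by simp [mstmt, hq, stk, update_stk_ctl]) rfl
          intro x hx
          rcases List.mem_cons.1 hx with rfl | hx
          · exact hqs (show x ∈ (star x).subs by simp [subs, self_mem_subs])
          rcases List.mem_cons.1 hx with rfl | hx
          · exact hqs (self_mem_subs _)
          · exact hc' x hx
        | false =>
          exact good (c' := c) (s' := s)
            (v' := { v with c := some (p.toSub (star q)) }) hv hc' (by omega) hs1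
            (by simp [mstmt, hq]) rfl

/-- The Turing machine loads the input word and then executes the program. -/
theorem stepsLE_load {x : List Γ} {w : List Bool} {l : List A} {v : MVar Γ A p.Sub} {N : ℕ}
    (hv : v.flag = false) (hN : x.length + l.length + w.length + 1 ≤ N) :
    StepsLE (mstmt p k emb)
      ⟨some .load, v, stk (x.map Sum.inl ++ w.map Sum.inr) [] []
        (Function.update (fun _ => []) k l)⟩
      ⟨none, {}, stk [] [result w ([p], Function.update (fun _ => []) k ((x.map emb).reverse ++ l))]
        [] fun _ => []⟩ (2 * x.length + 1 + (4 * w.length + N + 3)) := by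
  induction x generalizing l v with
  | nil =>
    refine (StepsLE.head (n := 4 * w.length + N + 3) (b := ⟨some .dispatch,
      { v with i := (w.map Sum.inr).head? }, stk (w.map Sum.inr).tail [] ([p].map p.toSub)
      (Function.update (fun _ => []) k l)⟩) ?_ ?_).mono (by simp only [List.length_nil]; omega)
    · cases w <;> simp [mstmt, stk, update_stk_ctl, update_stk_inp]
    · rw [List.length_nil] at hN
      exact stepsLE_dispatch hv rfl (by simp [self_mem_subs]) (by omega) (by simp; omega)
        (length_update_le (by simp) (by omega))
  | cons a x ih =>
    rw [List.length_cons] at hN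
    have h := StepsLE.head (M := mstmt p k emb) (v := v) (l := .load)
      (S := stk ((a :: x).map Sum.inl ++ w.map Sum.inr) [] [] (Function.update (fun _ => []) k l))
      (b := ⟨some (.store a), { v with i := some (.inl a) },
        stk (x.map Sum.inl ++ w.map Sum.inr) [] [] (Function.update (fun _ => []) k l)⟩)
      (by simp [mstmt, stk, update_stk_inp])
      (StepsLE.head (b := ⟨some .load, { v with i := some (.inl a) },
        stk (x.map Sum.inl ++ w.map Sum.inr) [] [] (Function.update (fun _ => []) k (emb a :: l))⟩)
        (by simp [mstmt, stk, update_stk_data])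
        (ih (l := emb a :: l) (v := { v with i := some (.inl a) }) hv
          (by rw [List.length_cons]; omega)))
    rw [List.map_cons (l := x) (f := emb), List.reverse_cons, List.append_assoc,
      List.singleton_append]
    exact h.mono (by rw [List.length_cons]; omega)

/-- The verifier of a program runs in polynomial time. -/
theorem verifier_computable [Fintype Γ] [Fintype A] (p : Prog (StackOp K A)) (k : K)
    (emb : Γ → A) :
    Nonempty (TM2ComputableInPolyTime
      (Computability.encodingProd (Computability.encodingList Γ)
        (Computability.encodingList Bool)).encode
      Computability.encodeBool (verifier p k emb)) := by
  have key : ∀ x : List Γ × List Bool, StepsLE (mstmt p k emb)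
      ⟨some .load, {}, stk (x.1.map Sum.inl ++ x.2.map Sum.inr) [] [] fun _ => []⟩
      ⟨none, {}, stk [] [verifier p k emb x] [] fun _ => []⟩
      (5 * (x.1.length + x.2.length) + 5) := by
    intro x
    have h := stepsLE_load (p := p) (k := k) (emb := emb) (x := x.1) (w := x.2) (l := [])
      (v := {}) rfl le_rfl
    rw [Function.update_eq_self] at h
    rw [List.append_nil] at h
    exact h.mono (by rw [List.length_nil]; omega)
  choose m hm h using key
  refine ⟨{ tm := machine p k emb, inputAlphabet := Equiv.refl _, outputAlphabet := Equiv.refl _,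
            time := Polynomial.C 5 * Polynomial.X + Polynomial.C 5,
            outputsFun := fun x => ⟨⟨m x, ?_⟩, ?_⟩ }⟩
  · have h1 : initList (machine p k emb) (List.map (Equiv.refl (Γ ⊕ Bool)).invFun
        ((Computability.encodingProd (Computability.encodingList Γ)
          (Computability.encodingList Bool)).encode x)) =
        ⟨some .load, {}, stk (x.1.map Sum.inl ++ x.2.map Sum.inr) [] [] fun _ => []⟩ := by
      simp only [initList]
      congr 1
      funext j
      cases j <;> simp [machine, stk, Computability.encodingProd, Computability.encodingList]
      rfl
    have h2 : haltList (machine p k emb) [verifier p k emb x] =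
        ⟨none, {}, stk [] [verifier p k emb x] [] fun _ => []⟩ := by
      simp only [haltList]
      congr 1
      funext j
      cases j <;> simp [machine, stk]
      rfl
    exact (congrArg (fun c => (flip bind (TM2.step (mstmt p k emb)))^[m x] (some c)) h1).trans
      ((h x).trans (congrArg some h2.symm))
  · refine (hm x).trans (le_of_eq ?_)
    simp [Computability.encodingProd, Computability.encodingList]

/-- A language is in NP if its words are recognized by a nondeterministic program within a
polynomial number of steps. -/
theorem inNP_of_run [Fintype Γ] [Fintype A] (L : Language Γ) (p : Prog (StackOp K A)) (k : K)
    (emb : Γ → A) (f : Polynomial ℕ)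
    (sound : ∀ x t n, Run StackOp.sem p (inputStacks k emb x) t n → x ∈ L)
    (complete : ∀ x ∈ L, ∃ t, ∃ n ≤ f.eval x.length, Run StackOp.sem p (inputStacks k emb x) t n) :
    InNP L := by
  refine ⟨Bool, inferInstance, verifier p k emb, f, verifier_computable p k emb, fun x => ?_⟩
  constructor
  · intro hx
    obtain ⟨t, n, hn, h⟩ := complete x hx
    obtain ⟨w, rfl, hw⟩ := exists_verifier_iff.2 ⟨t, h⟩
    exact ⟨w, hn, hw⟩
  · rintro ⟨w, -, hw⟩
    obtain ⟨t, h⟩ := exists_verifier_iff.1 ⟨w, rfl, hw⟩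
    exact sound x t _ h

end Machine

end Prog

namespace Prog
/-! ### Calculus of programs -/

section Calculus

variable {ι κ S T : Type} {sem : ι → S → S → Prop} {p q : Prog ι} {s t u : S} {m n : ℕ}

/-- `Ex sem p s t`: the program `p` has a run from `s` to `t`. -/
def Ex (sem : ι → S → S → Prop) (p : Prog ι) (s t : S) : Prop := ∃ n, Run sem p s t n

/-- `RunLE sem p s t n`: the program `p` has a run of at most `n` steps from `s` to `t`. -/
def RunLE (sem : ι → S → S → Prop) (p : Prog ι) (s t : S) (n : ℕ) : Prop :=
  ∃ m ≤ n, Run sem p s t m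

theorem ex_prim {i : ι} : Ex sem (prim i) s t ↔ sem i s t :=
  ⟨fun ⟨_, h⟩ => by cases h; assumption, fun h => ⟨_, .prim h⟩⟩

theorem ex_skip : Ex sem skip s t ↔ t = s :=
  ⟨fun ⟨_, h⟩ => by cases h; rfl, by rintro rfl; exact ⟨_, .skip⟩⟩

theorem ex_fail : Ex sem fail s t ↔ False :=
  ⟨(nomatch ·), False.elim⟩

theorem ex_seq : Ex sem (seq p q) s t ↔ ∃ u, Ex sem p s u ∧ Ex sem q u t :=
  ⟨fun ⟨_, h⟩ => by cases h with | seq h1 h2 => exact ⟨_, ⟨_, h1⟩, ⟨_, h2⟩⟩,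
    fun ⟨_, ⟨_, h1⟩, ⟨_, h2⟩⟩ => ⟨_, .seq h1 h2⟩⟩

theorem ex_alt : Ex sem (alt p q) s t ↔ Ex sem p s t ∨ Ex sem q s t := by
  constructor
  · rintro ⟨_, h⟩
    cases h with
    | altl h => exact .inl ⟨_, h⟩
    | altr h => exact .inr ⟨_, h⟩
  · rintro (⟨_, h⟩ | ⟨_, h⟩)
    · exact ⟨_, .altl h⟩
    · exact ⟨_, .altr h⟩

theorem Run.reflTransGen (h : Run sem (star p) s t n) : Relation.ReflTransGen (Ex sem p) s t := by
  generalize hq : star p = q at h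
  induction h with
  | star_nil => exact .refl
  | star_cons h1 _ _ ih => cases hq; exact .head ⟨_, h1⟩ (ih rfl)
  | _ => cases hq

theorem ex_star : Ex sem (star p) s t ↔ Relation.ReflTransGen (Ex sem p) s t := by
  constructor
  · rintro ⟨n, h⟩
    exact h.reflTransGen
  · intro h
    induction h using Relation.ReflTransGen.head_induction_on with
    | refl => exact ⟨_, .star_nil⟩
    | head h _ ih =>
      obtain ⟨_, h⟩ := h
      obtain ⟨_, ih⟩ := ih
      exact ⟨_, .star_cons h ih⟩

namespace RunLE

theorem ex (h : RunLE sem p s t n) : Ex sem p s t := let ⟨m, _, h⟩ := h; ⟨m, h⟩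

theorem mono (h : RunLE sem p s t m) (hmn : m ≤ n) : RunLE sem p s t n :=
  let ⟨k, hk, h⟩ := h; ⟨k, hk.trans hmn, h⟩

theorem prim {i : ι} (h : sem i s t) : RunLE sem (prim i) s t 1 := ⟨1, le_rfl, .prim h⟩

theorem skip : RunLE sem skip s s 1 := ⟨1, le_rfl, .skip⟩

theorem seq (h : RunLE sem p s t m) (h' : RunLE sem q t u n) :
    RunLE sem (seq p q) s u (m + n + 1) :=
  let ⟨_, hk, h⟩ := h; let ⟨_, hl, h'⟩ := h'; ⟨_, by omega, .seq h h'⟩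

theorem altl (h : RunLE sem p s t n) : RunLE sem (alt p q) s t (n + 1) :=
  let ⟨_, hk, h⟩ := h; ⟨_, by omega, .altl h⟩

theorem altr (h : RunLE sem q s t n) : RunLE sem (alt p q) s t (n + 1) :=
  let ⟨_, hk, h⟩ := h; ⟨_, by omega, .altr h⟩

theorem star_nil : RunLE sem (star p) s s 1 := ⟨1, le_rfl, .star_nil⟩

theorem star_cons (h : RunLE sem p s t m) (h' : RunLE sem (star p) t u n) :
    RunLE sem (star p) s u (m + n + 1) :=
  let ⟨_, hk, h⟩ := h; let ⟨_, hl, h'⟩ := h'; ⟨_, by omega, .star_cons h h'⟩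

theorem star_append (h : RunLE sem (star p) s t m) (h' : RunLE sem (star p) t u n) :
    RunLE sem (star p) s u (m + n) := by
  obtain ⟨k, hk, h⟩ := h
  suffices h : RunLE sem (star p) s u (k + n) from h.mono (by omega)
  clear hk
  generalize hq : star p = q at h
  induction h with
  | star_nil => cases hq; exact h'.mono (by omega)
  | star_cons h1 _ _ ih => cases hq; exact (star_cons ⟨_, le_rfl, h1⟩ (ih h' rfl)).mono (by omega)
  | _ => cases hq

end RunLE

/-- The nondeterministic choice between the programs of a list. -/
def choice (l : List (Prog ι)) : Prog ι := l.foldr alt fail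

theorem ex_choice {l : List (Prog ι)} : Ex sem (choice l) s t ↔ ∃ p ∈ l, Ex sem p s t := by
  induction l with
  | nil => simp [choice, ex_fail]
  | cons p l ih =>
    rw [show choice (p :: l) = alt p (choice l) from rfl, ex_alt, ih]
    simp

theorem RunLE.choice {l : List (Prog ι)} (hp : p ∈ l) (h : RunLE sem p s t n) :
    RunLE sem (choice l) s t (n + l.length) := by
  induction l with
  | nil => cases hp
  | cons q l ih =>
    rw [show Prog.choice (q :: l) = alt q (Prog.choice l) from rfl, List.length_cons]
    rcases List.mem_cons.1 hp with rfl | hp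
    · exact h.altl.mono (by omega)
    · exact (ih hp).altr

/-- The nondeterministic choice between the programs of a finite family. -/
noncomputable def any {α : Type} [Fintype α] (f : α → Prog ι) : Prog ι :=
  choice (Finset.univ.toList.map f)

theorem ex_any {α : Type} [Fintype α] {f : α → Prog ι} :
    Ex sem (any f) s t ↔ ∃ a, Ex sem (f a) s t := by
  simp [any, ex_choice]

theorem RunLE.any {α : Type} [Fintype α] {f : α → Prog ι} (a : α) (h : RunLE sem (f a) s t n) :
    RunLE sem (any f) s t (n + Fintype.card α) :=
  (RunLE.choice (List.mem_map_of_mem (by simp)) h).mono (by simp)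

/-- Replace every operation of a program by a program. -/
def bind (f : ι → Prog κ) : Prog ι → Prog κ
  | prim i => f i
  | skip => skip
  | fail => fail
  | seq p q => seq (bind f p) (bind f q)
  | alt p q => alt (bind f p) (bind f q)
  | star p => star (bind f p)

variable {sem' : κ → T → T → Prop} {f : ι → Prog κ} {Rep : T → S → Prop}

/-- If the implementations of the operations do nothing but what the operations may do, up to the
representation `Rep` of states, then the same holds for all programs. -/
theorem Ex.of_bind
    (h : ∀ i a a' s, Rep a s → Ex sem' (f i) a a' → ∃ s', sem i s s' ∧ Rep a' s')
    {a a' : T} (ha : Rep a s) (h' : Ex sem' (p.bind f) a a') :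
    ∃ s', Ex sem p s s' ∧ Rep a' s' := by
  induction p generalizing a a' s with
  | prim i =>
    obtain ⟨s', h1, h2⟩ := h i a a' s ha h'
    exact ⟨s', ex_prim.2 h1, h2⟩
  | skip => rw [bind, ex_skip] at h'; subst h'; exact ⟨s, ex_skip.2 rfl, ha⟩
  | fail => rw [bind, ex_fail] at h'; exact h'.elim
  | seq p q ihp ihq =>
    obtain ⟨b, h1, h2⟩ := ex_seq.1 h'
    obtain ⟨s1, h3, h4⟩ := ihp ha h1
    obtain ⟨s2, h5, h6⟩ := ihq h4 h2
    exact ⟨s2, ex_seq.2 ⟨s1, h3, h5⟩, h6⟩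
  | alt p q ihp ihq =>
    rcases ex_alt.1 h' with h1 | h1
    · obtain ⟨s1, h3, h4⟩ := ihp ha h1
      exact ⟨s1, ex_alt.2 (.inl h3), h4⟩
    · obtain ⟨s1, h3, h4⟩ := ihq ha h1
      exact ⟨s1, ex_alt.2 (.inr h3), h4⟩
  | star p ih =>
    rw [bind, ex_star] at h'
    induction h' using Relation.ReflTransGen.head_induction_on generalizing s with
    | refl => exact ⟨s, ex_star.2 .refl, ha⟩
    | head h1 _ ih' =>
      obtain ⟨s1, h3, h4⟩ := ih ha h1
      obtain ⟨s2, h5, h6⟩ := ih' h4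
      exact ⟨s2, ex_star.2 (.head h3 (ex_star.1 h5)), h6⟩

/-- If every operation is implemented by a program with at most `c` steps, then every run of `n`
steps gives rise to a run of at most `c * n` steps of the implementation. -/
theorem Run.bind {c : ℕ} (hc : 1 ≤ c)
    (h : ∀ i a s s', Rep a s → sem i s s' → ∃ a', RunLE sem' (f i) a a' c ∧ Rep a' s')
    {a : T} (ha : Rep a s) (h' : Run sem p s t n) :
    ∃ a', RunLE sem' (p.bind f) a a' (c * n) ∧ Rep a' t := by
  induction h' generalizing a with
  | prim h1 => rw [mul_one]; exact h _ _ _ _ ha h1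
  | skip => exact ⟨a, RunLE.skip.mono (by omega), ha⟩
  | seq _ _ ih1 ih2 =>
    obtain ⟨b, h1, hb⟩ := ih1 ha
    obtain ⟨b', h2, hb'⟩ := ih2 hb
    exact ⟨b', (h1.seq h2).mono (by rw [mul_add, mul_add]; omega), hb'⟩
  | altl _ ih =>
    obtain ⟨b, h1, hb⟩ := ih ha
    exact ⟨b, h1.altl.mono (by rw [mul_add]; omega), hb⟩
  | altr _ ih =>
    obtain ⟨b, h1, hb⟩ := ih ha
    exact ⟨b, h1.altr.mono (by rw [mul_add]; omega), hb⟩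
  | star_nil => exact ⟨a, RunLE.star_nil.mono (by omega), ha⟩
  | star_cons _ _ ih1 ih2 =>
    obtain ⟨b, h1, hb⟩ := ih1 ha
    obtain ⟨b', h2, hb'⟩ := ih2 hb
    exact ⟨b', (h1.star_cons h2).mono (by rw [mul_add, mul_add]; omega), hb'⟩

theorem RunLE.bind {c : ℕ} (hc : 1 ≤ c)
    (h : ∀ i a s s', Rep a s → sem i s s' → ∃ a', RunLE sem' (f i) a a' c ∧ Rep a' s')
    {a : T} (ha : Rep a s) (h' : RunLE sem p s t n) :
    ∃ a', RunLE sem' (p.bind f) a a' (c * n) ∧ Rep a' t := by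
  obtain ⟨m, hm, h'⟩ := h'
  obtain ⟨a', h1, h2⟩ := h'.bind hc h ha
  exact ⟨a', h1.mono (Nat.mul_le_mul_left c hm), h2⟩

end Calculus

end Prog

/-! ### Register machines with synchronous binary arithmetic -/

namespace RegMachine

open Prog

section

variable (R M G : Type)

/-- The symbols on the stacks of a register machine: columns, which hold one bit of every register,
carries, one bit of each coordinate of a point, and input symbols. -/
abbrev Alph : Type := (R → Bool) ⊕ Bool ⊕ (Bool × Bool) ⊕ G

/-- The stacks of a register machine: the registers are an array of columns, which is cut into the
stacks `right` and `left`, and there are stacks for a carry, for the input in reversed and in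
correct order, and for the lists `mem m` of points. -/
inductive Key
  | right
  | left
  | carry
  | rev
  | inp
  | mem (m : M)
  deriving DecidableEq, Fintype

variable {R M G}

/-- A column, as a symbol. -/
def Alph.col (a : R → Bool) : Alph R G := .inl a

/-- A carry, as a symbol. -/
def Alph.car (a : Bool) : Alph R G := .inr (.inl a)

/-- A pair of bits of the coordinates of a point, as a symbol. -/
def Alph.pt (a : Bool × Bool) : Alph R G := .inr (.inr (.inl a))

/-- An input symbol, as a symbol. -/
def Alph.sym (a : G) : Alph R G := .inr (.inr (.inr a))

variable (M G) in
/-- The contents of the stacks other than `left` and `right`. -/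
@[ext] structure Rest where
  carry : List Bool
  rev : List G
  inp : List G
  mem : M → List (Bool × Bool)

/-- The contents of all stacks. -/
def st (r l : List (R → Bool)) (u : Rest M G) : Key M → List (Alph R G)
  | .right => r.map .col
  | .left => l.map .col
  | .carry => u.carry.map .car
  | .rev => u.rev.map .sym
  | .inp => u.inp.map .sym
  | .mem m => (u.mem m).map .pt

/-- The elementary programs of a register machine. -/
abbrev RProg (R M G : Type) : Type := Prog (StackOp (Key M) (Alph R G))

variable [DecidableEq M] {r l : List (R → Bool)} {u : Rest M G} {t : Key M → List (Alph R G)}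

section Stacks

variable {B : Type} {e : B → Alph R G} {k : Key M} {s : Key M → List (Alph R G)} {b : List B}
  {a : B}

theorem sem_push (hk : s k = b.map e) :
    StackOp.sem (.push k (e a)) s t ↔ t = Function.update s k ((a :: b).map e) := by
  simp [StackOp.sem, hk]

theorem sem_pop (he : Function.Injective e) (hk : s k = b.map e) :
    StackOp.sem (.pop k (e a)) s t ↔ ∃ b', b = a :: b' ∧ t = Function.update s k (b'.map e) := by
  simp only [StackOp.sem, hk, List.map_eq_cons_iff]
  constructor
  · rintro ⟨_, ⟨a', b', rfl, h, rfl⟩, rfl⟩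
    exact ⟨b', by rw [he h], rfl⟩
  · rintro ⟨b', rfl, rfl⟩
    exact ⟨_, ⟨a, b', rfl, rfl, rfl⟩, rfl⟩

end Stacks

theorem update_right (r') : Function.update (st r l u) .right (r'.map .col) = st r' l u := by
  funext k; cases k <;> simp [st]

theorem update_left (l') : Function.update (st r l u) .left (l'.map .col) = st r l' u := by
  funext k; cases k <;> simp [st]

theorem update_carry (c) :
    Function.update (st r l u) .carry (c.map .car) = st r l { u with carry := c } := by
  funext k; cases k <;> simp [st]

theorem update_rev (x) :
    Function.update (st r l u) .rev (x.map .sym) = st r l { u with rev := x } := by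
  funext k; cases k <;> simp [st]

theorem update_inp (x) :
    Function.update (st r l u) .inp (x.map .sym) = st r l { u with inp := x } := by
  funext k; cases k <;> simp [st]

theorem update_mem (m : M) (x) : Function.update (st r l u) (.mem m) (x.map .pt) =
    st r l { u with mem := Function.update u.mem m x } := by
  funext k
  cases k with
  | mem j =>
    by_cases h : j = m
    · subst h; simp [st]
    · simp [st, h]
  | _ => simp [st]

theorem sem_push_right {a} : StackOp.sem (.push .right (.col a)) (st r l u) t ↔
    t = st (a :: r) l u := by
  rw [sem_push (b := r) rfl, update_right]

theorem sem_push_left {a} : StackOp.sem (.push .left (.col a)) (st r l u) t ↔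
    t = st r (a :: l) u := by
  rw [sem_push (b := l) rfl, update_left]

theorem sem_push_carry {a} : StackOp.sem (.push .carry (.car a)) (st r l u) t ↔
    t = st r l { u with carry := a :: u.carry } := by
  rw [sem_push (b := u.carry) rfl, update_carry]

theorem sem_push_inp {a} : StackOp.sem (.push .inp (.sym a)) (st r l u) t ↔
    t = st r l { u with inp := a :: u.inp } := by
  rw [sem_push (b := u.inp) rfl, update_inp]

theorem sem_push_mem {m a} : StackOp.sem (.push (.mem m) (.pt a)) (st r l u) t ↔
    t = st r l { u with mem := Function.update u.mem m (a :: u.mem m) } := by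
  rw [sem_push (b := u.mem m) rfl, update_mem]

theorem col_injective : Function.Injective (Alph.col : (R → Bool) → Alph R G) :=
  Sum.inl_injective

theorem car_injective : Function.Injective (Alph.car : Bool → Alph R G) :=
  Sum.inr_injective.comp Sum.inl_injective

theorem pt_injective : Function.Injective (Alph.pt : Bool × Bool → Alph R G) :=
  Sum.inr_injective.comp (Sum.inr_injective.comp Sum.inl_injective)

theorem sym_injective : Function.Injective (Alph.sym : G → Alph R G) :=
  Sum.inr_injective.comp (Sum.inr_injective.comp Sum.inr_injective)

theorem sem_pop_right {a} : StackOp.sem (.pop .right (.col a)) (st r l u) t ↔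
    ∃ r', r = a :: r' ∧ t = st r' l u := by
  rw [sem_pop col_injective (b := r) rfl]
  simp only [update_right]

theorem sem_pop_left {a} : StackOp.sem (.pop .left (.col a)) (st r l u) t ↔
    ∃ l', l = a :: l' ∧ t = st r l' u := by
  rw [sem_pop col_injective (b := l) rfl]
  simp only [update_left]

theorem sem_pop_carry {a} : StackOp.sem (.pop .carry (.car a)) (st r l u) t ↔
    ∃ c, u.carry = a :: c ∧ t = st r l { u with carry := c } := by
  rw [sem_pop car_injective (b := u.carry) rfl]
  simp only [update_carry]

theorem sem_pop_rev {a} : StackOp.sem (.pop .rev (.sym a)) (st r l u) t ↔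
    ∃ c, u.rev = a :: c ∧ t = st r l { u with rev := c } := by
  rw [sem_pop sym_injective (b := u.rev) rfl]
  simp only [update_rev]

theorem sem_pop_inp {a} : StackOp.sem (.pop .inp (.sym a)) (st r l u) t ↔
    ∃ c, u.inp = a :: c ∧ t = st r l { u with inp := c } := by
  rw [sem_pop sym_injective (b := u.inp) rfl]
  simp only [update_inp]

theorem sem_pop_mem {m a} : StackOp.sem (.pop (.mem m) (.pt a)) (st r l u) t ↔
    ∃ c, u.mem m = a :: c ∧ t = st r l { u with mem := Function.update u.mem m c } := by
  rw [sem_pop pt_injective (b := u.mem m) rfl]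
  simp only [update_mem]

theorem sem_isEmpty_right :
    StackOp.sem (.isEmpty .right) (st r l u) t ↔ r = [] ∧ t = st r l u := by
  simp [StackOp.sem, st]

theorem sem_isEmpty_left :
    StackOp.sem (.isEmpty .left) (st r l u) t ↔ l = [] ∧ t = st r l u := by
  simp [StackOp.sem, st]

theorem sem_isEmpty_rev :
    StackOp.sem (.isEmpty .rev) (st r l u) t ↔ u.rev = [] ∧ t = st r l u := by
  simp [StackOp.sem, st]

theorem sem_isEmpty_inp :
    StackOp.sem (.isEmpty .inp) (st r l u) t ↔ u.inp = [] ∧ t = st r l u := by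
  simp [StackOp.sem, st]

theorem sem_isEmpty_mem {m} :
    StackOp.sem (.isEmpty (.mem m)) (st r l u) t ↔ u.mem m = [] ∧ t = st r l u := by
  simp [StackOp.sem, st]

/-! ### Sweeps over the registers -/

/-- `Fold ρ r r' u u'`: reading the columns `r` one after the other, the relation `ρ` may replace
them by `r'`, thereby changing the contents of the other stacks from `u` to `u'`. -/
inductive Fold {C U : Type} (ρ : C → C → U → U → Prop) : List C → List C → U → U → Prop
  | nil {u : U} : Fold ρ [] [] u u
  | cons {a b r r' u u' u''} : ρ a b u u' → Fold ρ r r' u' u'' → Fold ρ (a :: r) (b :: r') u u''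

/-- A sweep: move all columns from the stack `k` to the stack `k'`; while the column `a` is replaced
by `b`, the program `body a b` is executed. -/
noncomputable def sweep [Fintype R] [DecidableEq R] (k k' : Key M)
    (body : (R → Bool) → (R → Bool) → RProg R M G) : RProg R M G :=
  seq (star (Prog.any fun ab : (R → Bool) × (R → Bool) =>
    seq (prim (.pop k (.col ab.1))) (seq (body ab.1 ab.2) (prim (.push k' (.col ab.2))))))
    (prim (.isEmpty k))

section sweep

variable [Fintype R] [DecidableEq R] {k k' : Key M} {body : (R → Bool) → (R → Bool) → RProg R M G}
  {Z : List (R → Bool) → List (R → Bool) → Rest M G → Key M → List (Alph R G)}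
  {ρ : (R → Bool) → (R → Bool) → Rest M G → Rest M G → Prop}

theorem Fold.of_sweep
    (h1 : ∀ a r l u t, StackOp.sem (.pop k (.col a)) (Z r l u) t → ∃ r', r = a :: r' ∧ t = Z r' l u)
    (h2 : ∀ a r l u t, StackOp.sem (.push k' (.col a)) (Z r l u) t → t = Z r (a :: l) u)
    (h3 : ∀ r l u t, StackOp.sem (.isEmpty k) (Z r l u) t → r = [] ∧ t = Z r l u)
    (hb : ∀ a b r l u t, Ex StackOp.sem (body a b) (Z r l u) t → ∃ u', ρ a b u u' ∧ t = Z r l u')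
    {r l : List (R → Bool)} {u : Rest M G} {t : Key M → List (Alph R G)}
    (h : Ex StackOp.sem (sweep k k' body) (Z r l u) t) :
    ∃ r' u', Fold ρ r r' u u' ∧ t = Z [] (r'.reverse ++ l) u' := by
  rw [sweep, ex_seq] at h
  obtain ⟨s, h, h'⟩ := h
  rw [ex_star] at h
  rw [ex_prim] at h'
  generalize hs : Z r l u = s₀ at h
  induction h using Relation.ReflTransGen.head_induction_on generalizing r l u with
  | refl =>
    subst hs
    obtain ⟨rfl, rfl⟩ := h3 _ _ _ _ h'
    exact ⟨[], u, .nil, rfl⟩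
  | head h _ ih =>
    subst hs
    obtain ⟨⟨a, b⟩, h⟩ := ex_any.1 h
    obtain ⟨s1, i1, h⟩ := ex_seq.1 h
    obtain ⟨s2, i2, i3⟩ := ex_seq.1 h
    obtain ⟨r1, rfl, rfl⟩ := h1 _ _ _ _ _ (ex_prim.1 i1)
    obtain ⟨u1, hu1, rfl⟩ := hb _ _ _ _ _ _ i2
    obtain rfl := h2 _ _ _ _ _ (ex_prim.1 i3)
    obtain ⟨r', u', hF, ht⟩ := ih rfl
    exact ⟨b :: r', u', .cons hu1 hF, by simpa using ht⟩

theorem Fold.runLE_sweep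
    (h1 : ∀ a r l u, StackOp.sem (.pop k (.col a)) (Z (a :: r) l u) (Z r l u))
    (h2 : ∀ a r l u, StackOp.sem (.push k' (.col a)) (Z r l u) (Z r (a :: l) u))
    (h3 : ∀ l u, StackOp.sem (.isEmpty k) (Z [] l u) (Z [] l u)) {c : ℕ}
    (hb : ∀ a b r l u u', ρ a b u u' → RunLE StackOp.sem (body a b) (Z r l u) (Z r l u') c)
    {r r' l : List (R → Bool)} {u u' : Rest M G} (h : Fold ρ r r' u u') :
    RunLE StackOp.sem (sweep k k' body) (Z r l u) (Z [] (r'.reverse ++ l) u')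
      ((c + 5 + Fintype.card ((R → Bool) × (R → Bool))) * (r.length + 1)) := by
  suffices h : RunLE StackOp.sem (star (Prog.any fun ab : (R → Bool) × (R → Bool) =>
      Prog.seq (prim (.pop k (.col ab.1))) (Prog.seq (body ab.1 ab.2)
        (prim (.push k' (.col ab.2))))))
      (Z r l u) (Z [] (r'.reverse ++ l) u')
      ((c + 5 + Fintype.card ((R → Bool) × (R → Bool))) * r.length + 1) from
    (h.seq (.prim (h3 _ _))).mono (by rw [mul_add]; omega)
  induction h generalizing l with
  | nil => exact RunLE.star_nil
  | @cons a b r r' u u' u'' hρ _ ih =>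
    have step := RunLE.any
      (f := fun ab : (R → Bool) × (R → Bool) => Prog.seq (prim (.pop k (.col ab.1)))
        (Prog.seq (body ab.1 ab.2) (prim (.push k' (.col ab.2))))) (a, b)
      ((RunLE.prim (h1 a r l u)).seq ((hb a b r l u u' hρ).seq (RunLE.prim (h2 b r l u'))))
    have := step.star_cons (ih (l := b :: l))
    rw [List.reverse_cons, List.append_assoc, List.singleton_append]
    exact this.mono (by rw [List.length_cons, mul_add]; omega)

end sweep

end

/-! ### Binary numbers -/

section

/-- The number with a given list of binary digits, the least significant one first. -/
def bval : List Bool → ℕ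
  | [] => 0
  | b :: l => b.toNat + 2 * bval l

/-- The number with `W` given binary digits. -/
def val {W : ℕ} (f : Fin W → Bool) : ℕ := bval (List.ofFn f)

theorem exists_val_eq {W n : ℕ} (h : n < 2 ^ W) : ∃ f : Fin W → Bool, val f = n := by
  induction W generalizing n with
  | zero => exact ⟨Fin.elim0, by simp [val, bval]; omega⟩
  | succ W ih =>
    obtain ⟨f, hf⟩ := ih (n := n / 2) (by rw [pow_succ] at h; omega)
    refine ⟨Fin.cons (decide (n % 2 = 1)) f, ?_⟩
    simp only [val, List.ofFn_cons, bval] at hf ⊢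
    rw [hf]
    by_cases h2 : n % 2 = 1 <;> simp [h2] <;> omega

end

/-! ### The operations of a register machine -/

/-- The operations of a register machine: guess the value of a register; replace the value of the
register `a` so that `P = Q + S + k`, where an operand `(false, r)` is the old and `(true, r)` is
the new value of `r`; pop a point with coordinates `p`, `q` from a list, or push it; read an input
symbol; test for the end of the input, or whether a list is empty. -/
inductive RegOp (R M G : Type)
  | guess (a : R)
  | lin (a : R) (k : Bool) (P Q S : Bool × R)
  | pop (m : M) (p q : R)
  | push (m : M) (p q : R)
  | inp (c : G)
  | inpEnd
  | memEnd (m : M)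

/-- The states of a register machine whose registers have `W` binary digits. -/
@[ext] structure RState (R M G : Type) (W : ℕ) where
  reg : R → Fin W → Bool
  mem : M → List ((Fin W → Bool) × (Fin W → Bool))
  inp : List G

/-- The value of an operand. -/
def operand {R α : Type} (s t : R → α) (o : Bool × R) : α := if o.1 then t o.2 else s o.2

section

variable {R M G : Type} [DecidableEq M] {W : ℕ}

open Classical in
/-- Execute the program `p` if the condition `P`, which is known in advance, is true, and fail
otherwise. In a sweep, the condition is a relation of the old and the new column. -/
noncomputable def guard (P : Prop) (p : RProg R M G) : RProg R M G := if P then p else fail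

theorem ex_guard {P : Prop} {p : RProg R M G} {s t} :
    Ex StackOp.sem (guard P p) s t ↔ P ∧ Ex StackOp.sem p s t := by
  by_cases h : P <;> simp [guard, h, ex_fail]

theorem runLE_guard {P : Prop} {p : RProg R M G} {s t n} (h : P)
    (h' : RunLE StackOp.sem p s t n) : RunLE StackOp.sem (guard P p) s t n := by
  rwa [guard, if_pos h]

variable [DecidableEq R]

/-- The effect of an operation. -/
def RegOp.sem : RegOp R M G → RState R M G W → RState R M G W → Prop
  | .guess a, s, t => ∃ v, t = { s with reg := Function.update s.reg a v }
  | .lin a k P Q S, s, t => ∃ v, t = { s with reg := Function.update s.reg a v } ∧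
      val (operand s.reg t.reg P) = val (operand s.reg t.reg Q) + val (operand s.reg t.reg S)
        + k.toNat
  | .pop m p q, s, t => ∃ l, s.mem m = (s.reg p, s.reg q) :: l ∧
      t = { s with mem := Function.update s.mem m l }
  | .push m p q, s, t =>
      t = { s with mem := Function.update s.mem m ((s.reg p, s.reg q) :: s.mem m) }
  | .inp c, s, t => ∃ l, s.inp = c :: l ∧ t = { s with inp := l }
  | .inpEnd, s, t => s.inp = [] ∧ t = s
  | .memEnd m, s, t => s.mem m = [] ∧ t = s

/-- The columns of the register array. -/
def RState.cols (s : RState R M G W) : List (R → Bool) := List.ofFn fun i r => s.reg r i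

/-- The digits of a list of points. -/
def digits (l : List ((Fin W → Bool) × (Fin W → Bool))) : List (Bool × Bool) :=
  l.flatMap fun pq => List.ofFn fun i => (pq.1 i, pq.2 i)

/-- The stacks that represent a state. -/
def RState.stacks (s : RState R M G W) : Key M → List (Alph R G) :=
  st s.cols [] ⟨[], [], s.inp, fun m => digits (s.mem m)⟩

variable [Fintype R]

/-- Move all columns back. -/
noncomputable def restore : RProg R M G := sweep .left .right fun a b => guard (b = a) skip

/-- Whether a full adder with carry `c` and new carry `c'` relates the bits of the operands. -/
def addBits (a b : R → Bool) (P Q S : Bool × R) (c c' : Bool) : Prop :=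
  (operand a b P).toNat + 2 * c'.toNat = (operand a b Q).toNat + (operand a b S).toNat + c.toNat

/-- Programs for the operations. -/
noncomputable def RegOp.prog : RegOp R M G → RProg R M G
  | .guess x => seq (sweep .right .left fun a b => guard (∀ r ≠ x, b r = a r) skip) restore
  | .lin x k P Q S => seq (prim (.push .carry (.car k))) (seq
      (seq (sweep .right .left fun a b => guard (∀ r ≠ x, b r = a r)
        (Prog.any fun cc : Bool × Bool => guard (addBits a b P Q S cc.1 cc.2)
          (seq (prim (.pop .carry (.car cc.1))) (prim (.push .carry (.car cc.2))))))
        restore)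
      (prim (.pop .carry (.car false))))
  | .pop m p q => seq (sweep .right .left fun a b => guard (b = a)
      (prim (.pop (.mem m) (.pt (a p, a q))))) restore
  | .push m p q => seq (sweep .right .left fun a b => guard (b = a) skip)
      (sweep .left .right fun a b => guard (b = a) (prim (.push (.mem m) (.pt (a p, a q)))))
  | .inp c => prim (.pop .inp (.sym c))
  | .inpEnd => prim (.isEmpty .inp)
  | .memEnd m => prim (.isEmpty (.mem m))

section sweeps

variable {body : (R → Bool) → (R → Bool) → RProg R M G} {c : ℕ}
  {ρ : (R → Bool) → (R → Bool) → Rest M G → Rest M G → Prop}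

theorem Fold.of_sweep_right
    (hb : ∀ a b r l u t, Ex StackOp.sem (body a b) (st r l u) t → ∃ u', ρ a b u u' ∧ t = st r l u')
    {r : List (R → Bool)} {u : Rest M G} {t : Key M → List (Alph R G)}
    (h : Ex StackOp.sem (sweep .right .left body) (st r [] u) t) :
    ∃ r' u', Fold ρ r r' u u' ∧ t = st [] r'.reverse u' := by
  obtain ⟨r', u', h1, h2⟩ := Fold.of_sweep (Z := st) (fun _ _ _ _ _ => sem_pop_right.1)
    (fun _ _ _ _ _ => sem_push_left.1) (fun _ _ _ _ => sem_isEmpty_right.1) hb h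
  exact ⟨r', u', h1, by simpa using h2⟩

theorem Fold.of_sweep_left
    (hb : ∀ a b r l u t, Ex StackOp.sem (body a b) (st r l u) t → ∃ u', ρ a b u u' ∧ t = st r l u')
    {l : List (R → Bool)} {u : Rest M G} {t : Key M → List (Alph R G)}
    (h : Ex StackOp.sem (sweep .left .right body) (st [] l u) t) :
    ∃ l' u', Fold ρ l l' u u' ∧ t = st l'.reverse [] u' := by
  obtain ⟨r', u', h1, h2⟩ := Fold.of_sweep (Z := fun r l u => st l r u)
    (fun _ _ _ _ _ => sem_pop_left.1) (fun _ _ _ _ _ => sem_push_right.1)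
    (fun _ _ _ _ => sem_isEmpty_left.1) (fun a b r l u t => hb a b l r u t) h
  exact ⟨r', u', h1, by simpa using h2⟩

/-- A bound for the number of steps that a sweep spends on each column. -/
noncomputable def sweepCost (R : Type) [Fintype R] [DecidableEq R] (c : ℕ) : ℕ :=
  c + 5 + Fintype.card ((R → Bool) × (R → Bool))

theorem Fold.runLE_right
    (hb : ∀ a b r l u u', ρ a b u u' → RunLE StackOp.sem (body a b) (st r l u) (st r l u') c)
    {r r' : List (R → Bool)} {u u' : Rest M G} (h : Fold ρ r r' u u') :
    RunLE StackOp.sem (sweep .right .left body) (st r [] u) (st [] r'.reverse u')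
      (sweepCost R c * (r.length + 1)) := by
  have := Fold.runLE_sweep (Z := st) (l := []) (k := .right) (k' := .left)
    (fun _ _ _ _ => sem_pop_right.2 ⟨_, rfl, rfl⟩)
    (fun _ _ _ _ => sem_push_left.2 rfl) (fun _ _ => sem_isEmpty_right.2 ⟨rfl, rfl⟩) hb h
  rwa [List.append_nil] at this

theorem Fold.runLE_left
    (hb : ∀ a b r l u u', ρ a b u u' → RunLE StackOp.sem (body a b) (st r l u) (st r l u') c)
    {l l' : List (R → Bool)} {u u' : Rest M G} (h : Fold ρ l l' u u') :
    RunLE StackOp.sem (sweep .left .right body) (st [] l u) (st l'.reverse [] u')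
      (sweepCost R c * (l.length + 1)) := by
  have := Fold.runLE_sweep (Z := fun r l u => st l r u) (l := []) (k := .left) (k' := .right)
    (fun _ _ _ _ => sem_pop_left.2 ⟨_, rfl, rfl⟩)
    (fun _ _ _ _ => sem_push_right.2 rfl) (fun _ _ => sem_isEmpty_left.2 ⟨rfl, rfl⟩)
    (fun a b r l u u' => hb a b l r u u') h
  rwa [List.append_nil] at this

end sweeps

section folds

variable {C U : Type} {r r' : List C} {u u' : U}

theorem fold_and_eq {P : C → C → Prop} :
    Fold (fun a b u u' => P a b ∧ u' = u) r r' u u' ↔ List.Forall₂ P r r' ∧ u' = u := by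
  constructor
  · intro h
    induction h with
    | nil => exact ⟨.nil, rfl⟩
    | cons h _ ih => exact ⟨.cons h.1 ih.1, by rw [ih.2, h.2]⟩
  · rintro ⟨h, rfl⟩
    induction h with
    | nil => exact .nil
    | cons h _ ih => exact .cons ⟨h, rfl⟩ ih

theorem fold_eq_and_eq :
    Fold (fun a b u u' => b = a ∧ u' = u) r r' u u' ↔ r' = r ∧ u' = u := by
  rw [fold_and_eq]
  refine and_congr_left fun _ => ?_
  constructor
  · intro h
    induction h with
    | nil => rfl
    | cons h _ ih => rw [h, ih]
  · rintro rfl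
    exact List.forall₂_refl _

theorem forall₂_ofFn {P : C → C → Prop} {f : Fin W → C} :
    List.Forall₂ P (List.ofFn f) r' ↔ ∃ g, r' = List.ofFn g ∧ ∀ i, P (f i) (g i) := by
  induction W generalizing r' with
  | zero => simp
  | succ W ih =>
    rw [List.ofFn_succ, List.forall₂_cons_left_iff]
    simp only [ih]
    constructor
    · rintro ⟨b, _, h, ⟨g, rfl, hg⟩, rfl⟩
      exact ⟨Fin.cons b g, by simp, Fin.cases (by simpa using h) (by simpa using hg)⟩
    · rintro ⟨g, rfl, hg⟩
      exact ⟨g 0, _, hg 0, ⟨_, rfl, fun i => hg i.succ⟩, by rw [List.ofFn_succ]⟩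

/-- The fold of the popping sweep. -/
theorem fold_pop {m : M} {f : C → Bool × Bool} {r r' : List C} {u u' : Rest M G} :
    Fold (fun a b u u' => b = a ∧ ∃ c, u.mem m = f a :: c ∧
      u' = { u with mem := Function.update u.mem m c }) r r' u u' ↔
    r' = r ∧ ∃ c, u.mem m = r.map f ++ c ∧ u' = { u with mem := Function.update u.mem m c } := by
  constructor
  · intro h
    induction h with
    | @nil u => exact ⟨rfl, u.mem m, rfl, by simp⟩
    | cons h _ ih =>
      obtain ⟨rfl, c, h1, rfl⟩ := h
      obtain ⟨rfl, c', h2, rfl⟩ := ih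
      refine ⟨rfl, c', ?_, by simp⟩
      rw [h1, List.map_cons, List.cons_append, ← h2]
      simp
  · rintro ⟨rfl, c, h, rfl⟩
    induction r' generalizing u with
    | nil =>
      obtain rfl : u.mem m = c := h
      convert Fold.nil
      simp
    | cons a r ih =>
      have := ih (u := { u with mem := Function.update u.mem m (r.map f ++ c) }) (by simp)
      refine .cons ⟨rfl, r.map f ++ c, h, rfl⟩ ?_
      simpa using this

/-- The fold of the pushing sweep. -/
theorem fold_push {m : M} {f : C → Bool × Bool} {r r' : List C} {u u' : Rest M G} :
    Fold (fun a b u u' => b = a ∧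
      u' = { u with mem := Function.update u.mem m (f a :: u.mem m) }) r r' u u' ↔
    r' = r ∧ u' = { u with mem := Function.update u.mem m ((r.map f).reverse ++ u.mem m) } := by
  constructor
  · intro h
    induction h with
    | nil => exact ⟨rfl, by simp⟩
    | cons h _ ih =>
      obtain ⟨rfl, rfl⟩ := h
      obtain ⟨rfl, rfl⟩ := ih
      exact ⟨rfl, by simp⟩
  · rintro ⟨rfl, rfl⟩
    induction r' generalizing u with
    | nil =>
      convert Fold.nil
      simp
    | cons a r ih =>
      have := ih (u := { u with mem := Function.update u.mem m (f a :: u.mem m) })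
      refine .cons ⟨rfl, rfl⟩ ?_
      simpa using this

/-- The digits of the register `x`. -/
def track (r : List (R → Bool)) (x : R) : List Bool := r.map (· x)

/-- Serial addition is correct. -/
theorem fold_lin {x : R} {P Q S : Bool × R} {r r' : List (R → Bool)} {k : Bool} {cs : List Bool}
    {u u' : Rest M G} (hu : u.carry = k :: cs) :
    Fold (fun a b u u' => (∀ r ≠ x, b r = a r) ∧ ∃ c c', addBits a b P Q S c c' ∧
      ∃ cs, u.carry = c :: cs ∧ u' = { u with carry := c' :: cs }) r r' u u' ↔
    List.Forall₂ (fun a b => ∀ r ≠ x, b r = a r) r r' ∧ ∃ k' : Bool,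
      bval (operand (track r) (track r') P) + 2 ^ r.length * k'.toNat =
      bval (operand (track r) (track r') Q) +
      bval (operand (track r) (track r') S) + k.toNat ∧
      u' = { u with carry := k' :: cs } := by
  have op : ∀ (a b : R → Bool) (r r' : List (R → Bool)) (o : Bool × R),
      bval (operand (track (a :: r)) (track (b :: r')) o) =
      (operand a b o).toNat + 2 * bval (operand (track r) (track r') o) := by
    intro a b r r' o
    unfold operand
    split_ifs <;> simp [track, bval]
  have op0 : ∀ o : Bool × R,
      bval (operand (track ([] : List (R → Bool))) (track []) o) = 0 := by
    intro o
    unfold operand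
    split_ifs <;> rfl
  constructor
  · intro h
    induction h generalizing k with
    | @nil u => exact ⟨.nil, k, by simp [op0], by rw [← hu]⟩
    | cons h _ ih =>
      obtain ⟨h1, c, c', h2, cs', h3, rfl⟩ := h
      obtain ⟨rfl, rfl⟩ := List.cons.inj (hu.symm.trans h3)
      obtain ⟨h4, k', h5, rfl⟩ := ih (k := c') rfl
      refine ⟨.cons h1 h4, k', ?_, rfl⟩
      simp only [op, List.length_cons, pow_succ]
      unfold addBits at h2
      linarith
  · rintro ⟨h, k', h1, rfl⟩
    induction h generalizing k u with
    | nil =>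
      simp only [op0, List.length_nil, pow_zero, one_mul, zero_add] at h1
      obtain rfl : k' = k := by cases k' <;> cases k <;> simp_all
      rw [← hu]
      exact .nil
    | @cons a b r r' h _ ih =>
      simp only [op, List.length_cons, pow_succ] at h1
      -- the carry is determined by the lowest digits
      obtain ⟨c, hc⟩ : ∃ c : Bool, addBits a b P Q S k c := by
        refine ⟨decide (2 ≤ (operand a b Q).toNat + (operand a b S).toNat + k.toNat), ?_⟩
        unfold addBits
        have h2 := Bool.toNat_le (operand a b P)
        have h3 := Bool.toNat_le (operand a b Q)
        have h4 := Bool.toNat_le (operand a b S)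
        have h5 := Bool.toNat_le k
        by_cases h6 : 2 ≤ (operand a b Q).toNat + (operand a b S).toNat + k.toNat
        · simp only [h6, decide_true, Bool.toNat_true]
          have : (2 ^ r.length * 2 * k'.toNat) = 2 * (2 ^ r.length * k'.toNat) := by ring
          omega
        · simp only [h6, decide_false, Bool.toNat_false]
          have : (2 ^ r.length * 2 * k'.toNat) = 2 * (2 ^ r.length * k'.toNat) := by ring
          omega
      refine .cons ⟨h, k, c, hc, cs, hu, rfl⟩
        (ih (u := { u with carry := c :: cs }) (k := c) rfl ?_)
      unfold addBits at hc
      have : (2 ^ r.length * 2 * k'.toNat) = 2 * (2 ^ r.length * k'.toNat) := by ring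
      omega

end folds

end

/-! ### The programs of the operations are correct -/

section

variable {R M G : Type} [DecidableEq M] {W : ℕ} [DecidableEq R]

section states

theorem forall₂_cols {s : RState R M G W} {x : R} {r' : List (R → Bool)} :
    List.Forall₂ (fun a b => ∀ r ≠ x, b r = a r) s.cols r' ↔
      ∃ v, r' = RState.cols { s with reg := Function.update s.reg x v } := by
  rw [RState.cols, forall₂_ofFn]
  constructor
  · rintro ⟨g, rfl, hg⟩
    refine ⟨fun i => g i x, ?_⟩
    unfold RState.cols
    congr 1
    funext i r
    by_cases h : r = x
    · subst h; simp
    · simp [h, hg i r h]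
  · rintro ⟨v, rfl⟩
    exact ⟨_, rfl, fun i r hr => by simp [hr]⟩

theorem length_cols {s : RState R M G W} : s.cols.length = W := by simp [RState.cols]

theorem bval_operand {s t : RState R M G W} {o : Bool × R} :
    bval (operand (track s.cols) (track t.cols) o) = val (operand s.reg t.reg o) := by
  unfold operand
  split_ifs <;> simp [track, RState.cols, val, List.map_ofFn, Function.comp_def]

theorem map_cols {s : RState R M G W} {p q : R} :
    s.cols.map (fun a => (a p, a q)) = digits [(s.reg p, s.reg q)] := by
  simp [digits, RState.cols, List.map_ofFn, Function.comp_def]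

theorem digits_cons {a} {l : List ((Fin W → Bool) × (Fin W → Bool))} :
    digits (a :: l) = digits [a] ++ digits l := by
  simp [digits]

theorem update_digits {m : M} {f : M → List ((Fin W → Bool) × (Fin W → Bool))}
    {l} : (fun j => digits (Function.update f m l j)) =
      Function.update (fun j => digits (f j)) m (digits l) := by
  funext j
  by_cases h : j = m
  · subst h; simp
  · simp [h]

theorem digits_eq_append {a} {l : List ((Fin W → Bool) × (Fin W → Bool))} {c} (hW : 0 < W)
    (h : digits l = digits [a] ++ c) : ∃ l', l = a :: l' ∧ c = digits l' := by
  have len : ∀ a : (Fin W → Bool) × (Fin W → Bool), (digits [a]).length = W := by simp [digits]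
  cases l with
  | nil =>
    have := congrArg List.length h
    rw [List.length_append, len] at this
    simp [digits] at this
    omega
  | cons b l =>
    rw [digits_cons] at h
    obtain ⟨h1, h2⟩ := List.append_inj h (by rw [len, len])
    refine ⟨l, ?_, h2.symm⟩
    have : b = a := by
      simp only [digits, List.flatMap_cons, List.flatMap_nil, List.append_nil,
        List.ofFn_inj] at h1
      exact Prod.ext (funext fun i => (Prod.mk.inj (congrFun h1 i)).1)
        (funext fun i => (Prod.mk.inj (congrFun h1 i)).2)
    rw [this]

end states

variable [Fintype R] {r r' l : List (R → Bool)} {u u' : Rest M G} {t : Key M → List (Alph R G)}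
  {P : Prop}

theorem ex_guard_skip (h : Ex StackOp.sem (guard P skip) (st r l u) t) :
    ∃ u', (P ∧ u' = u) ∧ t = st r l u' := by
  obtain ⟨h, h'⟩ := ex_guard.1 h
  exact ⟨u, ⟨h, rfl⟩, ex_skip.1 h'⟩

theorem runLE_guard_skip (h : P ∧ u' = u) :
    RunLE StackOp.sem (guard P skip) (st r l u) (st r l u') 1 := by
  obtain ⟨h, rfl⟩ := h
  exact runLE_guard h .skip

theorem ex_restore (h : Ex StackOp.sem restore (st [] l u) t) : t = st l.reverse [] u := by
  obtain ⟨l', u', hF, rfl⟩ := Fold.of_sweep_left (fun _ _ _ _ _ _ => ex_guard_skip) h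
  obtain ⟨rfl, rfl⟩ := fold_eq_and_eq.1 hF
  rfl

theorem runLE_restore : RunLE StackOp.sem restore (st [] l u) (st l.reverse [] u)
    (sweepCost R 1 * (l.length + 1)) :=
  Fold.runLE_left (body := fun a b => guard (b = a) skip) (ρ := fun a b u u' => b = a ∧ u' = u)
    (fun _ _ _ _ _ _ => runLE_guard_skip) (fold_eq_and_eq.2 ⟨rfl, rfl⟩)

/-- The program of an operation has no other effects than the operation. If the registers had width
`0`, points would have no digits, and popping from an empty list would succeed. -/
theorem RegOp.sound (hW : 0 < W) (i : RegOp R M G) {s : RState R M G W}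
    (h : Ex StackOp.sem i.prog s.stacks t) : ∃ s', i.sem s s' ∧ t = s'.stacks := by
  cases i with
  | guess x =>
    obtain ⟨t1, h1, h2⟩ := ex_seq.1 h
    obtain ⟨r', u', hF, rfl⟩ := Fold.of_sweep_right (fun _ _ _ _ _ _ => ex_guard_skip) h1
    obtain ⟨hC, rfl⟩ := fold_and_eq.1 hF
    obtain rfl := ex_restore h2
    obtain ⟨v, rfl⟩ := forall₂_cols.1 hC
    exact ⟨_, ⟨v, rfl⟩, by rw [List.reverse_reverse]; rfl⟩
  | lin x k P Q S =>
    obtain ⟨t1, h1, h2⟩ := ex_seq.1 h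
    obtain rfl := sem_push_carry.1 (ex_prim.1 h1)
    obtain ⟨t2, h2, h3⟩ := ex_seq.1 h2
    obtain ⟨t3, h2, h4⟩ := ex_seq.1 h2
    obtain ⟨r', u', hF, rfl⟩ := Fold.of_sweep_right
      (ρ := fun a b u u' => (∀ r ≠ x, b r = a r) ∧ ∃ c c', addBits a b P Q S c c' ∧
      ∃ cs, u.carry = c :: cs ∧ u' = { u with carry := c' :: cs }) (by
        intro a b r l u t h
        obtain ⟨g, h⟩ := ex_guard.1 h
        obtain ⟨⟨c, c'⟩, h⟩ := ex_any.1 h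
        obtain ⟨g', h⟩ := ex_guard.1 h
        obtain ⟨t', i1, i2⟩ := ex_seq.1 h
        obtain ⟨cs, j, rfl⟩ := sem_pop_carry.1 (ex_prim.1 i1)
        exact ⟨_, ⟨g, c, c', g', cs, j, rfl⟩, sem_push_carry.1 (ex_prim.1 i2)⟩) h2
    obtain ⟨hC, k', h5, rfl⟩ := (fold_lin rfl).1 hF
    obtain rfl := ex_restore h4
    obtain ⟨cs, h6, rfl⟩ := sem_pop_carry.1 (ex_prim.1 h3)
    obtain ⟨rfl, rfl⟩ := List.cons.inj h6
    obtain ⟨v, rfl⟩ := forall₂_cols.1 hC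
    simp only [bval_operand, Bool.toNat_false, mul_zero, add_zero] at h5
    exact ⟨_, ⟨v, rfl, h5⟩, by rw [List.reverse_reverse]; rfl⟩
  | pop m p q =>
    obtain ⟨t1, h1, h2⟩ := ex_seq.1 h
    obtain ⟨r', u', hF, rfl⟩ := Fold.of_sweep_right
      (ρ := fun a b u u' => b = a ∧ ∃ c, u.mem m = (a p, a q) :: c ∧
        u' = { u with mem := Function.update u.mem m c }) (by
        intro a b r l u t h
        obtain ⟨g, h⟩ := ex_guard.1 h
        obtain ⟨c, j, rfl⟩ := sem_pop_mem.1 (ex_prim.1 h)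
        exact ⟨_, ⟨g, c, j, rfl⟩, rfl⟩) h1
    obtain ⟨rfl, c, hc, rfl⟩ := (fold_pop (f := fun a : R → Bool => (a p, a q))).1 hF
    obtain rfl := ex_restore h2
    rw [map_cols] at hc
    obtain ⟨l', hl, rfl⟩ := digits_eq_append hW hc
    refine ⟨_, ⟨l', hl, rfl⟩, ?_⟩
    simp only [List.reverse_reverse, RState.stacks, update_digits]
    rfl
  | push m p q =>
    obtain ⟨t1, h1, h2⟩ := ex_seq.1 h
    obtain ⟨r', u', hF, rfl⟩ := Fold.of_sweep_right (fun _ _ _ _ _ _ => ex_guard_skip) h1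
    obtain ⟨rfl, rfl⟩ := fold_eq_and_eq.1 hF
    obtain ⟨l', u', hF, rfl⟩ := Fold.of_sweep_left
      (ρ := fun a b u u' => b = a ∧
        u' = { u with mem := Function.update u.mem m ((a p, a q) :: u.mem m) }) (by
        intro a b r l u t h
        obtain ⟨g, h⟩ := ex_guard.1 h
        exact ⟨_, ⟨g, rfl⟩, sem_push_mem.1 (ex_prim.1 h)⟩) h2
    obtain ⟨rfl, rfl⟩ := (fold_push (f := fun a : R → Bool => (a p, a q))).1 hF
    refine ⟨_, rfl, ?_⟩
    rw [RState.stacks, update_digits, digits_cons, ← map_cols]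
    simp only [List.reverse_reverse, List.map_reverse]
    rfl
  | inp c =>
    obtain ⟨l', hl, rfl⟩ := sem_pop_inp.1 (ex_prim.1 h)
    exact ⟨_, ⟨l', hl, rfl⟩, rfl⟩
  | inpEnd =>
    obtain ⟨hl, rfl⟩ := sem_isEmpty_inp.1 (ex_prim.1 h)
    exact ⟨_, ⟨hl, rfl⟩, rfl⟩
  | memEnd m =>
    obtain ⟨hl, rfl⟩ := sem_isEmpty_mem.1 (ex_prim.1 h)
    have hl : digits (s.mem m) = [] := hl
    refine ⟨_, ⟨?_, rfl⟩, rfl⟩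
    cases hm : s.mem m with
    | nil => rfl
    | cons a l =>
      obtain ⟨_, h, _⟩ := digits_eq_append (l := []) (a := a) (c := digits l) hW (by
        rw [← digits_cons, ← hm, hl]; rfl)
      exact absurd h (by simp)

theorem RegOp.complete (i : RegOp R M G) {s s' : RState R M G W} (h : i.sem s s') :
    RunLE StackOp.sem i.prog s.stacks s'.stacks (2 * sweepCost R 10 * (W + 2)) := by
  have le1 : sweepCost R 1 ≤ sweepCost R 10 := by unfold sweepCost; omega
  have le2 : 10 ≤ sweepCost R 10 := by unfold sweepCost; omega
  have le3 := Nat.mul_le_mul_right (W + 1) le1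
  have le4 : 2 * sweepCost R 10 * (W + 2) =
      2 * (sweepCost R 10 * (W + 1)) + 2 * sweepCost R 10 := by
    ring
  cases i with
  | guess x =>
    obtain ⟨v, hs⟩ := h
    have h1 := Fold.runLE_right (body := fun a b => guard (∀ r ≠ x, b r = a r) skip)
      (fun _ _ _ _ _ _ => runLE_guard_skip)
      (fold_and_eq.2 ⟨forall₂_cols.2 ⟨v, congrArg RState.cols hs⟩, rfl⟩)
      (u := ⟨[], [], s.inp, fun m => digits (s.mem m)⟩)
    have h2 := h1.seq runLE_restore
    rw [List.reverse_reverse, List.length_reverse, length_cols, length_cols] at h2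
    rw [show s'.stacks = st s'.cols [] ⟨[], [], s.inp, fun m => digits (s.mem m)⟩ by
      rw [RState.stacks, hs]]
    exact h2.mono (by omega)
  | lin x k P Q S =>
    obtain ⟨v, hs, h⟩ := h
    simp only [← bval_operand] at h
    have h0 := RunLE.prim (sem_push_carry (r := s.cols) (l := [])
      (u := ⟨[], [], s.inp, fun m => digits (s.mem m)⟩) (a := k).2 rfl)
    have h1 := Fold.runLE_right (c := 9) (u' := ⟨[false], [], s.inp, fun m => digits (s.mem m)⟩)
      (body := fun a b => guard (∀ r ≠ x, b r = a r)
        (Prog.any fun cc : Bool × Bool => guard (addBits a b P Q S cc.1 cc.2)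
          (seq (prim (.pop .carry (.car cc.1))) (prim (.push .carry (.car cc.2))))))
      (by
        rintro a b r l u u' ⟨g, c, c', g', cs, j, rfl⟩
        exact (runLE_guard g (RunLE.any (c, c') (runLE_guard g'
          ((RunLE.prim (sem_pop_carry.2 ⟨cs, j, rfl⟩)).seq
            (RunLE.prim (sem_push_carry.2 rfl)))))).mono (by simp))
      ((fold_lin (u := ⟨[k], [], s.inp, fun m => digits (s.mem m)⟩) rfl).2
        ⟨forall₂_cols.2 ⟨v, congrArg RState.cols hs⟩, false, by simpa using h, rfl⟩)
    have h2 := h0.seq ((h1.seq runLE_restore).seq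
      (RunLE.prim (sem_pop_carry.2 ⟨[], rfl, rfl⟩)))
    rw [List.reverse_reverse, List.length_reverse, length_cols, length_cols] at h2
    rw [show s'.stacks = st s'.cols [] ⟨[], [], s.inp, fun m => digits (s.mem m)⟩ by
      rw [RState.stacks, hs]]
    have le5 : sweepCost R 9 ≤ sweepCost R 10 := by unfold sweepCost; omega
    have le6 := Nat.mul_le_mul_right (W + 1) le5
    exact h2.mono (by omega)
  | pop m p q =>
    obtain ⟨l, h, rfl⟩ := h
    have h1 := Fold.runLE_right (c := 1)
      (u := ⟨[], [], s.inp, fun m => digits (s.mem m)⟩)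
      (body := fun a b => guard (b = a) (prim (.pop (.mem m) (.pt (a p, a q)))))
      (by
        rintro a b r l u u' ⟨g, c, j, rfl⟩
        exact runLE_guard g (RunLE.prim (sem_pop_mem.2 ⟨c, j, rfl⟩)))
      ((fold_pop (f := fun a => (a p, a q)) (r := s.cols)).2 ⟨rfl, digits l, by
        rw [map_cols, ← digits_cons, ← h], rfl⟩)
    have h2 := h1.seq runLE_restore
    rw [List.reverse_reverse, List.length_reverse, length_cols, ← update_digits] at h2
    exact h2.mono (by omega)
  | push m p q =>
    obtain rfl := h
    have h1 := Fold.runLE_right (body := fun a b => guard (b = a) skip)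
      (u := ⟨[], [], s.inp, fun m => digits (s.mem m)⟩) (r := s.cols)
      (fun _ _ _ _ _ _ => runLE_guard_skip) (fold_eq_and_eq.2 ⟨rfl, rfl⟩)
    have h2 := Fold.runLE_left (c := 1)
      (u := ⟨[], [], s.inp, fun m => digits (s.mem m)⟩)
      (body := fun a b => guard (b = a) (prim (.push (.mem m) (.pt (a p, a q)))))
      (by
        rintro a b r l u u' ⟨g, rfl⟩
        exact runLE_guard g (RunLE.prim (sem_push_mem.2 rfl)))
      ((fold_push (f := fun a => (a p, a q)) (r := s.cols.reverse)).2 ⟨rfl, rfl⟩)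
    have h3 := h1.seq h2
    rw [List.reverse_reverse, List.length_reverse, length_cols, List.map_reverse,
      List.reverse_reverse, map_cols, ← digits_cons, ← update_digits] at h3
    exact h3.mono (by omega)
  | inp c =>
    obtain ⟨l, h, rfl⟩ := h
    exact (RunLE.prim (sem_pop_inp.2 ⟨l, h, rfl⟩)).mono (by omega)
  | inpEnd =>
    obtain ⟨h, rfl⟩ := h
    exact (RunLE.prim (sem_isEmpty_inp.2 ⟨h, rfl⟩)).mono (by omega)
  | memEnd m =>
    obtain ⟨h, rfl⟩ := h
    exact (RunLE.prim (sem_isEmpty_mem.2 ⟨by simp [h, digits], rfl⟩)).mono (by omega)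

end

/-! ### Languages recognized by register machines are in NP -/

section

variable {R M G : Type} [DecidableEq M] [DecidableEq R] [Fintype R] [Fintype G] {W : ℕ}
  {r l : List (R → Bool)} {u u' : Rest M G} {t : Key M → List (Alph R G)}

variable (R M G) in
/-- Move the input from the stack `rev` to the stack `inp`. -/
noncomputable def reverseInput : RProg R M G :=
  seq (star (Prog.any fun a : G => seq (prim (.pop .rev (.sym a))) (prim (.push .inp (.sym a)))))
    (prim (.isEmpty .rev))

variable (R M G) in
/-- Push an arbitrary column. -/
noncomputable def pushColumn : RProg R M G :=
  Prog.any fun a : R → Bool => prim (.push .right (.col a))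

theorem ex_reverseInput (h : Ex StackOp.sem (reverseInput R M G) (st r l u) t) :
    t = st r l { u with rev := [], inp := u.rev.reverse ++ u.inp } := by
  obtain ⟨s, h0, h'⟩ := ex_seq.1 h
  replace h := h0
  clear h0
  rw [ex_star] at h
  rw [ex_prim] at h'
  generalize hs : st r l u = s₀ at h
  induction h using Relation.ReflTransGen.head_induction_on generalizing u with
  | refl =>
    subst hs
    obtain ⟨hu, rfl⟩ := sem_isEmpty_rev.1 h'
    rw [hu, List.reverse_nil, List.nil_append, ← hu]
  | head h _ ih =>
    subst hs
    obtain ⟨a, h⟩ := ex_any.1 h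
    obtain ⟨s1, i1, i2⟩ := ex_seq.1 h
    obtain ⟨c, hc, rfl⟩ := sem_pop_rev.1 (ex_prim.1 i1)
    obtain rfl := sem_push_inp.1 (ex_prim.1 i2)
    rw [ih rfl, hc]
    simp

theorem runLE_reverseInput : RunLE StackOp.sem (reverseInput R M G) (st r l u)
    (st r l { u with rev := [], inp := u.rev.reverse ++ u.inp })
    ((Fintype.card G + 4) * (u.rev.length + 1)) := by
  suffices h : RunLE StackOp.sem (star (Prog.any fun a : G =>
      seq (prim (.pop .rev (.sym a))) (prim (.push .inp (.sym a)))))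
      (st r l u) (st r l { u with rev := [], inp := u.rev.reverse ++ u.inp })
      ((Fintype.card G + 4) * u.rev.length + 1) from
    (h.seq (.prim (sem_isEmpty_rev.2 ⟨rfl, rfl⟩))).mono (by rw [mul_add]; omega)
  generalize hx : u.rev = x
  induction x generalizing u with
  | nil =>
    have : { u with rev := [], inp := [].reverse ++ u.inp } = u := by
      ext1 <;> simp [hx]
    rw [this]
    exact RunLE.star_nil.mono (by simp)
  | cons a x ih =>
    have step := RunLE.any
      (f := fun a : G => (Prog.seq (prim (.pop .rev (.sym a)))
        (prim (.push .inp (.sym a))) : RProg R M G)) a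
      ((RunLE.prim (sem_pop_rev (r := r) (l := l).2 ⟨x, hx, rfl⟩)).seq
        (RunLE.prim (sem_push_inp.2 rfl)))
    have := step.star_cons (ih (u := { u with rev := x, inp := a :: u.inp }) rfl)
    rw [List.reverse_cons, List.append_assoc, List.singleton_append]
    exact this.mono (by rw [List.length_cons, mul_add]; omega)

theorem ex_pushColumn (h : Ex StackOp.sem (pushColumn R M G) (st r l u) t) :
    ∃ a, t = st (a :: r) l u := by
  obtain ⟨a, h⟩ := ex_any.1 h
  exact ⟨a, sem_push_right.1 (ex_prim.1 h)⟩

theorem ex_star_pushColumn (h : Ex StackOp.sem (star (pushColumn R M G)) (st r l u) t) :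
    ∃ r', t = st (r' ++ r) l u := by
  rw [ex_star] at h
  generalize hs : st r l u = s₀ at h
  induction h using Relation.ReflTransGen.head_induction_on generalizing r with
  | refl => exact ⟨[], hs.symm⟩
  | head h _ ih =>
    subst hs
    obtain ⟨a, rfl⟩ := ex_pushColumn h
    obtain ⟨r', rfl⟩ := ih rfl
    exact ⟨r' ++ [a], by simp⟩

theorem runLE_pushColumn {a} : RunLE StackOp.sem (pushColumn R M G) (st r l u) (st (a :: r) l u)
    (1 + Fintype.card (R → Bool)) :=
  RunLE.any (f := fun a : R → Bool => (prim (.push .right (.col a)) : RProg R M G)) a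
    (RunLE.prim (sem_push_right.2 rfl))

theorem runLE_star_pushColumn {r'} : RunLE StackOp.sem (star (pushColumn R M G)) (st r l u)
    (st (r' ++ r) l u) ((2 + Fintype.card (R → Bool)) * r'.length + 1) := by
  induction r' using List.reverseRecOn generalizing r with
  | nil => exact RunLE.star_nil
  | append_singleton r' a ih =>
    have := (runLE_pushColumn (a := a) (r := r)).star_cons ih
    rw [List.append_assoc, List.singleton_append]
    exact this.mono (by rw [List.length_append, List.length_singleton, mul_add]; omega)

theorem inputStacks_eq (x : List G) : inputStacks (.rev : Key M) (Alph.sym (R := R)) x =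
    st [] [] ⟨[], x.reverse, [], fun _ => []⟩ := by
  funext k
  cases k <;> simp [inputStacks, st]

theorem exists_stacks_eq {r : List (R → Bool)} {x : List G} :
    ∃ s : RState R M G r.length, s.mem = (fun _ => []) ∧ s.inp = x ∧
      s.stacks = st r [] ⟨[], [], x, fun _ => []⟩ := by
  refine ⟨⟨fun q i => r.get i q, fun _ => [], x⟩, rfl, rfl, ?_⟩
  have : RState.cols (⟨fun q i => r.get i q, fun _ => [], x⟩ : RState R M G r.length) = r := by
    unfold RState.cols
    exact List.ofFn_get r
  rw [RState.stacks, this]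
  rfl

/-- A language is in NP if it is recognized by a nondeterministic register machine with a
polynomial number of steps and registers of polynomial width. -/
theorem inNP_of_program [Fintype M] [DecidableEq G] (L : Language G) (p : Prog (RegOp R M G))
    (f g : Polynomial ℕ)
    (sound : ∀ (W : ℕ) (s t : RState R M G W), 0 < W → s.mem = (fun _ => []) →
      Ex RegOp.sem p s t → s.inp ∈ L)
    (complete : ∀ x ∈ L, ∃ W, 0 < W ∧ W ≤ g.eval x.length ∧ ∀ s : RState R M G W,
      s.mem = (fun _ => []) → s.inp = x → ∃ t, RunLE RegOp.sem p s t (f.eval x.length)) :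
    InNP L := by
  let P : RProg R M G := seq (reverseInput R M G) (seq (seq (pushColumn R M G)
    (star (pushColumn R M G))) (p.bind RegOp.prog))
  refine inNP_of_run L P .rev .sym
    (.C (Fintype.card G + 4) * (.X + 1) + .C (Fintype.card (R → Bool) + 6) * (g + 1) +
      .C (2 * sweepCost R 10) * (g + 2) * f) ?_ ?_
  · intro x t n h
    rw [inputStacks_eq] at h
    obtain ⟨t1, h1, h⟩ := ex_seq.1 ⟨n, h⟩
    obtain rfl := ex_reverseInput h1
    obtain ⟨t2, h2, h⟩ := ex_seq.1 h
    obtain ⟨t3, h2, h3⟩ := ex_seq.1 h2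
    obtain ⟨a, rfl⟩ := ex_pushColumn h2
    obtain ⟨r, rfl⟩ := ex_star_pushColumn h3
    obtain ⟨s, hs1, hs2, hs3⟩ := exists_stacks_eq (M := M) (r := r ++ [a])
      (x := x.reverse.reverse ++ [])
    have hW : 0 < (r ++ [a]).length := by simp
    obtain ⟨s', h', -⟩ := Ex.of_bind (sem := RegOp.sem) (Rep := fun t s => t = RState.stacks s)
      (by
        rintro i _ b s rfl hb
        exact RegOp.sound hW i hb) hs3.symm h
    have := sound _ s s' hW hs1 h'
    rwa [hs2, List.append_nil, List.reverse_reverse] at this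
  · intro x hx
    obtain ⟨W, hW, hWg, h⟩ := complete x hx
    have h1 := runLE_reverseInput (R := R) (r := []) (l := [])
      (u := ⟨[], x.reverse, [], fun _ : M => []⟩)
    obtain ⟨W, rfl⟩ := Nat.exists_eq_succ_of_ne_zero hW.ne'
    have h2 := (runLE_pushColumn (r := []) (l := []) (a := fun _ : R => false)
      (u := ⟨[], [], x, fun _ : M => []⟩)).seq
      (runLE_star_pushColumn (r' := List.replicate W fun _ : R => false))
    have h3 : ∃ s : RState R M G (W + 1), s.mem = (fun _ => []) ∧ s.inp = x ∧
        s.stacks = st (List.replicate W (fun _ => false) ++ [fun _ => false]) []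
          ⟨[], [], x, fun _ => []⟩ := by
      have := exists_stacks_eq (M := M) (x := x)
        (r := List.replicate W (fun _ : R => false) ++ [fun _ => false])
      rwa [List.length_append, List.length_replicate] at this
    obtain ⟨s, hs1, hs2, hs3⟩ := h3
    obtain ⟨t, h⟩ := h s hs1 hs2
    obtain ⟨_, h4, rfl⟩ := RunLE.bind (sem' := StackOp.sem) (f := RegOp.prog)
      (Rep := fun t s => t = RState.stacks s) (c := 2 * sweepCost R 10 * (W + 1 + 2))
      (by have : 5 ≤ sweepCost R 10 := by unfold sweepCost; omega
          nlinarith) (by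
        rintro i _ s s' rfl h
        exact ⟨_, RegOp.complete i h, rfl⟩) hs3.symm h
    rw [inputStacks_eq]
    obtain ⟨n, hn, hr⟩ := h1.seq (RunLE.seq (by simpa using h2) h4)
    refine ⟨_, n, hn.trans ?_, hr⟩
    have h5 : 2 * sweepCost R 10 * (W + 1 + 2) * f.eval x.length ≤
        2 * sweepCost R 10 * (g.eval x.length + 2) * f.eval x.length := by gcongr
    have h6 : (2 + Fintype.card (R → Bool)) * W + (Fintype.card (R → Bool) + 2) + 4 ≤
        (Fintype.card (R → Bool) + 6) * (g.eval x.length + 1) := by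
      calc _ ≤ (Fintype.card (R → Bool) + 6) * (W + 1 + 1) := by nlinarith
        _ ≤ _ := by gcongr
    simp only [Polynomial.eval_add, Polynomial.eval_mul, Polynomial.eval_C, Polynomial.eval_X,
      Polynomial.eval_one, Polynomial.eval_ofNat, List.length_reverse]
    simp only [Fintype.card_fun, Fintype.card_bool] at h6 ⊢
    omega
end

/-! ### Register machines on natural numbers -/

section

/-- The states of a register machine, with numbers as values. -/
@[ext] structure NState (R M G : Type) where
  reg : R → ℕ
  mem : M → List (ℕ × ℕ)
  inp : List G

variable {R M G : Type} [DecidableEq M] [DecidableEq R] {W : ℕ}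

/-- The effect of an operation if all numbers have to be less than `N`. -/
def RegOp.nsem (N : ℕ) : RegOp R M G → NState R M G → NState R M G → Prop
  | .guess a, s, t => ∃ v < N, t = { s with reg := Function.update s.reg a v }
  | .lin a k P Q S, s, t => ∃ v < N, t = { s with reg := Function.update s.reg a v } ∧
      operand s.reg t.reg P = operand s.reg t.reg Q + operand s.reg t.reg S + k.toNat
  | .pop m p q, s, t => ∃ l, s.mem m = (s.reg p, s.reg q) :: l ∧
      t = { s with mem := Function.update s.mem m l }
  | .push m p q, s, t =>
      t = { s with mem := Function.update s.mem m ((s.reg p, s.reg q) :: s.mem m) }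
  | .inp c, s, t => ∃ l, s.inp = c :: l ∧ t = { s with inp := l }
  | .inpEnd, s, t => s.inp = [] ∧ t = s
  | .memEnd m, s, t => s.mem m = [] ∧ t = s

section

variable {N : ℕ} {s : NState R M G} {m : M} {a p q : R}

theorem runLE_guess {v : ℕ} (h : v < N) : RunLE (RegOp.nsem N) (prim (.guess a)) s
    { s with reg := Function.update s.reg a v } 1 := .prim ⟨v, h, rfl⟩

theorem runLE_lin {k : Bool} {P Q S : Bool × R} {v : ℕ} (h : v < N)
    (h' : operand s.reg (Function.update s.reg a v) P =
      operand s.reg (Function.update s.reg a v) Q + operand s.reg (Function.update s.reg a v) S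
        + k.toNat) :
    RunLE (RegOp.nsem N) (prim (.lin a k P Q S)) s
      { s with reg := Function.update s.reg a v } 1 := .prim ⟨v, h, rfl, h'⟩

theorem runLE_pop {l : List (ℕ × ℕ)} (h : s.mem m = (s.reg p, s.reg q) :: l) :
    RunLE (RegOp.nsem N) (prim (.pop m p q)) s
      { s with mem := Function.update s.mem m l } 1 := .prim ⟨l, h, rfl⟩

theorem runLE_push : RunLE (RegOp.nsem N) (prim (.push m p q)) s
    { s with mem := Function.update s.mem m ((s.reg p, s.reg q) :: s.mem m) } 1 := .prim rfl

theorem runLE_inp {c : G} {l : List G} (h : s.inp = c :: l) :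
    RunLE (RegOp.nsem N) (prim (.inp c)) s { s with inp := l } 1 := .prim ⟨l, h, rfl⟩

theorem runLE_inpEnd (h : s.inp = []) : RunLE (RegOp.nsem N) (prim .inpEnd) s s 1 :=
  .prim ⟨h, rfl⟩

theorem runLE_memEnd (h : s.mem m = []) : RunLE (RegOp.nsem N) (prim (.memEnd m)) s s 1 :=
  .prim ⟨h, rfl⟩

end

theorem bval_lt (l : List Bool) : bval l < 2 ^ l.length := by
  induction l with
  | nil => simp [bval]
  | cons b l ih =>
    have := Bool.toNat_le b
    rw [bval, List.length_cons, pow_succ]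
    omega

theorem val_lt (f : Fin W → Bool) : val f < 2 ^ W := by
  simpa [val] using bval_lt (List.ofFn f)

theorem bval_inj {l l' : List Bool} (h : l.length = l'.length) (h' : bval l = bval l') :
    l = l' := by
  induction l generalizing l' with
  | nil => exact (List.length_eq_zero_iff.1 h.symm).symm
  | cons b l ih =>
    cases l' with
    | nil => simp at h
    | cons b' l' =>
      simp only [bval] at h'
      have h1 := Bool.toNat_le b
      have h2 := Bool.toNat_le b'
      rw [ih (by simpa using h) (by omega)]
      have : b.toNat = b'.toNat := by omega
      cases b <;> cases b' <;> simp_all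

theorem val_injective : Function.Injective (val : (Fin W → Bool) → ℕ) := fun f g h =>
  List.ofFn_injective (bval_inj (by simp) h)

/-- The values of a pair of registers. -/
def ptVal (p : (Fin W → Bool) × (Fin W → Bool)) : ℕ × ℕ := (val p.1, val p.2)

theorem ptVal_injective : Function.Injective (ptVal (W := W)) := fun _ _ h =>
  Prod.ext (val_injective (Prod.mk.inj h).1) (val_injective (Prod.mk.inj h).2)

/-- The numbers that are represented by a state. -/
def RState.nat (s : RState R M G W) : NState R M G where
  reg r := val (s.reg r)
  mem m := (s.mem m).map ptVal
  inp := s.inp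

theorem nat_update_reg {s : RState R M G W} {a : R} {v} :
    RState.nat { s with reg := Function.update s.reg a v } =
      { s.nat with reg := Function.update s.nat.reg a (val v) } := by
  ext1
  · funext r
    by_cases h : r = a
    · subst h; simp [RState.nat]
    · simp [RState.nat, h]
  · rfl
  · rfl

theorem nat_update_mem {s : RState R M G W} {m : M} {l} :
    RState.nat { s with mem := Function.update s.mem m l } =
      { s.nat with mem := Function.update s.nat.mem m (l.map ptVal) } := by
  ext1
  · rfl
  · funext j
    by_cases h : j = m
    · subst h; simp [RState.nat]
    · simp [RState.nat, h]
  · rfl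

theorem val_operand {s t : RState R M G W} {o : Bool × R} :
    val (operand s.reg t.reg o) = operand s.nat.reg t.nat.reg o := by
  unfold operand
  split_ifs <;> rfl

theorem RegOp.nsem_of_sem {i : RegOp R M G} {s t : RState R M G W} (h : i.sem s t) :
    i.nsem (2 ^ W) s.nat t.nat := by
  cases i with
  | guess a =>
    obtain ⟨v, rfl⟩ := h
    exact ⟨val v, val_lt v, nat_update_reg⟩
  | lin a k P Q S =>
    obtain ⟨v, hv, h⟩ := h
    refine ⟨val v, val_lt v, hv ▸ nat_update_reg, ?_⟩
    rwa [val_operand, val_operand, val_operand] at h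
  | pop m p q =>
    obtain ⟨l, h, rfl⟩ := h
    exact ⟨l.map ptVal, by simp [RState.nat, h, ptVal], nat_update_mem⟩
  | push m p q =>
    obtain rfl := h
    exact nat_update_mem
  | inp c =>
    obtain ⟨l, h, rfl⟩ := h
    exact ⟨l, h, rfl⟩
  | inpEnd =>
    obtain ⟨h, rfl⟩ := h
    exact ⟨h, rfl⟩
  | memEnd m =>
    obtain ⟨h, rfl⟩ := h
    exact ⟨by simp [RState.nat, h], rfl⟩

theorem RegOp.exists_sem_of_nsem {i : RegOp R M G} {s : RState R M G W} {t : NState R M G}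
    (h : i.nsem (2 ^ W) s.nat t) : ∃ t' : RState R M G W, i.sem s t' ∧ t = t'.nat := by
  cases i with
  | guess a =>
    obtain ⟨v, hv, rfl⟩ := h
    obtain ⟨f, rfl⟩ := exists_val_eq hv
    exact ⟨_, ⟨f, rfl⟩, nat_update_reg.symm⟩
  | lin a k P Q S =>
    obtain ⟨v, hv, h, h'⟩ := h
    obtain ⟨f, rfl⟩ := exists_val_eq hv
    rw [← nat_update_reg] at h
    subst h
    exact ⟨_, ⟨f, rfl, by rwa [val_operand, val_operand, val_operand]⟩, rfl⟩
  | pop m p q =>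
    obtain ⟨l, h, rfl⟩ := h
    obtain ⟨a, l, h1, h2, rfl⟩ := List.map_eq_cons_iff.1 h
    have : a = (s.reg p, s.reg q) := ptVal_injective h2
    exact ⟨_, ⟨l, this ▸ h1, rfl⟩, nat_update_mem.symm⟩
  | push m p q =>
    obtain rfl := h
    exact ⟨_, rfl, (nat_update_mem (l := (s.reg p, s.reg q) :: s.mem m)).symm⟩
  | inp c =>
    obtain ⟨l, h, rfl⟩ := h
    exact ⟨_, ⟨l, h, rfl⟩, rfl⟩
  | inpEnd =>
    obtain ⟨h, rfl⟩ := h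
    exact ⟨_, ⟨h, rfl⟩, rfl⟩
  | memEnd m =>
    obtain ⟨h, rfl⟩ := h
    exact ⟨_, ⟨List.map_eq_nil_iff.1 h, rfl⟩, rfl⟩

theorem bind_prim {ι : Type} (p : Prog ι) : p.bind prim = p := by
  induction p <;> simp_all [Prog.bind]

/-- A language is in NP if it is recognized by a nondeterministic register machine with a
polynomial number of steps and numbers of polynomial length. -/
theorem inNP_of_nat_program [Fintype R] [Fintype M] [Fintype G] [DecidableEq G] (L : Language G)
    (p : Prog (RegOp R M G)) (f g : Polynomial ℕ)
    (sound : ∀ (N : ℕ) (s t : NState R M G), s.mem = (fun _ => []) →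
      Ex (RegOp.nsem N) p s t → s.inp ∈ L)
    (complete : ∀ x ∈ L, ∃ W, 0 < W ∧ W ≤ g.eval x.length ∧ ∀ s : NState R M G,
      s.mem = (fun _ => []) → s.inp = x → ∃ t, RunLE (RegOp.nsem (2 ^ W)) p s t
        (f.eval x.length)) :
    InNP L := by
  refine inNP_of_program L p f g ?_ ?_
  · intro W s t _ hs h
    rw [← bind_prim p] at h
    obtain ⟨t', h', -⟩ := Ex.of_bind (sem := RegOp.nsem (2 ^ W))
      (Rep := fun s s' => s' = RState.nat s) (by
        rintro i a a' _ rfl h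
        exact ⟨_, RegOp.nsem_of_sem (ex_prim.1 h), rfl⟩) rfl h
    refine sound _ s.nat t' ?_ h'
    simp [RState.nat, hs]
  · intro x hx
    obtain ⟨W, hW, hg, h⟩ := complete x hx
    refine ⟨W, hW, hg, fun s hs hx => ?_⟩
    obtain ⟨t, h⟩ := h s.nat (by simp [RState.nat, hs]) hx
    obtain ⟨t', h', -⟩ := RunLE.bind (sem' := RegOp.sem) (f := prim)
      (Rep := fun s s' => s' = RState.nat s) (c := 1) le_rfl (by
        rintro i a _ s' rfl h
        obtain ⟨t', h1, h2⟩ := RegOp.exists_sem_of_nsem h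
        exact ⟨t', .prim h1, h2⟩) rfl h
    rw [bind_prim, one_mul] at h'
    exact ⟨t', h'⟩

end

end RegMachine

namespace TwoLevelSteiner

open Prog RegMachine

/-! ### The state of the verifier -/

/-- The main registers of the verifier: the common denominator `den` and the offset `off`, by which
the natural number `n` stands for the coordinate `(n - off) / den`, the coordinates `x` and `y` of
the current point, and the remaining budget `bud` for the total length, in the same coding. -/
inductive Reg
  | den
  | off
  | x
  | y
  | bud
  deriving DecidableEq

instance : Fintype Reg := ⟨{.den, .off, .x, .y, .bud}, fun a => by cases a <;> decide⟩

/-- Auxiliary registers. -/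
inductive Aux
  | e
  | p
  | q
  | z
  | w
  | u
  | v
  deriving DecidableEq

instance : Fintype Aux := ⟨{.e, .p, .q, .z, .w, .u, .v}, fun a => by cases a <;> decide⟩

/-- The lists of points of the verifier: the vertices of the top-level tree, the vertices of the
current tree, the terminals of the previous groups, and those of the current group. -/
inductive Mem
  | top
  | cur
  | old
  | new
  deriving DecidableEq

instance : Fintype Mem := ⟨{.top, .cur, .old, .new}, fun a => by cases a <;> decide⟩

/-- Auxiliary lists. -/
inductive Tmp
  | tmp
  | trash
  deriving DecidableEq

instance : Fintype Tmp := ⟨{.tmp, .trash}, fun a => by cases a <;> decide⟩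

/-- The states of the verifier without the auxiliary registers and lists. -/
abbrev State : Type := NState Reg Mem Sym

/-- The states of the verifier. -/
abbrev FullState : Type := NState (Reg ⊕ Aux) (Mem ⊕ Tmp) Sym

/-- The programs of the verifier. -/
abbrev MProg : Type := Prog (RegOp (Reg ⊕ Aux) (Mem ⊕ Tmp) Sym)

/-- Forget the auxiliary registers and lists. -/
def abs (s : FullState) : State where
  reg r := s.reg (.inl r)
  mem m := s.mem (.inl m)
  inp := s.inp

section abs

variable {s : FullState}

theorem abs_aux {a : Aux} {n : ℕ} :
    abs { s with reg := Function.update s.reg (.inr a) n } = abs s := by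
  ext1 <;> funext <;> simp [abs]

theorem abs_reg {r : Reg} {n : ℕ} : abs { s with reg := Function.update s.reg (.inl r) n } =
    { abs s with reg := Function.update (abs s).reg r n } := by
  ext1
  · funext r'
    by_cases h : r' = r
    · subst h; simp [abs]
    · simp [abs, h]
  · rfl
  · rfl

theorem abs_mem {m : Mem} {l} : abs { s with mem := Function.update s.mem (.inl m) l } =
    { abs s with mem := Function.update (abs s).mem m l } := by
  ext1
  · rfl
  · funext m'
    by_cases h : m' = m
    · subst h; simp [abs]
    · simp [abs, h]
  · rfl

end abs

/-! ### Moving points from list to list -/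

/-- The main registers and the input are the same. -/
structure Frame (s t : FullState) : Prop where
  inp : t.inp = s.inp
  reg : ∀ r, t.reg (.inl r) = s.reg (.inl r)

theorem Frame.rfl {s : FullState} : Frame s s := ⟨Eq.refl _, fun _ => Eq.refl _⟩

theorem Frame.trans {s t u : FullState} (h : Frame s t) (h' : Frame t u) : Frame s u :=
  ⟨h'.inp.trans h.inp, fun r => (h'.reg r).trans (h.reg r)⟩

theorem Frame.abs_reg {s t : FullState} (h : Frame s t) : (abs t).reg = (abs s).reg :=
  funext h.reg

theorem Frame.abs_eq {s t : FullState} (h : Frame s t)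
    (h' : ∀ m, t.mem (.inl m) = s.mem (.inl m)) : abs t = abs s :=
  NState.ext (funext h.reg) (funext h') h.inp

/-- Take a point from the list `k` into the registers `p`, `q`, and move it to the list `l` if it
passes a test. -/
def move (k l : Mem ⊕ Tmp) (test : MProg) : MProg :=
  seq (prim (.guess (.inr .p))) (seq (prim (.guess (.inr .q)))
    (seq (prim (.pop k (.inr .p) (.inr .q))) (seq test (prim (.push l (.inr .p) (.inr .q))))))

section

variable {N : ℕ} {test : MProg} {T : (Reg → ℕ) → ℕ × ℕ → Prop} {k l : Mem ⊕ Tmp}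
  {s t : FullState}

/-- A test changes neither the lists nor the registers `p` and `q`. -/
structure Tested (s t : FullState) : Prop extends Frame s t where
  mem : t.mem = s.mem
  p : t.reg (.inr .p) = s.reg (.inr .p)
  q : t.reg (.inr .q) = s.reg (.inr .q)

/-- Move a part of the list `k` to the list `l`. -/
structure Moved (k l : Mem ⊕ Tmp) (a b : List (ℕ × ℕ)) (s t : FullState) : Prop
    extends Frame s t where
  mem_from : s.mem k = a ++ b
  mem_to : t.mem = Function.update (Function.update s.mem k b) l (a.reverse ++ s.mem l)

theorem ex_move (hkl : k ≠ l)
    (htest : ∀ s t, Ex (RegOp.nsem N) test s t →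
      Tested s t ∧ T (abs s).reg (s.reg (.inr .p), s.reg (.inr .q)))
    (h : Ex (RegOp.nsem N) (move k l test) s t) :
    ∃ a b, Moved k l [a] b s t ∧ T (abs s).reg a := by
  obtain ⟨s1, h1, h⟩ := ex_seq.1 h
  obtain ⟨s2, h2, h⟩ := ex_seq.1 h
  obtain ⟨s3, h3, h⟩ := ex_seq.1 h
  obtain ⟨s4, h4, h5⟩ := ex_seq.1 h
  obtain ⟨m, -, rfl⟩ := ex_prim.1 h1
  obtain ⟨n, -, rfl⟩ := ex_prim.1 h2
  obtain ⟨b, hb, rfl⟩ := ex_prim.1 h3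
  obtain ⟨h4, hT⟩ := htest _ _ h4
  obtain rfl := ex_prim.1 h5
  have hmem := h4.mem
  have hp := h4.p
  have hq := h4.q
  have hi := h4.inp
  have hr := h4.reg
  simp only [Function.update_self, ne_eq, Sum.inr.injEq, reduceCtorEq, not_false_eq_true,
    Function.update_of_ne] at hb hmem hp hq hi hr
  refine ⟨(m, n), b, ⟨⟨by rw [← hi], fun r => by rw [← hr]⟩, by simpa using hb, ?_⟩, ?_⟩
  · simp only [hmem, hp, hq]
    simp [hkl.symm]
  · simpa [abs] using hT

theorem runLE_move (hkl : k ≠ l) {c : ℕ}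
    (htest : ∀ s, T (abs s).reg (s.reg (.inr .p), s.reg (.inr .q)) →
      ∃ t, RunLE (RegOp.nsem N) test s t c ∧ Tested s t)
    {a : ℕ × ℕ} {b : List (ℕ × ℕ)} (hs : s.mem k = a :: b) (h1 : a.1 < N) (h2 : a.2 < N)
    (hT : T (abs s).reg a) :
    ∃ t, RunLE (RegOp.nsem N) (move k l test) s t (c + 8) ∧ Moved k l [a] b s t := by
  obtain ⟨t, ht, h⟩ := htest { s with
    reg := Function.update (Function.update s.reg (.inr .p) a.1) (.inr .q) a.2
    mem := Function.update s.mem k b } (by simpa [abs] using hT)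
  have hmem := h.mem
  have hp := h.p
  have hq := h.q
  have hi := h.inp
  have hr := h.reg
  simp only [Function.update_self, ne_eq, Sum.inr.injEq, reduceCtorEq, not_false_eq_true,
    Function.update_of_ne] at hmem hp hq hi hr
  refine ⟨_, ((runLE_guess h1).seq ((runLE_guess h2).seq
    ((runLE_pop ?_).seq (ht.seq runLE_push)))).mono (by omega), ⟨?_, ?_⟩, ?_, ?_⟩
  · simpa using hs
  · exact hi
  · exact hr
  · simpa using hs
  · simp only [hmem, hp, hq]
    simp [hkl.symm]

theorem Moved.trans {a a' b b' : List (ℕ × ℕ)} {u : FullState} (hkl : k ≠ l)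
    (h : Moved k l a b s t) (h' : Moved k l a' b' t u) : Moved k l (a ++ a') b' s u where
  toFrame := h.toFrame.trans h'.toFrame
  mem_from := by
    have := h'.mem_from
    rw [h.mem_to] at this
    simp only [ne_eq, hkl, not_false_eq_true, Function.update_of_ne, Function.update_self] at this
    rw [h.mem_from, this, List.append_assoc]
  mem_to := by
    rw [h'.mem_to, h.mem_to, Function.update_comm hkl]
    simp [Function.update_comm hkl]

theorem ex_star_move (hkl : k ≠ l)
    (htest : ∀ s t, Ex (RegOp.nsem N) test s t →
      Tested s t ∧ T (abs s).reg (s.reg (.inr .p), s.reg (.inr .q)))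
    (h : Ex (RegOp.nsem N) (star (move k l test)) s t) :
    ∃ a b, Moved k l a b s t ∧ ∀ x ∈ a, T (abs s).reg x := by
  rw [ex_star] at h
  induction h using Relation.ReflTransGen.head_induction_on with
  | refl => exact ⟨[], t.mem k, ⟨.rfl, rfl, by simp⟩, by simp⟩
  | head h _ ih =>
    obtain ⟨a, b, h1, h2⟩ := ex_move hkl htest h
    obtain ⟨a', b', h3, h4⟩ := ih
    refine ⟨[a] ++ a', b', h1.trans hkl h3, ?_⟩
    rw [h1.abs_reg] at h4
    simpa using ⟨h2, fun x y => h4 (x, y)⟩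

theorem runLE_star_move (hkl : k ≠ l) {c : ℕ}
    (htest : ∀ s, T (abs s).reg (s.reg (.inr .p), s.reg (.inr .q)) →
      ∃ t, RunLE (RegOp.nsem N) test s t c ∧ Tested s t)
    {a b : List (ℕ × ℕ)} (hs : s.mem k = a ++ b)
    (ha : ∀ x ∈ a, x.1 < N ∧ x.2 < N ∧ T (abs s).reg x) :
    ∃ t, RunLE (RegOp.nsem N) (star (move k l test)) s t ((c + 9) * a.length + 1) ∧
      Moved k l a b s t := by
  induction a generalizing s with
  | nil =>
    obtain rfl : s.mem k = b := hs
    exact ⟨s, RunLE.star_nil.mono (by simp), .rfl, rfl, by simp⟩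
  | cons x a ih =>
    obtain ⟨h1, h2, h3⟩ := ha x (by simp)
    obtain ⟨t, ht, hm⟩ := runLE_move hkl htest hs h1 h2 h3
    obtain ⟨u, hu, hm'⟩ := ih (s := t) (by rw [hm.mem_to]; simp [hkl]) (by
      rw [hm.abs_reg]
      exact fun y hy => ha y (List.mem_cons_of_mem _ hy))
    exact ⟨u, (ht.star_cons hu).mono (by rw [List.length_cons, mul_add]; omega),
      hm.trans hkl hm'⟩

/-- Move the whole list. -/
theorem ex_star_move_all (hkl : k ≠ l)
    (htest : ∀ s t, Ex (RegOp.nsem N) test s t →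
      Tested s t ∧ T (abs s).reg (s.reg (.inr .p), s.reg (.inr .q)))
    (h : Ex (RegOp.nsem N) (seq (star (move k l test)) (prim (.memEnd k))) s t) :
    Moved k l (s.mem k) [] s t ∧ ∀ x ∈ s.mem k, T (abs s).reg x := by
  obtain ⟨u, h1, h2⟩ := ex_seq.1 h
  obtain ⟨a, b, h3, h4⟩ := ex_star_move hkl htest h1
  obtain ⟨h5, rfl⟩ := ex_prim.1 h2
  obtain rfl : b = [] := by simpa [h3.mem_to, hkl] using h5
  have := h3.mem_from
  rw [List.append_nil] at this
  rw [this]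
  exact ⟨h3, h4⟩

theorem runLE_star_move_all (hkl : k ≠ l) {c : ℕ}
    (htest : ∀ s, T (abs s).reg (s.reg (.inr .p), s.reg (.inr .q)) →
      ∃ t, RunLE (RegOp.nsem N) test s t c ∧ Tested s t)
    (ha : ∀ x ∈ s.mem k, x.1 < N ∧ x.2 < N ∧ T (abs s).reg x) :
    ∃ t, RunLE (RegOp.nsem N) (seq (star (move k l test)) (prim (.memEnd k))) s t
      ((c + 9) * (s.mem k).length + 3) ∧ Moved k l (s.mem k) [] s t := by
  obtain ⟨t, h1, h2⟩ := runLE_star_move hkl htest (b := []) (by simp) ha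
  exact ⟨t, (h1.seq (runLE_memEnd (by simp [h2.mem_to, hkl]))).mono (by omega), h2⟩

theorem tested_skip (h : Ex (RegOp.nsem N) skip s t) : Tested s t ∧ True := by
  obtain rfl := ex_skip.1 h
  exact ⟨⟨.rfl, rfl, rfl, rfl⟩, trivial⟩

theorem exists_runLE_skip (s : FullState) : ∃ t, RunLE (RegOp.nsem N) skip s t 1 ∧ Tested s t :=
  ⟨s, .skip, .rfl, rfl, rfl, rfl⟩

end

/-! ### Reading numbers -/

section bits

theorem bval_append (l l' : List Bool) : bval (l ++ l') = bval l + 2 ^ l.length * bval l' := by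
  induction l with
  | nil => simp [bval]
  | cons b l ih => simp only [List.cons_append, bval, ih, List.length_cons, pow_succ]; ring

theorem bval_encodePosNum (n : PosNum) : bval (Computability.encodePosNum n) = n := by
  induction n with
  | one => simp [Computability.encodePosNum, bval]
  | bit1 n ih => simp [Computability.encodePosNum, bval, ih]; omega
  | bit0 n ih => simp [Computability.encodePosNum, bval, ih]; omega

theorem bval_encodeNat (n : ℕ) : bval (Computability.encodeNat n) = n := by
  have : ∀ n : Num, bval (Computability.encodeNum n) = n := by
    intro n
    cases n with
    | zero => simp [Computability.encodeNum, bval]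
    | pos n => simp [Computability.encodeNum, bval_encodePosNum]
  simp [Computability.encodeNat, this]

theorem encodePosNum_eq (n : PosNum) : ∃ l, Computability.encodePosNum n = l ++ [true] := by
  induction n with
  | one => exact ⟨[], rfl⟩
  | bit1 n ih =>
    obtain ⟨l, h⟩ := ih
    exact ⟨true :: l, by simp [Computability.encodePosNum, h]⟩
  | bit0 n ih =>
    obtain ⟨l, h⟩ := ih
    exact ⟨false :: l, by simp [Computability.encodePosNum, h]⟩

theorem encodeNat_eq {n : ℕ} (hn : 0 < n) : ∃ l, Computability.encodeNat n = l ++ [true] := by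
  unfold Computability.encodeNat
  cases h : (n : Num) with
  | zero =>
    have : ((n : Num) : ℕ) = 0 := by rw [h]; rfl
    simp at this
    omega
  | pos m => exact encodePosNum_eq m

theorem exists_encodePosNum (l : List Bool) :
    ∃ n, Computability.encodePosNum n = l ++ [true] := by
  induction l with
  | nil => exact ⟨.one, rfl⟩
  | cons b l ih =>
    obtain ⟨n, h⟩ := ih
    cases b with
    | false => exact ⟨.bit0 n, by simp [Computability.encodePosNum, h]⟩
    | true => exact ⟨.bit1 n, by simp [Computability.encodePosNum, h]⟩

/-- A list of digits without superfluous zeros is the encoding of its value. -/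
theorem encodeNat_bval (l : List Bool) :
    0 < bval (l ++ [true]) ∧ Computability.encodeNat (bval (l ++ [true])) = l ++ [true] := by
  constructor
  · rw [bval_append]
    simp [bval]
  · obtain ⟨n, h⟩ := exists_encodePosNum l
    have h2 : ((n : ℕ) : Num) = .pos n := by simp
    rw [← h, bval_encodePosNum, Computability.encodeNat, h2]
    rfl

end bits

/-- Subtract a multiple of `r` from the auxiliary register `a`, and halve it. -/
def halve (a : Aux) (r : Reg) (b : Bool) : MProg :=
  seq (if b then prim (.lin (.inr a) false (false, .inr a) (true, .inr a) (true, .inl r)) else skip)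
    (prim (.lin (.inr a) false (false, .inr a) (true, .inr a) (true, .inr a)))

/-- Execute `halve a r b` for several pairs of `a` and `r`. -/
def halves (l : List (Aux × Reg)) (b : Bool) : MProg :=
  l.foldr (fun x p => seq (halve x.1 x.2 b) p) skip

/-- The effect of reading the word `w` for the binary representation of a number: for the pairs
`(a, r)` in the list, the value of `a` is divided by `k` after the subtraction of `n * r`. -/
structure Shifted (l : List (Aux × Reg)) (k n : ℕ) (w : List Sym) (s t : FullState) : Prop where
  inp : s.inp = w ++ t.inp
  mem : t.mem = s.mem
  reg : ∀ r, t.reg (.inl r) = s.reg (.inl r)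
  aux : ∀ a, (∀ x ∈ l, x.1 ≠ a) → t.reg (.inr a) = s.reg (.inr a)
  eq : ∀ x ∈ l, s.reg (.inr x.1) = k * t.reg (.inr x.1) + n * s.reg (.inl x.2)

theorem Shifted.trans {l : List (Aux × Reg)} {k n k' n' : ℕ} {w w' : List Sym} {s t u : FullState}
    (h : Shifted l k n w s t) (h' : Shifted l k' n' w' t u) :
    Shifted l (k * k') (n + k * n') (w ++ w') s u where
  inp := by rw [h.inp, h'.inp, List.append_assoc]
  mem := h'.mem.trans h.mem
  reg r := (h'.reg r).trans (h.reg r)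
  aux a ha := (h'.aux a ha).trans (h.aux a ha)
  eq x hx := by rw [h.eq x hx, h'.eq x hx, h.reg]; ring

theorem Shifted.rfl {l : List (Aux × Reg)} {s : FullState} : Shifted l 1 0 [] s s :=
  ⟨by simp, Eq.refl _, fun _ => Eq.refl _, fun _ _ => Eq.refl _, fun _ _ => by simp⟩

section

variable {N : ℕ} {s t : FullState} {a : Aux} {r : Reg} {b : Bool} {l : List (Aux × Reg)}

theorem ex_halve (h : Ex (RegOp.nsem N) (halve a r b) s t) :
    ∃ n, s.reg (.inr a) = 2 * n + b.toNat * s.reg (.inl r) ∧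
      t = { s with reg := Function.update s.reg (.inr a) n } := by
  obtain ⟨u, h1, h2⟩ := ex_seq.1 h
  obtain ⟨n, -, rfl, h3⟩ := ex_prim.1 h2
  cases b with
  | false =>
    obtain rfl := ex_skip.1 h1
    simp [operand] at h3
    exact ⟨n, by simp; omega, rfl⟩
  | true =>
    obtain ⟨m, -, rfl, h4⟩ := ex_prim.1 h1
    simp [operand] at h3 h4
    exact ⟨n, by simp; omega, by simp⟩

theorem runLE_halve {n : ℕ} (h : s.reg (.inr a) = 2 * n + b.toNat * s.reg (.inl r))
    (hN : s.reg (.inr a) < N) : RunLE (RegOp.nsem N) (halve a r b) s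
      { s with reg := Function.update s.reg (.inr a) n } 3 := by
  cases b with
  | false => exact RunLE.skip.seq (runLE_lin (by omega) (by simp [operand] at h ⊢; omega))
  | true =>
    have h1 : RunLE (RegOp.nsem N) (prim (.lin (.inr a) false (false, .inr a) (true, .inr a)
        (true, .inl r))) s { s with reg := Function.update s.reg (.inr a) (2 * n) } 1 :=
      runLE_lin (by omega) (by simp [operand] at h ⊢; omega)
    have h2 : RunLE (RegOp.nsem N) (prim (.lin (.inr a) false (false, .inr a) (true, .inr a)
        (true, .inr a))) { s with reg := Function.update s.reg (.inr a) (2 * n) }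
        { s with reg := Function.update (Function.update s.reg (.inr a) (2 * n)) (.inr a) n } 1 :=
      runLE_lin (by omega) (by simp [operand]; omega)
    rw [Function.update_idem] at h2
    exact h1.seq h2

theorem ex_halves (hl : (l.map Prod.fst).Nodup) (h : Ex (RegOp.nsem N) (halves l b) s t) :
    Shifted l 2 b.toNat [] s t := by
  induction l generalizing s with
  | nil =>
    obtain rfl := ex_skip.1 h
    exact ⟨by simp, rfl, fun _ => rfl, fun _ _ => rfl, by simp⟩
  | cons x l ih =>
    obtain ⟨u, h1, h2⟩ := ex_seq.1 h
    obtain ⟨n, hn, rfl⟩ := ex_halve h1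
    rw [List.map_cons, List.nodup_cons] at hl
    have h3 := ih hl.2 h2
    have hx : ∀ y ∈ l, y.1 ≠ x.1 := fun y hy h =>
      hl.1 (h ▸ List.mem_map_of_mem (f := Prod.fst) hy)
    refine ⟨h3.inp, h3.mem, fun r => by simp [h3.reg], fun a ha => ?_, fun y hy => ?_⟩
    · rw [h3.aux a fun y hy => ha y (List.mem_cons_of_mem _ hy)]
      simp [(ha x (by simp)).symm]
    · rcases List.mem_cons.1 hy with rfl | hy
      · rw [h3.aux y.1 hx, hn]
        simp
      · have := h3.eq y hy
        simpa [hx y hy] using this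

theorem runLE_halves (hl : (l.map Prod.fst).Nodup)
    (h : ∀ x ∈ l, ∃ n, s.reg (.inr x.1) = 2 * n + b.toNat * s.reg (.inl x.2))
    (hN : ∀ x ∈ l, s.reg (.inr x.1) < N) :
    ∃ t, RunLE (RegOp.nsem N) (halves l b) s t (4 * l.length + 1) := by
  induction l generalizing s with
  | nil => exact ⟨s, .skip⟩
  | cons x l ih =>
    rw [List.map_cons, List.nodup_cons] at hl
    have hx : ∀ y ∈ l, y.1 ≠ x.1 := fun y hy h =>
      hl.1 (h ▸ List.mem_map_of_mem (f := Prod.fst) hy)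
    obtain ⟨n, hn⟩ := h x (by simp)
    obtain ⟨t, ht⟩ := ih (s := { s with reg := Function.update s.reg (.inr x.1) n }) hl.2
      (fun y hy => by simpa [hx y hy] using h y (List.mem_cons_of_mem _ hy))
      (fun y hy => by simpa [hx y hy] using hN y (List.mem_cons_of_mem _ hy))
    exact ⟨t, ((runLE_halve hn (hN x (by simp))).seq ht).mono (by rw [List.length_cons]; omega)⟩

/-- Read the binary digit `b`, and adjust the registers in `l`. -/
def readBit (l : List (Aux × Reg)) (b : Bool) : MProg := seq (prim (.inp (.bit b))) (halves l b)

/-- Read an arbitrary number of binary digits. -/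
def readBits (l : List (Aux × Reg)) : MProg := star (alt (readBit l false) (readBit l true))

/-- Read a positive number; its last digit is `true`. -/
def readPos (l : List (Aux × Reg)) : MProg := seq (readBits l) (readBit l true)

/-- Read a number; the word for zero is empty. -/
def readNat (l : List (Aux × Reg)) : MProg := alt skip (readPos l)

theorem ex_readBit (hl : (l.map Prod.fst).Nodup) (h : Ex (RegOp.nsem N) (readBit l b) s t) :
    Shifted l 2 b.toNat [.bit b] s t := by
  obtain ⟨u, h1, h2⟩ := ex_seq.1 h
  obtain ⟨i, hi, rfl⟩ := ex_prim.1 h1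
  have h := ex_halves hl h2
  exact ⟨by rw [hi, ← h.inp.trans (List.nil_append _)]; rfl, h.mem, h.reg, h.aux, h.eq⟩

theorem runLE_readBit (hl : (l.map Prod.fst).Nodup) {i : List Sym} (hi : s.inp = .bit b :: i)
    (h : ∀ x ∈ l, ∃ n, s.reg (.inr x.1) = 2 * n + b.toNat * s.reg (.inl x.2))
    (hN : ∀ x ∈ l, s.reg (.inr x.1) < N) :
    ∃ t, RunLE (RegOp.nsem N) (readBit l b) s t (4 * l.length + 3) := by
  obtain ⟨t, ht⟩ := runLE_halves (s := { s with inp := i }) (b := b) hl h hN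
  exact ⟨t, ((runLE_inp hi).seq ht).mono (by omega)⟩

theorem ex_readBits (hl : (l.map Prod.fst).Nodup) (h : Ex (RegOp.nsem N) (readBits l) s t) :
    ∃ d : List Bool, Shifted l (2 ^ d.length) (bval d) (d.map .bit) s t := by
  rw [readBits, ex_star] at h
  induction h using Relation.ReflTransGen.head_induction_on with
  | refl => exact ⟨[], .rfl⟩
  | head h _ ih =>
    obtain ⟨d, hd⟩ := ih
    obtain ⟨b, hb⟩ : ∃ b, Ex (RegOp.nsem N) (readBit l b) _ _ :=
      (ex_alt.1 h).elim (fun h => ⟨_, h⟩) fun h => ⟨_, h⟩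
    refine ⟨b :: d, ?_⟩
    have := (ex_readBit hl hb).trans hd
    rwa [mul_comm, ← pow_succ] at this

theorem ex_readPos (hl : (l.map Prod.fst).Nodup) (h : Ex (RegOp.nsem N) (readPos l) s t) :
    ∃ n k, 0 < n ∧ 0 < k ∧ Shifted l k n (natWord n) s t := by
  obtain ⟨u, h1, h2⟩ := ex_seq.1 h
  obtain ⟨d, hd⟩ := ex_readBits hl h1
  have := hd.trans (ex_readBit hl h2)
  obtain ⟨h3, h4⟩ := encodeNat_bval d
  refine ⟨bval (d ++ [true]), 2 ^ d.length * 2, h3, by positivity, ?_⟩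
  rw [natWord, h4, bval_append]
  simpa [bval] using this

theorem ex_readNat (hl : (l.map Prod.fst).Nodup) (h : Ex (RegOp.nsem N) (readNat l) s t) :
    ∃ n k, 0 < k ∧ Shifted l k n (natWord n) s t := by
  rcases ex_alt.1 h with h | h
  · obtain rfl := ex_skip.1 h
    exact ⟨0, 1, one_pos, .rfl⟩
  · obtain ⟨n, k, -, hk, h⟩ := ex_readPos hl h
    exact ⟨n, k, hk, h⟩

theorem runLE_readBits (hl : (l.map Prod.fst).Nodup) {d : List Bool} {i : List Sym}
    (hi : s.inp = d.map .bit ++ i)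
    (h : ∀ x ∈ l, ∃ n, s.reg (.inr x.1) = 2 ^ d.length * n + bval d * s.reg (.inl x.2))
    (hN : ∀ x ∈ l, s.reg (.inr x.1) < N) :
    ∃ t, RunLE (RegOp.nsem N) (readBits l) s t ((4 * l.length + 5) * d.length + 1) ∧
      Shifted l (2 ^ d.length) (bval d) (d.map .bit) s t := by
  induction d generalizing s with
  | nil => exact ⟨s, RunLE.star_nil, .rfl⟩
  | cons b d ih =>
    obtain ⟨u, hu⟩ := runLE_readBit (s := s) (N := N) hl hi (b := b) (by
      intro x hx
      obtain ⟨n, hn⟩ := h x hx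
      exact ⟨2 ^ d.length * n + bval d * s.reg (.inl x.2), by
        rw [hn, List.length_cons, bval]; ring⟩) hN
    have h1 := ex_readBit hl hu.ex
    obtain ⟨t, ht, h2⟩ := ih (s := u) (by simpa [h1.inp] using hi) (by
      intro x hx
      obtain ⟨n, hn⟩ := h x hx
      refine ⟨n, ?_⟩
      have := h1.eq x hx
      rw [hn, List.length_cons, bval, pow_succ] at this
      rw [h1.reg]
      linarith) (by
      intro x hx
      have := h1.eq x hx
      have := hN x hx
      omega)
    refine ⟨t, (RunLE.star_cons (m := 4 * l.length + 4) ?_ ht).mono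
      (by rw [List.length_cons, mul_add]; omega), ?_⟩
    · cases b with
      | false => exact hu.altl
      | true => exact hu.altr
    · have := h1.trans h2
      rwa [mul_comm, ← pow_succ] at this

theorem runLE_readPos (hl : (l.map Prod.fst).Nodup) {n : ℕ} (hn : 0 < n) {i : List Sym}
    (hi : s.inp = natWord n ++ i)
    (h : ∀ x ∈ l, s.reg (.inr x.1) = n * s.reg (.inl x.2))
    (hN : ∀ x ∈ l, s.reg (.inr x.1) < N) :
    ∃ t, RunLE (RegOp.nsem N) (readPos l) s t ((4 * l.length + 5) * (natWord n).length + 1) ∧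
      ∃ k, 0 < k ∧ Shifted l k n (natWord n) s t := by
  obtain ⟨d, hd⟩ := encodeNat_eq hn
  have hdn : n = bval d + 2 ^ d.length := by
    have := bval_encodeNat n
    rw [hd, bval_append] at this
    simpa [bval] using this.symm
  have hw : natWord n = d.map .bit ++ [.bit true] := by rw [natWord, hd]; simp
  rw [hw, List.append_assoc] at hi
  obtain ⟨u, hu, h1⟩ := runLE_readBits (s := s) (N := N) hl hi (by
    intro x hx
    refine ⟨s.reg (.inl x.2), ?_⟩
    rw [h x hx, hdn]
    ring) hN
  have h2 : ∀ x ∈ l, u.reg (.inr x.1) = u.reg (.inl x.2) := by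
    intro x hx
    have := h1.eq x hx
    rw [h x hx] at this
    nth_rw 1 [hdn] at this
    rw [h1.reg]
    have h3 : 0 < 2 ^ d.length := by positivity
    refine (Nat.eq_of_mul_eq_mul_left h3 ?_).symm
    linarith
  obtain ⟨t, ht⟩ := runLE_readBit (s := u) (b := true) (i := i) (N := N) hl
    (by simpa [h1.inp] using hi) (fun x hx => ⟨0, by simp [h2 x hx]⟩) (by
      intro x hx
      have := h1.eq x hx
      have := hN x hx
      have : 0 < 2 ^ d.length := by positivity
      nlinarith)
  refine ⟨t, (hu.seq ht).mono (by rw [hw]; simp; ring_nf; omega), 2 ^ d.length * 2,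
    by positivity, ?_⟩
  have := h1.trans (ex_readBit hl ht.ex)
  rw [hw]
  rwa [Bool.toNat_true, mul_one, ← hdn] at this

theorem runLE_readNat (hl : (l.map Prod.fst).Nodup) {n : ℕ} {i : List Sym}
    (hi : s.inp = natWord n ++ i)
    (h : ∀ x ∈ l, s.reg (.inr x.1) = n * s.reg (.inl x.2))
    (hN : ∀ x ∈ l, s.reg (.inr x.1) < N) :
    ∃ t, RunLE (RegOp.nsem N) (readNat l) s t ((4 * l.length + 5) * (natWord n).length + 2) ∧
      ∃ k, 0 < k ∧ Shifted l k n (natWord n) s t := by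
  rcases Nat.eq_zero_or_pos n with rfl | hn
  · exact ⟨s, RunLE.skip.altl.mono (by omega), 1, one_pos, .rfl⟩
  · obtain ⟨t, ht, h⟩ := runLE_readPos hl hn hi h hN
    exact ⟨t, ht.altr, h⟩

end

/-! ### Reading fractions -/

section

variable {N : ℕ} {s t : FullState} {a : Aux} {r : Reg}

/-- Test whether an auxiliary register is zero. -/
def isZero (a : Aux) : MProg :=
  prim (.lin (.inr .z) false (false, .inr a) (false, .inr a) (false, .inr a))

theorem ex_isZero (h : Ex (RegOp.nsem N) (isZero a) s t) :
    s.reg (.inr a) = 0 ∧ Tested s t ∧ ∀ b ≠ .z, t.reg (.inr b) = s.reg (.inr b) := by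
  obtain ⟨v, -, rfl, h⟩ := ex_prim.1 h
  simp only [operand, Bool.toNat_false] at h
  refine ⟨by simpa using h, ⟨⟨rfl, fun r => ?_⟩, rfl, ?_, ?_⟩, fun b hb => ?_⟩
  · simp
  · simp
  · simp
  · simp [hb]

theorem runLE_isZero (hN : 0 < N) (h : s.reg (.inr a) = 0) : ∃ t,
    RunLE (RegOp.nsem N) (isZero a) s t 1 :=
  ⟨_, runLE_lin hN (by simp [operand, h])⟩

/-- Read the numerator, with its sign. If the guessed value of `w` is the product of the absolute
value of the numerator and `den`, then it becomes zero. The register `u` gets the value `v - w` or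
`v + w`, according to the sign. -/
def readNum : MProg :=
  alt (seq (prim (.inp .minus)) (seq
      (prim (.lin (.inr .u) false (false, .inr .v) (true, .inr .u) (false, .inr .w)))
      (readPos [(.w, .den)])))
    (seq (prim (.lin (.inr .u) false (true, .inr .u) (false, .inr .v) (false, .inr .w)))
      (readNat [(.w, .den)]))

/-- Read a fraction `f`, and test whether the value of the register `r` is the corresponding
coordinate, which means that `f.den * r = f.den * off + f.num * den`. To this end, guess
`w = |f.num| * den` and `v = f.den * off`, compute `u = v ± w`, and verify the products
`u = f.den * r`, `v = f.den * off`, and the one for `w`, bit by bit while the factors `f.num` and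
`f.den` are read: the registers have to become zero. -/
def readFrac (r : Reg) : MProg :=
  seq (prim (.guess (.inr .w))) (seq (prim (.guess (.inr .v))) (seq readNum (seq (isZero .w)
    (seq (prim (.inp .slash)) (seq (readPos [(.u, r), (.v, .off)]) (seq (isZero .u)
      (seq (isZero .v) (prim (.inp .comma)))))))))

theorem ex_readNum (h : Ex (RegOp.nsem N) readNum s t) (hw : t.reg (.inr .w) = 0) : ∃ n : ℤ,
    s.inp = (if n < 0 then [Sym.minus] else []) ++ natWord n.natAbs ++ t.inp ∧ t.mem = s.mem ∧
    (∀ r, t.reg (.inl r) = s.reg (.inl r)) ∧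
    (t.reg (.inr .u) : ℤ) = t.reg (.inr .v) + n * s.reg (.inl .den) := by
  rcases ex_alt.1 h with h | h
  · obtain ⟨s1, h1, h⟩ := ex_seq.1 h
    obtain ⟨i, hi, rfl⟩ := ex_prim.1 h1
    obtain ⟨s2, h2, h⟩ := ex_seq.1 h
    obtain ⟨v, -, rfl, h2⟩ := ex_prim.1 h2
    obtain ⟨n, k, hn, -, h3⟩ := ex_readPos (by simp) h
    have h4 := h3.eq (.w, .den) (by simp)
    have h5 := h3.aux .u (by simp)
    have h6 := h3.aux .v (by simp)
    have h7 := h3.inp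
    simp [operand, hw] at h2 h4 h5 h6 h7
    refine ⟨-n, ?_, h3.mem, fun r => by simpa using h3.reg r, ?_⟩
    · rw [if_pos (by omega), Int.natAbs_neg, Int.natAbs_natCast, hi, h7]
      rfl
    · rw [h5, h6, h2, h4]
      push_cast
      ring
  · obtain ⟨s2, h2, h⟩ := ex_seq.1 h
    obtain ⟨v, -, rfl, h2⟩ := ex_prim.1 h2
    obtain ⟨n, k, -, h3⟩ := ex_readNat (by simp) h
    have h4 := h3.eq (.w, .den) (by simp)
    have h5 := h3.aux .u (by simp)
    have h6 := h3.aux .v (by simp)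
    have h7 := h3.inp
    simp [operand, hw] at h2 h4 h5 h6 h7
    refine ⟨n, ?_, h3.mem, fun r => by simpa using h3.reg r, ?_⟩
    · rw [if_neg (by omega), Int.natAbs_natCast, h7]
      rfl
    · rw [h5, h6, h2, h4]
      push_cast
      ring

theorem ex_readFrac (h : Ex (RegOp.nsem N) (readFrac r) s t) : ∃ f : Frac,
    s.inp = f.word ++ t.inp ∧ t.mem = s.mem ∧ (∀ r, t.reg (.inl r) = s.reg (.inl r)) ∧
    (f.den * s.reg (.inl r) : ℤ) = f.den * s.reg (.inl .off) + f.num * s.reg (.inl .den) := by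
  obtain ⟨s1, h1, h⟩ := ex_seq.1 h
  obtain ⟨w, -, rfl⟩ := ex_prim.1 h1
  obtain ⟨s2, h2, h⟩ := ex_seq.1 h
  obtain ⟨v, -, rfl⟩ := ex_prim.1 h2
  obtain ⟨s3, h3, h⟩ := ex_seq.1 h
  obtain ⟨s4, h4, h⟩ := ex_seq.1 h
  obtain ⟨h4, h5, h6⟩ := ex_isZero h4
  obtain ⟨n, n1, n2, n3, n4⟩ := ex_readNum h3 h4
  obtain ⟨s5, h7, h⟩ := ex_seq.1 h
  obtain ⟨i, hi, rfl⟩ := ex_prim.1 h7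
  obtain ⟨s6, h8, h⟩ := ex_seq.1 h
  obtain ⟨d, k, hd, -, h8⟩ := ex_readPos (by simp) h8
  obtain ⟨s7, h9, h⟩ := ex_seq.1 h
  obtain ⟨h9, h10, h11⟩ := ex_isZero h9
  obtain ⟨s8, h12, h⟩ := ex_seq.1 h
  obtain ⟨h12, h13, -⟩ := ex_isZero h12
  obtain ⟨j, hj, rfl⟩ := ex_prim.1 h
  refine ⟨⟨n, d, hd⟩, ?_, ?_, ?_, ?_⟩
  · have e1 := h8.inp
    have e2 := h13.inp
    have e3 := h10.inp
    have e4 := h5.inp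
    simp only at n1 e1
    rw [n1, ← e4, hi, e1, ← e3, ← e2, hj]
    simp [Frac.word]
  · rw [h13.mem, h10.mem, h8.mem, h5.mem, n2]
  · intro r
    rw [h13.reg, h10.reg, h8.reg, h5.reg, n3]
    simp
  · rw [h11 .v (by decide)] at h12
    have e1 := h8.eq (.u, r) (by simp)
    have e2 := h8.eq (.v, .off) (by simp)
    simp only [h9, h12, mul_zero, zero_add, h6 .u (by decide), h6 .v (by decide), h5.reg, n3]
      at e1 e2
    rw [e1, e2] at n4
    simpa using n4

theorem runLE_readNum {n : ℤ} {i : List Sym}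
    (hi : s.inp = (if n < 0 then [Sym.minus] else []) ++ natWord n.natAbs ++ i)
    (hw : s.reg (.inr .w) = n.natAbs * s.reg (.inl .den))
    (hwN : s.reg (.inr .w) < N)
    {u : ℕ} (hu : (u : ℤ) = s.reg (.inr .v) + n * s.reg (.inl .den)) (huN : u < N) :
    ∃ t, RunLE (RegOp.nsem N) readNum s t (9 * (natWord n.natAbs).length + 6) ∧
      t.inp = i ∧ t.mem = s.mem ∧ (∀ r, t.reg (.inl r) = s.reg (.inl r)) ∧
      t.reg (.inr .u) = u ∧ t.reg (.inr .v) = s.reg (.inr .v) ∧ t.reg (.inr .w) = 0 := by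
  by_cases hn : n < 0
  · rw [if_pos hn] at hi
    have hn' : (n.natAbs : ℤ) = -n := by omega
    have e : s.reg (.inr .v) = u + s.reg (.inr .w) := by
      have : (s.reg (.inr .w) : ℤ) = -n * s.reg (.inl .den) := by
        rw [hw]; push_cast; rw [← hn']; simp
      zify
      linarith
    obtain ⟨t, ht, k, hk, h⟩ := runLE_readPos (l := [(.w, .den)]) (n := n.natAbs) (i := i) (N := N)
      (s := { s with inp := natWord n.natAbs ++ i, reg := Function.update s.reg (.inr .u) u })
      (by simp) (by omega) rfl (by simpa using hw) (by simpa using hwN)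
    refine ⟨t, (RunLE.altl ((runLE_inp (by simpa using hi)).seq ((runLE_lin huN
      (by simpa [operand] using e)).seq ht))).mono (by simp; omega), ?_, ?_, ?_, ?_, ?_, ?_⟩
    · simpa using h.inp.symm
    · exact h.mem
    · simpa using h.reg
    · simpa using h.aux .u (by simp)
    · simpa using h.aux .v (by simp)
    · have := h.eq (.w, .den) (by simp)
      simp [hw] at this
      omega
  · rw [if_neg hn] at hi
    have hn' : (n.natAbs : ℤ) = n := by omega
    have e : u = s.reg (.inr .v) + s.reg (.inr .w) := by
      zify
      rw [hu, hw]; push_cast; rw [← hn']; simp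
    obtain ⟨t, ht, k, hk, h⟩ := runLE_readNat (l := [(.w, .den)]) (n := n.natAbs) (i := i) (N := N)
      (s := { s with reg := Function.update s.reg (.inr .u) u })
      (by simp) (by simpa using hi) (by simpa using hw) (by simpa using hwN)
    refine ⟨t, (RunLE.altr ((runLE_lin huN
      (by simpa [operand] using e)).seq ht)).mono (by simp; omega), ?_, ?_, ?_, ?_, ?_, ?_⟩
    · exact List.append_cancel_left (h.inp.symm.trans (by simpa using hi))
    · exact h.mem
    · simpa using h.reg
    · simpa using h.aux .u (by simp)
    · simpa using h.aux .v (by simp)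
    · have := h.eq (.w, .den) (by simp)
      simp [hw] at this
      omega

theorem runLE_readFrac {f : Frac} {i : List Sym} (hi : s.inp = f.word ++ i)
    (hf : (f.den * s.reg (.inl r) : ℤ) = f.den * s.reg (.inl .off) + f.num * s.reg (.inl .den))
    (h1 : f.num.natAbs * s.reg (.inl .den) < N) (h2 : f.den * s.reg (.inl .off) < N)
    (h3 : f.den * s.reg (.inl r) < N) :
    ∃ t, RunLE (RegOp.nsem N) (readFrac r) s t (13 * f.word.length + 24) ∧
      t.inp = i ∧ t.mem = s.mem ∧ ∀ r, t.reg (.inl r) = s.reg (.inl r) := by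
  have hi' : s.inp = (if f.num < 0 then [Sym.minus] else []) ++ natWord f.num.natAbs ++
      (.slash :: (natWord f.den ++ .comma :: i)) := by
    rw [hi, Frac.word]; simp
  have len : f.word.length = (if f.num < 0 then [Sym.minus] else []).length +
      (natWord f.num.natAbs).length + (natWord f.den).length + 2 := by
    rw [Frac.word]; simp; omega
  obtain ⟨s1, r1, a1, a2, a3, a4, a5, a6⟩ := runLE_readNum (N := N) (u := f.den * s.reg (.inl r))
    (s := { s with reg := Function.update (Function.update s.reg (.inr .w)
      (f.num.natAbs * s.reg (.inl .den))) (.inr .v) (f.den * s.reg (.inl .off)) })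
    hi' (by simp) (by simpa using h1) (by simpa using hf) h3
  obtain ⟨s2, r2⟩ := runLE_isZero (N := N) (by omega) a6
  obtain ⟨-, b1, b2⟩ := ex_isZero r2.ex
  simp only [ne_eq, reduceCtorEq, not_false_eq_true, Function.update_of_ne,
    Function.update_self] at a3 a5
  obtain ⟨s3, r3, k, hk, h⟩ := runLE_readPos (l := [(.u, r), (.v, .off)]) (n := f.den)
    (i := .comma :: i) (N := N) (s := { s2 with inp := natWord f.den ++ .comma :: i })
    (by simp) f.den_pos rfl (by simp [b2, b1.reg, a3, a4, a5]) (by simp [b2, a4, a5, h2, h3])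
  have e1 := h.eq (.u, r) (by simp)
  have e2 := h.eq (.v, .off) (by simp)
  simp only [b2 .u (by decide), b2 .v (by decide), b1.reg, a3, a4, a5] at e1 e2
  have e1 : s3.reg (.inr .u) = 0 := by
    rcases Nat.mul_eq_zero.1 (show k * s3.reg (.inr .u) = 0 by omega) with h | h <;> omega
  have e2 : s3.reg (.inr .v) = 0 := by
    rcases Nat.mul_eq_zero.1 (show k * s3.reg (.inr .v) = 0 by omega) with h | h <;> omega
  obtain ⟨s4, r4⟩ := runLE_isZero (N := N) (by omega) e1
  obtain ⟨-, c1, c2⟩ := ex_isZero r4.ex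
  obtain ⟨s5, r5⟩ := runLE_isZero (N := N) (s := s4) (a := .v) (by omega)
    (by rw [c2 _ (by decide), e2])
  obtain ⟨-, d1, -⟩ := ex_isZero r5.ex
  refine ⟨{ s5 with inp := i }, ((runLE_guess h1).seq ((runLE_guess h2).seq (r1.seq (r2.seq
    ((runLE_inp (by rw [b1.inp, a1])).seq (r3.seq (r4.seq (r5.seq (runLE_inp ?_))))))))).mono ?_,
    rfl, ?_, ?_⟩
  · rw [d1.inp, c1.inp]
    simpa using h.inp.symm
  · simp only [List.length_cons, List.length_nil]
    omega
  · simp only [d1.mem, c1.mem, h.mem, b1.mem, a2]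
  · intro r
    simp only [d1.reg, c1.reg, h.reg, b1.reg, a3]

end

/-! ### The operations of the verifier -/

/-- The operations of the verifier: guess the values of all main registers, read a fraction, make
an element of a list of points the current point, push the current point to a list, move the
current point horizontally or vertically, test that the current point is not one of the old
terminals, prepare for the next group, test that the budget is not exceeded, read a symbol, and test
for the end of the input. -/
inductive Op
  | start
  | read (r : Reg)
  | pick (m : Mem)
  | push (m : Mem)
  | grow
  | avoid
  | next
  | check
  | inp (c : Sym)
  | inpEnd

/-- The effect of an operation. -/
def Op.sem : Op → State → State → Prop
  | .start, s, t => 0 < t.reg .den ∧ t.mem = s.mem ∧ t.inp = s.inp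
  | .read r, s, t => ∃ f : Frac, s.inp = f.word ++ t.inp ∧ t.mem = s.mem ∧ t.reg = s.reg ∧
      (f.den * s.reg r : ℤ) = f.den * s.reg .off + f.num * s.reg .den
  | .pick m, s, t => ∃ p ∈ s.mem m,
      t = { s with reg := Function.update (Function.update s.reg .x p.1) .y p.2 }
  | .push m, s, t =>
      t = { s with mem := Function.update s.mem m ((s.reg .x, s.reg .y) :: s.mem m) }
  | .grow, s, t => ∃ r n e b, (r = .x ∨ r = .y) ∧ (n = s.reg r + e ∨ s.reg r = n + e) ∧
      s.reg .bud = b + e ∧ t = { s with reg := Function.update (Function.update s.reg r n) .bud b }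
  | .avoid, s, t => (s.reg .x, s.reg .y) ∉ s.mem .old ∧ t = s
  | .next, s, t => t = { s with mem := Function.update (Function.update (Function.update s.mem
      .cur []) .old ((s.mem .new).reverse ++ s.mem .old)) .new [] }
  | .check, s, t => s.reg .off ≤ s.reg .bud ∧ t = s
  | .inp c, s, t => ∃ l, s.inp = c :: l ∧ t = { s with inp := l }
  | .inpEnd, s, t => s.inp = [] ∧ t = s

/-- All numbers in the state are at most `c`, and there are at most `L` points in each list and at
most `L` symbols in the input. -/
structure Bounded (c L : ℕ) (s : State) : Prop where
  reg : ∀ r, s.reg r ≤ c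
  pt : ∀ m, ∀ p ∈ s.mem m, p.1 ≤ c ∧ p.2 ≤ c
  mem : ∀ m, (s.mem m).length ≤ L
  inp : s.inp.length ≤ L

/-- Test whether the current point differs from the point in the registers `p` and `q`. -/
def differs : MProg :=
  alt (alt (prim (.lin (.inr .e) true (false, .inl .x) (false, .inr .p) (true, .inr .e)))
      (prim (.lin (.inr .e) true (false, .inr .p) (false, .inl .x) (true, .inr .e))))
    (alt (prim (.lin (.inr .e) true (false, .inl .y) (false, .inr .q) (true, .inr .e)))
      (prim (.lin (.inr .e) true (false, .inr .q) (false, .inl .y) (true, .inr .e))))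

/-- Move all points back to the list `m`. -/
def unload (m : Mem) : MProg :=
  seq (star (move (.inr .tmp) (.inl m) skip)) (prim (.memEnd (.inr .tmp)))

/-- Change the register `r` by the value of the register `e`. -/
def shift (r : Reg) : MProg :=
  alt (prim (.lin (.inl r) false (true, .inl r) (false, .inl r) (false, .inr .e)))
    (prim (.lin (.inl r) false (false, .inl r) (true, .inl r) (false, .inr .e)))

/-- Programs for the operations. -/
def Op.prog : Op → MProg
  | .start => seq (prim (.guess (.inl .den))) (seq (prim (.guess (.inl .off)))
      (seq (prim (.guess (.inl .x))) (seq (prim (.guess (.inl .y))) (seq (prim (.guess (.inl .bud)))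
        (seq (prim (.guess (.inr .p)))
          (prim (.lin (.inr .e) true (false, .inl .den) (false, .inr .p) (true, .inr .e))))))))
  | .read r => readFrac r
  | .pick m => seq (star (move (.inl m) (.inr .tmp) skip)) (seq (prim (.guess (.inl .x)))
      (seq (prim (.guess (.inl .y))) (seq (prim (.pop (.inl m) (.inl .x) (.inl .y)))
        (seq (prim (.push (.inl m) (.inl .x) (.inl .y))) (unload m)))))
  | .push m => prim (.push (.inl m) (.inl .x) (.inl .y))
  | .grow => seq (prim (.guess (.inr .e))) (seq (alt (shift .x) (shift .y))
      (prim (.lin (.inl .bud) false (false, .inl .bud) (true, .inl .bud) (false, .inr .e))))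
  | .avoid => seq (seq (star (move (.inl .old) (.inr .tmp) differs)) (prim (.memEnd (.inl .old))))
      (unload .old)
  | .next => seq (seq (star (move (.inl .cur) (.inr .trash) skip)) (prim (.memEnd (.inl .cur))))
      (seq (star (move (.inl .new) (.inl .old) skip)) (prim (.memEnd (.inl .new))))
  | .check => prim (.lin (.inr .e) false (false, .inl .bud) (false, .inl .off) (true, .inr .e))
  | .inp c => prim (.inp c)
  | .inpEnd => prim .inpEnd

section

variable {N c L : ℕ} {s t : FullState}

theorem ex_differs (h : Ex (RegOp.nsem N) differs s t) : Tested s t ∧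
    (s.reg (.inr .p), s.reg (.inr .q)) ≠ ((abs s).reg .x, (abs s).reg .y) := by
  have key : ∀ P Q, Ex (RegOp.nsem N) (prim (.lin (.inr .e) true (false, P) (false, Q)
      (true, .inr .e))) s t → Tested s t ∧ s.reg P ≠ s.reg Q := by
    intro P Q h
    obtain ⟨v, -, rfl, h⟩ := ex_prim.1 h
    simp [operand] at h
    exact ⟨⟨⟨rfl, by simp⟩, rfl, by simp, by simp⟩, by omega⟩
  simp only [differs, ex_alt] at h
  simp only [abs, ne_eq, Prod.mk.injEq]
  rcases h with (h | h) | (h | h)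
  · obtain ⟨h, h'⟩ := key _ _ h
    exact ⟨h, fun h => h' h.1.symm⟩
  · obtain ⟨h, h'⟩ := key _ _ h
    exact ⟨h, fun h => h' h.1⟩
  · obtain ⟨h, h'⟩ := key _ _ h
    exact ⟨h, fun h => h' h.2.symm⟩
  · obtain ⟨h, h'⟩ := key _ _ h
    exact ⟨h, fun h => h' h.2⟩

theorem runLE_differs (h : (s.reg (.inr .p), s.reg (.inr .q)) ≠ ((abs s).reg .x, (abs s).reg .y))
    (hp : s.reg (.inr .p) < N) (hq : s.reg (.inr .q) < N) (hx : (abs s).reg .x < N)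
    (hy : (abs s).reg .y < N) : ∃ t, RunLE (RegOp.nsem N) differs s t 3 ∧ Tested s t := by
  have key : ∀ P Q, s.reg P < N → s.reg Q < s.reg P → P ≠ .inr .e → Q ≠ .inr .e →
      ∃ t, RunLE (RegOp.nsem N) (prim (.lin (.inr .e) true (false, P) (false, Q)
      (true, .inr .e))) s t 1 := by
    intro P Q h1 h2 h3 h4
    exact ⟨_, runLE_lin (v := s.reg P - s.reg Q - 1) (by omega) (by simp [operand]; omega)⟩
  suffices h : ∃ t, RunLE (RegOp.nsem N) differs s t 3 from
    let ⟨t, h⟩ := h; ⟨t, h, (ex_differs h.ex).1⟩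
  simp only [abs, ne_eq, Prod.mk.injEq] at h hx hy
  by_cases h1 : s.reg (.inr .p) = s.reg (.inl .x)
  · have h2 : s.reg (.inr .q) ≠ s.reg (.inl .y) := fun h2 => h ⟨h1, h2⟩
    rcases Nat.lt_or_gt_of_ne h2 with h2 | h2
    · obtain ⟨t, h⟩ := key _ _ hy h2 (by simp) (by simp)
      exact ⟨t, h.altl.altr⟩
    · obtain ⟨t, h⟩ := key _ _ hq h2 (by simp) (by simp)
      exact ⟨t, h.altr.altr⟩
  · rcases Nat.lt_or_gt_of_ne h1 with h2 | h2
    · obtain ⟨t, h⟩ := key _ _ hx h2 (by simp) (by simp)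
      exact ⟨t, h.altl.altl⟩
    · obtain ⟨t, h⟩ := key _ _ hp h2 (by simp) (by simp)
      exact ⟨t, h.altr.altl⟩

theorem ex_unload {m : Mem} (h : Ex (RegOp.nsem N) (unload m) s t) :
    Moved (.inr .tmp) (.inl m) (s.mem (.inr .tmp)) [] s t :=
  (ex_star_move_all (T := fun _ _ => True) (by simp) (fun _ _ => tested_skip) h).1

theorem runLE_unload {m : Mem} (h : ∀ x ∈ s.mem (.inr .tmp), x.1 < N ∧ x.2 < N) :
    ∃ t, RunLE (RegOp.nsem N) (unload m) s t (10 * (s.mem (.inr .tmp)).length + 3) ∧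
      Moved (.inr .tmp) (.inl m) (s.mem (.inr .tmp)) [] s t :=
  runLE_star_move_all (T := fun _ _ => True) (by simp) (fun s _ => exists_runLE_skip s)
    fun x hx => ⟨(h x hx).1, (h x hx).2, trivial⟩

/-- Moving points back and forth has no effect. -/
theorem Moved.back {m : Mem} {u : FullState} {a b : List (ℕ × ℕ)} (hs : s.mem (.inr .tmp) = [])
    (h : Moved (.inl m) (.inr .tmp) a b s t)
    (h' : u.mem = Function.update (Function.update t.mem (.inr .tmp) []) (.inl m)
      ((t.mem (.inr .tmp)).reverse ++ t.mem (.inl m))) : u.mem = s.mem := by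
  rw [h', h.mem_to]
  funext j
  rcases j with j | j
  · by_cases hj : j = m
    · subst hj; simp [hs, h.mem_from]
    · simp [hj]
  · cases j <;> simp [hs]

theorem ex_shift {r : Reg} (h : Ex (RegOp.nsem N) (shift r) s t) :
    ∃ n, (n = s.reg (.inl r) + s.reg (.inr .e) ∨ s.reg (.inl r) = n + s.reg (.inr .e)) ∧
      t = { s with reg := Function.update s.reg (.inl r) n } := by
  rcases ex_alt.1 h with h | h
  · obtain ⟨n, -, rfl, h⟩ := ex_prim.1 h
    simp [operand] at h
    exact ⟨n, .inl h, rfl⟩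
  · obtain ⟨n, -, rfl, h⟩ := ex_prim.1 h
    simp [operand] at h
    exact ⟨n, .inr h, rfl⟩

theorem runLE_shift {r : Reg} {n : ℕ} (hn : n < N)
    (h : n = s.reg (.inl r) + s.reg (.inr .e) ∨ s.reg (.inl r) = n + s.reg (.inr .e)) :
    RunLE (RegOp.nsem N) (shift r) s { s with reg := Function.update s.reg (.inl r) n } 2 := by
  rcases h with h | h
  · exact (runLE_lin hn (by simpa [operand] using h)).altl
  · exact (runLE_lin hn (by simpa [operand] using h)).altr

theorem Op.sound (i : Op) (hs : s.mem (.inr .tmp) = []) (h : Ex (RegOp.nsem N) i.prog s t) :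
    i.sem (abs s) (abs t) ∧ t.mem (.inr .tmp) = [] := by
  cases i with
  | start =>
    simp only [Op.prog, ex_seq, ex_prim] at h
    obtain ⟨_, ⟨_, _, rfl⟩, _, ⟨_, _, rfl⟩, _, ⟨_, _, rfl⟩, _, ⟨_, _, rfl⟩, _, ⟨_, _, rfl⟩, _,
      ⟨_, _, rfl⟩, _, _, rfl, h⟩ := h
    simp [operand] at h
    refine ⟨⟨?_, rfl, rfl⟩, hs⟩
    simp [abs]
    omega
  | read r =>
    obtain ⟨f, h1, h2, h3, h4⟩ := ex_readFrac h
    refine ⟨⟨f, h1, ?_, funext h3, h4⟩, by rw [h2, hs]⟩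
    simp [abs, h2]
  | pick m =>
    obtain ⟨s1, h1, h⟩ := ex_seq.1 h
    obtain ⟨a, b, h1, -⟩ := ex_star_move (T := fun _ _ => True) (by simp)
      (fun _ _ => tested_skip) h1
    obtain ⟨s2, h2, h⟩ := ex_seq.1 h
    obtain ⟨x, -, rfl⟩ := ex_prim.1 h2
    obtain ⟨s3, h3, h⟩ := ex_seq.1 h
    obtain ⟨y, -, rfl⟩ := ex_prim.1 h3
    obtain ⟨s4, h4, h⟩ := ex_seq.1 h
    obtain ⟨c, hc, rfl⟩ := ex_prim.1 h4
    obtain ⟨s5, h5, h⟩ := ex_seq.1 h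
    obtain rfl := ex_prim.1 h5
    have h6 := ex_unload h
    have h7 := h6.mem_to
    have h8 := h6.reg
    simp at hc
    simp [← hc] at h7 h8
    have h9 := h1.back hs h7
    have hm : s.mem (.inl m) = a ++ (x, y) :: c := by
      rw [h1.mem_from, ← hc, h1.mem_to]
      simp
    refine ⟨⟨(x, y), by simp [abs, hm], NState.ext ?_ ?_ (h6.inp.trans h1.inp)⟩, by rw [h9, hs]⟩
    · funext r
      simp only [abs, h8]
      cases r <;> simp [h1.reg]
    · funext j
      simp [abs, h9]
  | push m =>
    obtain rfl := ex_prim.1 h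
    exact ⟨abs_mem, by simpa using hs⟩
  | grow =>
    obtain ⟨s1, h1, h⟩ := ex_seq.1 h
    obtain ⟨e, -, rfl⟩ := ex_prim.1 h1
    obtain ⟨s2, h2, h⟩ := ex_seq.1 h
    obtain ⟨r, hr, h2⟩ : ∃ r, (r = .x ∨ r = .y) ∧ Ex (RegOp.nsem N) (shift r) _ s2 :=
      (ex_alt.1 h2).elim (fun h => ⟨_, .inl rfl, h⟩) fun h => ⟨_, .inr rfl, h⟩
    obtain ⟨n, hn, rfl⟩ := ex_shift h2
    obtain ⟨b, -, rfl, h⟩ := ex_prim.1 h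
    have hr' : r ≠ .bud := by rintro rfl; simp at hr
    simp [operand, hr'.symm] at h hn
    refine ⟨⟨r, n, e, b, hr, hn, h, ?_⟩, hs⟩
    rw [abs_reg, abs_reg, abs_aux]
  | avoid =>
    obtain ⟨s1, h1, h⟩ := ex_seq.1 h
    obtain ⟨h1, h2⟩ := ex_star_move_all
      (T := fun f p => p ≠ (f .x, f .y)) (by simp) (fun _ _ => ex_differs) h1
    have h3 := ex_unload h
    have h4 := h1.back hs h3.mem_to
    refine ⟨⟨fun h => h2 _ h rfl, (h1.toFrame.trans h3.toFrame).abs_eq fun m => by rw [h4]⟩, ?_⟩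
    rw [h4, hs]
  | next =>
    obtain ⟨s1, h1, h⟩ := ex_seq.1 h
    obtain ⟨h1, -⟩ := ex_star_move_all (T := fun _ _ => True) (by simp)
      (fun _ _ => tested_skip) h1
    obtain ⟨h2, -⟩ := ex_star_move_all (T := fun _ _ => True) (by simp)
      (fun _ _ => tested_skip) h
    refine ⟨NState.ext (h1.toFrame.trans h2.toFrame).abs_reg ?_
      (h1.toFrame.trans h2.toFrame).inp, ?_⟩
    · funext j
      cases j <;> simp [abs, h2.mem_to, h1.mem_to]
    · simp [h2.mem_to, h1.mem_to, hs]
  | check =>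
    obtain ⟨v, -, rfl, h⟩ := ex_prim.1 h
    simp [operand] at h
    refine ⟨⟨?_, abs_aux⟩, hs⟩
    simp [abs]
    omega
  | inp c =>
    obtain ⟨l, hl, rfl⟩ := ex_prim.1 h
    exact ⟨⟨l, hl, rfl⟩, hs⟩
  | inpEnd =>
    obtain ⟨hl, rfl⟩ := ex_prim.1 h
    exact ⟨⟨hl, rfl⟩, hs⟩

theorem lt_two_pow_length_natWord (n : ℕ) : n < 2 ^ (natWord n).length := by
  have := bval_lt (Computability.encodeNat n)
  rwa [bval_encodeNat, ← List.length_map (f := Sym.bit)] at this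

/-- A program that implements an operation may be assumed to be correct. -/
theorem Op.complete_of_runLE {i : Op} {t' : State} (hs : s.mem (.inr .tmp) = [])
    (h : RunLE (RegOp.nsem N) i.prog s t c) (h' : abs t = t') :
    ∃ t, RunLE (RegOp.nsem N) i.prog s t c ∧ abs t = t' ∧ t.mem (.inr .tmp) = [] :=
  ⟨t, h, h', (i.sound hs h.ex).2⟩

theorem Op.complete (i : Op) {t' : State} (hs : s.mem (.inr .tmp) = [])
    (h : i.sem (abs s) t') (hN : 2 ^ L * c < N) (hb : i ≠ .start → Bounded c L (abs s))
    (hb' : Bounded c L t') :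
    ∃ t, RunLE (RegOp.nsem N) i.prog s t (30 * (L + 1)) ∧ abs t = t' ∧
      t.mem (.inr .tmp) = [] := by
  have mul_lt : ∀ {k m : ℕ}, k ≤ 2 ^ L → m ≤ c → k * m < N := fun h h' =>
    (Nat.mul_le_mul h h').trans_lt hN
  have lt : ∀ {m : ℕ}, m ≤ c → m < N := fun h => by
    simpa using mul_lt (k := 1) Nat.one_le_two_pow h
  have pt_lt : ∀ {s m}, Bounded c L s → ∀ p ∈ s.mem m, p.1 < N ∧ p.2 < N := fun h p hp =>
    ⟨lt (h.pt _ p hp).1, lt (h.pt _ p hp).2⟩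
  cases i with
  | start =>
    obtain ⟨h1, h2, h3⟩ := h
    refine Op.complete_of_runLE hs (((runLE_guess (lt (hb'.reg .den))).seq
      ((runLE_guess (lt (hb'.reg .off))).seq ((runLE_guess (lt (hb'.reg .x))).seq
      ((runLE_guess (lt (hb'.reg .y))).seq ((runLE_guess (lt (hb'.reg .bud))).seq
      ((runLE_guess ((Nat.zero_le _).trans_lt (lt (hb'.reg .den)))).seq
      (runLE_lin (v := t'.reg .den - 1) ?_ ?_))))))).mono (by omega)) ?_
    · have := lt (hb'.reg .den)
      omega
    · simp [operand]
      omega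
    · refine NState.ext (funext fun r => ?_) h2.symm h3.symm
      cases r <;> simp [abs]
  | read r =>
    replace hb := hb (by simp)
    obtain ⟨f, h1, h2, h3, h4⟩ := h
    have hl := h1 ▸ hb.inp
    rw [List.length_append] at hl
    have h5 : f.num.natAbs ≤ 2 ^ L :=
      (lt_two_pow_length_natWord _).le.trans (Nat.pow_le_pow_right (by norm_num)
        (le_trans (by simp [Frac.word]; omega) hl))
    have h6 : f.den ≤ 2 ^ L :=
      (lt_two_pow_length_natWord _).le.trans (Nat.pow_le_pow_right (by norm_num)
        (le_trans (by simp [Frac.word]; omega) hl))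
    obtain ⟨t, ht, e1, e2, e3⟩ := runLE_readFrac (N := N) h1 h4
      (mul_lt h5 (hb.reg .den)) (mul_lt h6 (hb.reg .off)) (mul_lt h6 (hb.reg r))
    refine Op.complete_of_runLE hs (ht.mono (by omega)) ?_
    refine NState.ext (h3 ▸ funext e3) (h2 ▸ ?_) e1
    funext m
    simp [abs, e2]
  | pick m =>
    replace hb := hb (by simp)
    obtain ⟨p, hp, rfl⟩ := h
    obtain ⟨a, b, hm⟩ := List.append_of_mem hp
    have hm' : s.mem (.inl m) = a ++ p :: b := hm
    have hL := hb.mem m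
    rw [hm, List.length_append] at hL
    have hpt := pt_lt (m := m) hb
    rw [hm] at hpt
    obtain ⟨s1, r1, h1⟩ := runLE_star_move (N := N) (T := fun _ _ => True) (test := skip)
      (l := .inr .tmp) (by simp) (fun s _ => exists_runLE_skip s) hm'
      fun x hx => ⟨(hpt x (by simp [hx])).1, (hpt x (by simp [hx])).2, trivial⟩
    have e1 : s1.mem (.inr .tmp) = a.reverse := by simp [h1.mem_to, hs]
    have e2 : s1.mem (.inl m) = p :: b := by simp [h1.mem_to]
    obtain ⟨t, r2, h2⟩ := runLE_unload (N := N) (m := m) (s := { s1 with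
      reg := Function.update (Function.update s1.reg (.inl .x) p.1) (.inl .y) p.2 }) (by
        simp only [e1, List.mem_reverse]
        exact fun x hx => hpt x (by simp [hx]))
    have h3 := h1.back hs h2.mem_to
    refine Op.complete_of_runLE (t := t) hs ((r1.seq ((runLE_guess (hpt p (by simp)).1).seq
      ((runLE_guess (hpt p (by simp)).2).seq ((runLE_pop (l := b) ?_).seq (runLE_push.seq
        (n := 10 * (s1.mem (.inr .tmp)).length + 3) ?_))))).mono ?_) ?_
    · simp [e2]
    · convert r2 using 2
      simp [← e2]
    · rw [e1, List.length_reverse]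
      omega
    · refine NState.ext (funext fun r => ?_) (funext fun j => ?_) (h2.inp.trans h1.inp)
      · simp only [abs, h2.reg]
        cases r <;> simp [h1.reg]
      · simp [abs, h3]
  | push m =>
    replace hb := hb (by simp)
    obtain rfl := h
    exact Op.complete_of_runLE hs (runLE_push.mono (by omega)) abs_mem
  | grow =>
    replace hb := hb (by simp)
    obtain ⟨r, n, e, b, hr, hn, hbud, rfl⟩ := h
    have hr' : r ≠ .bud := by rintro rfl; simp at hr
    have b1 := lt (hb.reg r)
    have b2 := lt (hb'.reg r)
    have b3 := lt (hb'.reg .bud)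
    have b4 := lt (hb.reg .bud)
    simp [hr'] at b2 b3
    have r1 : RunLE (RegOp.nsem N) (alt (shift .x) (shift .y))
        { s with reg := Function.update s.reg (.inr .e) e }
        { s with reg := Function.update (Function.update s.reg (.inr .e) e) (.inl r) n } 3 := by
      have := runLE_shift (N := N) (r := r) (n := n)
        (s := { s with reg := Function.update s.reg (.inr .e) e }) b2
        (by simpa [abs] using hn)
      rcases hr with rfl | rfl
      · exact this.altl
      · exact this.altr
    refine Op.complete_of_runLE hs (((runLE_guess ?_).seq (r1.seq (runLE_lin b3 ?_))).mono
      (by omega)) ?_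
    · omega
    · simpa [operand, hr'.symm, abs] using hbud
    · refine NState.ext (funext fun r' => ?_) rfl rfl
      rcases hr with rfl | rfl <;> cases r' <;> simp [abs]
  | avoid =>
    replace hb := hb (by simp)
    obtain ⟨h, rfl⟩ := h
    have b1 := lt (hb.reg .x)
    have b2 := lt (hb.reg .y)
    have b3 := pt_lt (m := .old) hb
    have b4 := hb.mem .old
    obtain ⟨s1, r1, h1⟩ := runLE_star_move_all (s := s) (N := N) (k := .inl .old) (l := .inr .tmp)
      (T := fun f p => (p ≠ (f .x, f .y) ∧ p.1 < N ∧ p.2 < N) ∧ f .x < N ∧ f .y < N)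
      (test := differs) (by simp)
      (fun s h => runLE_differs h.1.1 h.1.2.1 h.1.2.2 h.2.1 h.2.2)
      (fun x hx => ⟨(b3 x hx).1, (b3 x hx).2,
        ⟨fun h' => h (h' ▸ hx), (b3 x hx).1, (b3 x hx).2⟩, b1, b2⟩)
    have e1 : s1.mem (.inr .tmp) = (s.mem (.inl .old)).reverse := by simp [h1.mem_to, hs]
    obtain ⟨t, r2, h2⟩ := runLE_unload (N := N) (m := .old) (s := s1) (by
        simp only [e1, List.mem_reverse]
        exact fun x hx => b3 x hx)
    refine Op.complete_of_runLE hs ((r1.seq r2).mono ?_) ?_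
    · have b4 : (s.mem (.inl .old)).length ≤ L := b4
      rw [e1, List.length_reverse]
      omega
    · exact (h1.toFrame.trans h2.toFrame).abs_eq fun m => by rw [h1.back hs h2.mem_to]
  | next =>
    replace hb := hb (by simp)
    obtain rfl := h
    obtain ⟨s1, r1, h1⟩ := runLE_star_move_all (s := s) (N := N) (k := .inl .cur) (l := .inr .trash)
      (T := fun _ _ => True) (test := skip) (by simp) (fun s _ => exists_runLE_skip s)
      (fun x hx => ⟨(pt_lt (m := .cur) hb x hx).1, (pt_lt (m := .cur) hb x hx).2, trivial⟩)
    have e1 : s1.mem (.inl .new) = s.mem (.inl .new) := by simp [h1.mem_to]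
    obtain ⟨t, r2, h2⟩ := runLE_star_move_all (s := s1) (N := N) (k := .inl .new) (l := .inl .old)
      (T := fun _ _ => True) (test := skip) (by simp) (fun s _ => exists_runLE_skip s)
      (by
        rw [e1]
        exact fun x hx =>
          ⟨(pt_lt (m := .new) hb x hx).1, (pt_lt (m := .new) hb x hx).2, trivial⟩)
    refine Op.complete_of_runLE hs ((r1.seq r2).mono ?_) ?_
    · have b1 : (s.mem (.inl .cur)).length ≤ L := hb.mem .cur
      have b2 : (s.mem (.inl .new)).length ≤ L := hb.mem .new
      rw [e1]
      omega
    · refine NState.ext (h1.toFrame.trans h2.toFrame).abs_reg (funext fun j => ?_)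
        (h1.toFrame.trans h2.toFrame).inp
      cases j <;> simp [abs, h2.mem_to, h1.mem_to]
  | check =>
    replace hb := hb (by simp)
    obtain ⟨h, rfl⟩ := h
    have b1 := lt (hb.reg .bud)
    refine Op.complete_of_runLE hs
      ((runLE_lin (v := (abs s).reg .bud - (abs s).reg .off) ?_ ?_).mono
      (by omega)) abs_aux
    · omega
    · simp [operand, abs] at h ⊢
      omega
  | inp c =>
    replace hb := hb (by simp)
    obtain ⟨l, h, rfl⟩ := h
    have h : s.inp = c :: l := h
    exact Op.complete_of_runLE hs ((runLE_inp h).mono (by omega)) rfl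
  | inpEnd =>
    replace hb := hb (by simp)
    obtain ⟨h, rfl⟩ := h
    have h : s.inp = [] := h
    exact Op.complete_of_runLE hs ((runLE_inpEnd h).mono (by omega)) rfl

end

/-- The effect of an operation on states with small numbers. -/
def Op.bsem (c L : ℕ) (i : Op) (s t : State) : Prop :=
  i.sem s t ∧ (i ≠ .start → Bounded c L s) ∧ Bounded c L t

/-- A language is in NP if it is recognized by a program whose operations are those of the verifier,
with polynomial bounds on the number of steps, on the length of the numbers, and on the length of
the lists. -/
theorem inNP_of_op_program (P : Language Sym) (p : Prog Op) (f g h : Polynomial ℕ)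
    (sound : ∀ s t : State, s.mem = (fun _ => []) → Ex Op.sem p s t → s.inp ∈ P)
    (complete : ∀ x ∈ P, ∀ s : State, s.mem = (fun _ => []) → s.inp = x →
      ∃ t, RunLE (Op.bsem (2 ^ g.eval x.length) (h.eval x.length)) p s t (f.eval x.length)) :
    InNP P := by
  refine inNP_of_nat_program P (p.bind Op.prog) (30 * (h + 1) * f) (h + g + 1) ?_ ?_
  · intro N s t hs h
    obtain ⟨t', h', -⟩ := Ex.of_bind (sem := Op.sem)
      (Rep := fun a s => s = abs a ∧ a.mem (.inr .tmp) = []) (by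
        rintro i a a' _ ⟨rfl, ha⟩ h
        exact ⟨_, (Op.sound i ha h).1, rfl, (Op.sound i ha h).2⟩) ⟨rfl, by simp [hs]⟩ h
    exact sound (abs s) t' (by simp [abs, hs]) h'
  · intro x hx
    refine ⟨(h + g + 1).eval x.length, by simp, le_rfl, fun s hs hi => ?_⟩
    obtain ⟨t, h1⟩ := complete x hx (abs s) (by simp [abs, hs]) hi
    obtain ⟨t', h2, -⟩ := RunLE.bind (sem' := RegOp.nsem (2 ^ (h + g + 1).eval x.length))
      (f := Op.prog) (c := 30 * (h.eval x.length + 1))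
      (Rep := fun a s => s = abs a ∧ a.mem (.inr .tmp) = []) (by omega) (by
        rintro i a _ s' ⟨rfl, ha⟩ h2
        obtain ⟨t, h3, h4, h5⟩ := Op.complete i (N := 2 ^ (h + g + 1).eval x.length) ha h2.1 (by
          rw [← pow_add]
          exact Nat.pow_lt_pow_right (by norm_num) (by simp)) h2.2.1 h2.2.2
        exact ⟨t, h3, h4.symm, h5⟩) ⟨rfl, by simp [hs]⟩ h1
    exact ⟨t', by simpa using h2⟩

/-! ### The verifier -/

/-- `Grows r l E`: starting with the vertex `r`, the vertices of the list `l` have been added one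
after the other, each with an edge to an earlier one. The list `E` consists of these edges. Vertices
may occur several times. -/
inductive Grows {α : Type*} (r : α) : List α → List (α × α) → Prop
  | single : Grows r [r] []
  | step {l : List α} {E : List (α × α)} {p : α} (q : α) (h : Grows r l E) (hp : p ∈ l) :
      Grows r (q :: l) ((p, q) :: E)

theorem Grows.root_mem {α : Type*} {r : α} {l E} (h : Grows r l E) : r ∈ l := by
  induction h with
  | single => simp
  | step q _ _ ih => exact List.mem_cons_of_mem _ ih

theorem Grows.map {α β : Type*} {r : α} {l E} (f : α → β) (h : Grows r l E) :
    Grows (f r) (l.map f) (E.map (Prod.map f f)) := by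
  induction h with
  | single => exact .single
  | step q _ hp ih => exact .step (f q) ih (List.mem_map_of_mem hp)

/-- The `ℓ₁`-distance of grid points. -/
def gridDist (p q : ℕ × ℕ) : ℕ := ((p.1 : ℤ) - q.1).natAbs + ((p.2 : ℤ) - q.2).natAbs

/-- The total length of edges of the grid. -/
def gridLength (E : List ((ℕ × ℕ) × (ℕ × ℕ))) : ℕ := (E.map fun e => gridDist e.1 e.2).sum

/-- Guess an edge that is parallel to an axis and starts at a vertex in the list `m`, and put its
end into this list. -/
def edgeProg (m : Mem) : Prog Op := seq (prim (.pick m)) (seq (prim .grow) (prim (.push m)))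

/-- Guess a tree whose root is the current point, and put its vertices into the list `m`. -/
def treeProg (m : Mem) : Prog Op := seq (prim (.push m)) (star (edgeProg m))

/-- Read a terminal of the current group, and check that it is a vertex of the current tree and not
in a previous group. -/
def terminalProg : Prog Op :=
  seq (prim (.pick .cur)) (seq (prim (.read .x)) (seq (prim (.read .y)) (seq (prim .avoid)
    (prim (.push .new)))))

/-- Read a group: choose the connection point among the vertices of the top-level tree, guess a tree
rooted there, and read the terminals, of which there must be at least one. -/
def groupProg : Prog Op :=
  seq (prim (.pick .top)) (seq (treeProg .cur) (seq terminalProg (seq (star terminalProg)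
    (seq (prim (.inp .semicolon)) (prim .next)))))

/-- The verifier: guess the grid, read the bound into the budget, guess the top-level tree, read the
groups, of which there must be at least one, and check the remaining budget. -/
def mainProg : Prog Op :=
  seq (prim .start) (seq (prim (.read .bud)) (seq (treeProg .top) (seq groupProg
    (seq (star groupProg) (seq (prim .inpEnd) (prim .check))))))

/-! ### Soundness of the verifier -/

section

variable {s t u : State}

/-- The registers that define the coordinates are the same. -/
structure SameGrid (s t : State) : Prop where
  den : t.reg .den = s.reg .den
  off : t.reg .off = s.reg .off

theorem SameGrid.trans (h : SameGrid s t) (h' : SameGrid t u) : SameGrid s u :=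
  ⟨h'.den.trans h.den, h'.off.trans h.off⟩

/-- The coordinate that is represented by a number. -/
noncomputable def coord (s : State) (n : ℕ) : ℝ := ((n : ℝ) - s.reg .off) / s.reg .den

/-- The point that is represented by a pair of numbers. -/
noncomputable def point (s : State) (p : ℕ × ℕ) : ℝ × ℝ := (coord s p.1, coord s p.2)

theorem SameGrid.coord_eq (h : SameGrid s t) : coord t = coord s := by
  funext n
  rw [coord, coord, h.den, h.off]

theorem SameGrid.point_eq (h : SameGrid s t) : point t = point s := by
  funext n
  rw [point, point, h.coord_eq]

/-- A tree with edges `E` has been put into the list `m`. -/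
structure Built (m : Mem) (E : List ((ℕ × ℕ) × (ℕ × ℕ))) (s t : State) : Prop
    extends SameGrid s t where
  inp : t.inp = s.inp
  mem : ∀ m' ≠ m, t.mem m' = s.mem m'
  bud : s.reg .bud = t.reg .bud + gridLength E

theorem ex_treeProg {m : Mem} (hs : s.mem m = []) (h : Ex Op.sem (treeProg m) s t) :
    ∃ E, Grows (s.reg .x, s.reg .y) (t.mem m) E ∧ Built m E s t := by
  obtain ⟨u, h1, h2⟩ := ex_seq.1 h
  obtain rfl := ex_prim.1 h1
  clear h h1
  rw [ex_star] at h2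
  induction h2 with
  | refl =>
    refine ⟨[], ?_, ⟨rfl, rfl⟩, rfl, fun m' hm' => by simp [hm'], rfl⟩
    simp [hs]
    exact .single
  | @tail t u _ h ih =>
    obtain ⟨E, hE, hb⟩ := ih
    simp only [edgeProg, ex_seq, ex_prim] at h
    obtain ⟨_, ⟨p, hp, rfl⟩, _, ⟨r, n, e, b, hr, hn, he, rfl⟩, rfl⟩ := h
    have hbud := hb.bud
    have hden := hb.den
    have hoff := hb.off
    simp only [ne_eq, reduceCtorEq, not_false_eq_true, Function.update_of_ne] at he
    let f := Function.update (Function.update (Function.update (Function.update t.reg .x p.1)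
      .y p.2) r n) .bud b
    refine ⟨(p, f .x, f .y) :: E, ?_, ⟨?_, ?_⟩, hb.inp, fun m' hm' => ?_, ?_⟩
    · simp only [Function.update_self]
      exact hE.step _ hp
    · rcases hr with rfl | rfl <;> simpa using hden
    · rcases hr with rfl | rfl <;> simpa using hoff
    · simpa [hm'] using hb.mem m' hm'
    · rcases hr with rfl | rfl <;>
        simp [gridLength, gridDist, f] at hn hbud ⊢ <;> omega

theorem coord_eq_val {r : Reg} {f : Frac} (hs : 0 < s.reg .den)
    (h : (f.den * s.reg r : ℤ) = f.den * s.reg .off + f.num * s.reg .den) :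
    coord s (s.reg r) = f.val := by
  have h1 : (0 : ℝ) < s.reg .den := by exact_mod_cast hs
  have h2 : (0 : ℝ) < f.den := by exact_mod_cast f.den_pos
  rw [coord, Frac.val, div_eq_div_iff h1.ne' h2.ne']
  have h3 : (f.den * s.reg r : ℝ) = f.den * s.reg .off + f.num * s.reg .den := by exact_mod_cast h
  linarith

/-- The coordinates of a terminal. -/
noncomputable def termPoint (a : Frac × Frac) : ℝ × ℝ := (a.1.val, a.2.val)

/-- The terminals `g` have been read; the list `l` consists of the corresponding grid points. -/
structure TerminalsRead (g : List (Frac × Frac)) (l : List (ℕ × ℕ)) (s t : State) : Prop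
    extends SameGrid s t where
  inp : s.inp = g.flatMap (fun a => a.1.word ++ a.2.word) ++ t.inp
  mem : ∀ m ≠ .new, t.mem m = s.mem m
  new : t.mem .new = l.reverse ++ s.mem .new
  bud : t.reg .bud = s.reg .bud
  point_eq : l.map (point s) = g.map termPoint
  cur : ∀ p ∈ l, p ∈ s.mem .cur
  old : ∀ p ∈ l, p ∉ s.mem .old

theorem TerminalsRead.trans {g g' l l'} (h : TerminalsRead g l s t) (h' : TerminalsRead g' l' t u) :
    TerminalsRead (g ++ g') (l ++ l') s u where
  toSameGrid := h.toSameGrid.trans h'.toSameGrid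
  inp := by rw [h.inp, h'.inp, List.flatMap_append, List.append_assoc]
  mem m hm := (h'.mem m hm).trans (h.mem m hm)
  new := by rw [h'.new, h.new, List.reverse_append, List.append_assoc]
  bud := h'.bud.trans h.bud
  point_eq := by
    have := h'.point_eq
    rw [h.toSameGrid.point_eq] at this
    rw [List.map_append, List.map_append, this, h.point_eq]
  cur p hp := by
    rcases List.mem_append.1 hp with hp | hp
    · exact h.cur p hp
    · exact h.mem .cur (by simp) ▸ h'.cur p hp
  old p hp := by
    rcases List.mem_append.1 hp with hp | hp
    · exact h.old p hp
    · exact h.mem .old (by simp) ▸ h'.old p hp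

theorem ex_terminalProg (hs : 0 < s.reg .den) (h : Ex Op.sem terminalProg s t) :
    ∃ a p, TerminalsRead [a] [p] s t := by
  simp only [terminalProg, ex_seq, ex_prim] at h
  obtain ⟨_, ⟨p, hp, rfl⟩, s1, ⟨f, hf, h1, h2, h3⟩, s2, ⟨f', hf', h1', h2', h3'⟩, _,
    ⟨h4, rfl⟩, rfl⟩ := h
  rw [h2] at h2' h3'
  rw [h1] at h1'
  have e1 := coord_eq_val (by simpa using hs) h3
  have e2 := coord_eq_val (s := { s with
    reg := Function.update (Function.update s.reg .x p.1) .y p.2 }) (by simpa using hs) h3'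
  simp only [h2', h1', ne_eq, reduceCtorEq, not_false_eq_true, Function.update_of_ne,
    Function.update_self] at h4 e1 e2
  refine ⟨(f, f'), p, ⟨by simp [h2'], by simp [h2']⟩, ?_, fun m hm => ?_, ?_, ?_, ?_, ?_, ?_⟩
  · simpa [hf'] using hf
  · simp [hm, h1']
  · simp [h1', h2']
  · simp [h2']
  · simpa [point, termPoint, coord] using ⟨e1, e2⟩
  · simpa using hp
  · simpa using h4

theorem ex_star_terminalProg (hs : 0 < s.reg .den) (h : Ex Op.sem (star terminalProg) s t) :
    ∃ g l, TerminalsRead g l s t := by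
  rw [ex_star] at h
  induction h using Relation.ReflTransGen.head_induction_on with
  | refl => exact ⟨[], [], ⟨rfl, rfl⟩, by simp, fun _ _ => rfl, by simp, rfl, rfl, by simp, by simp⟩
  | head h _ ih =>
    obtain ⟨a, p, h1⟩ := ex_terminalProg hs h
    obtain ⟨g, l, h2⟩ := ih (h1.den ▸ hs)
    exact ⟨_, _, h1.trans h2⟩

/-- The certificate for a group `g`: the connection point `q`, the corresponding tree, and the
list of its grid points `l` that are terminals. -/
structure GroupData where
  g : List (Frac × Frac)
  q : ℕ × ℕ
  verts : List (ℕ × ℕ)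
  E : List ((ℕ × ℕ) × (ℕ × ℕ))
  l : List (ℕ × ℕ)

/-- The certificate for a group is correct. -/
structure GroupData.Valid (d : GroupData) (s : State) : Prop where
  nonempty : d.g ≠ []
  top : d.q ∈ s.mem .top
  grows : Grows d.q d.verts d.E
  subset : ∀ p ∈ d.l, p ∈ d.verts
  point_eq : d.l.map (point s) = d.g.map termPoint

theorem ex_groupProg (hs : 0 < s.reg .den) (hcur : s.mem .cur = []) (hnew : s.mem .new = [])
    (h : Ex Op.sem groupProg s t) : ∃ d : GroupData, d.Valid s ∧ SameGrid s t ∧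
      s.inp = groupWord d.g ++ t.inp ∧ t.mem .cur = [] ∧ t.mem .new = [] ∧
      t.mem .top = s.mem .top ∧ t.mem .old = d.l ++ s.mem .old ∧
      (∀ p ∈ d.l, p ∉ s.mem .old) ∧ s.reg .bud = t.reg .bud + gridLength d.E := by
  obtain ⟨s1, h1, h⟩ := ex_seq.1 h
  obtain ⟨q, hq, rfl⟩ := ex_prim.1 h1
  obtain ⟨s2, h2, h⟩ := ex_seq.1 h
  obtain ⟨E, hE, h2⟩ := ex_treeProg (by simpa using hcur) h2
  have hg : SameGrid s s2 := ⟨by simpa using h2.den, by simpa using h2.off⟩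
  have hs2 := hg.den ▸ hs
  obtain ⟨s3, h3, h⟩ := ex_seq.1 h
  obtain ⟨a, p, h3⟩ := ex_terminalProg hs2 h3
  obtain ⟨s4, h4, h⟩ := ex_seq.1 h
  obtain ⟨g, l, h4⟩ := ex_star_terminalProg (h3.den ▸ hs2) h4
  have h5 := h3.trans h4
  obtain ⟨s5, h6, h⟩ := ex_seq.1 h
  obtain ⟨i, hi, rfl⟩ := ex_prim.1 h6
  obtain rfl := ex_prim.1 h
  have e1 := h2.mem .old (by simp)
  have e2 := h2.mem .top (by simp)
  have e3 := h2.mem .new (by simp)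
  simp only [hnew] at e1 e2 e3
  refine ⟨⟨[a] ++ g, q, s2.mem .cur, E, [p] ++ l⟩, ⟨by simp, hq, ?_, h5.cur, ?_⟩,
    ⟨h5.den.trans hg.den, h5.off.trans hg.off⟩, ?_, ?_, ?_, ?_, ?_, ?_, ?_⟩
  · simpa using hE
  · rw [← hg.point_eq, h5.point_eq]
  · have := h5.inp
    rw [hi, h2.inp] at this
    simpa [groupWord] using this
  · simp
  · simp
  · simp [h5.mem, e2]
  · simp [h5.mem, h5.new, e1, e3]
  · rw [← e1]
    exact h5.old
  · have := h2.bud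
    simp only [h5.bud]
    simpa using this

theorem ex_star_groupProg (hs : 0 < s.reg .den) (hcur : s.mem .cur = []) (hnew : s.mem .new = [])
    (h : Ex Op.sem (star groupProg) s t) : ∃ D : List GroupData, (∀ d ∈ D, d.Valid s) ∧
      s.inp = (D.map (·.g)).flatMap groupWord ++ t.inp ∧ SameGrid s t ∧
      (∀ d ∈ D, ∀ p ∈ d.l, p ∉ s.mem .old) ∧
      D.Pairwise (fun d d' => ∀ p ∈ d.l, p ∉ d'.l) ∧
      s.reg .bud = t.reg .bud + (D.map fun d => gridLength d.E).sum := by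
  rw [ex_star] at h
  induction h using Relation.ReflTransGen.head_induction_on with
  | refl => exact ⟨[], by simp, by simp, ⟨rfl, rfl⟩, by simp, by simp, by simp⟩
  | head h _ ih =>
    obtain ⟨d, h1, h2, h3, h4, h5, h6, h7, h8, h9⟩ := ex_groupProg hs hcur hnew h
    obtain ⟨D, i1, i2, i3, i4, i5, i6⟩ := ih (h2.den ▸ hs) h4 h5
    refine ⟨d :: D, ?_, ?_, h2.trans i3, ?_, ?_, ?_⟩
    · rintro e (_ | ⟨_, he⟩)
      · exact h1
      · have := i1 e he
        exact ⟨this.nonempty, h6 ▸ this.top, this.grows, this.subset, h2.point_eq ▸ this.point_eq⟩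
    · rw [h3, i2]
      simp
    · rintro e (_ | ⟨_, he⟩)
      · exact h8
      · intro p hp h'
        exact i4 e he p hp (h7 ▸ List.mem_append_right _ h')
    · refine List.pairwise_cons.2 ⟨fun e he p hp hp' => ?_, i5⟩
      exact i4 e he p hp' (h7 ▸ List.mem_append_left _ hp)
    · rw [h9, i6, List.map_cons, List.sum_cons]
      ring

/-- What an accepting run of the verifier proves. -/
theorem ex_mainProg (hs : s.mem = fun _ => []) (h : Ex Op.sem mainProg s t) :
    ∃ (u : State) (f : Frac) (r : ℕ × ℕ) (E : _) (D : List GroupData), 0 < u.reg .den ∧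
      s.inp = Instance.word ⟨f, D.map (·.g)⟩ ∧ D ≠ [] ∧ Grows r (u.mem .top) E ∧
      (∀ d ∈ D, d.Valid u) ∧ D.Pairwise (fun d d' => ∀ p ∈ d.l, p ∉ d'.l) ∧
      ((gridLength E + (D.map fun d => gridLength d.E).sum : ℕ) : ℝ) / u.reg .den ≤ f.val := by
  obtain ⟨s1, h1, h⟩ := ex_seq.1 h
  obtain ⟨hden, m1, hi⟩ := ex_prim.1 h1
  obtain ⟨s2, h2, h⟩ := ex_seq.1 h
  obtain ⟨f, hf, m2, r2, h2⟩ := ex_prim.1 h2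
  have hbound := coord_eq_val hden h2
  obtain ⟨s3, h3, h⟩ := ex_seq.1 h
  obtain ⟨E, hE, h3⟩ := ex_treeProg (by simp [m2, m1, hs]) h3
  have g3 : SameGrid s1 s3 := ⟨h3.den.trans (by rw [r2]), h3.off.trans (by rw [r2])⟩
  obtain ⟨s4, h4, h⟩ := ex_seq.1 h
  obtain ⟨s5, h5, h⟩ := ex_seq.1 h
  obtain ⟨D, i1, i2, i3, i4, i5, i6⟩ := ex_star_groupProg (s := s3) (g3.den ▸ hden)
    (by rw [h3.mem _ (by simp), m2, m1, hs]) (by rw [h3.mem _ (by simp), m2, m1, hs])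
    (ex_star.2 (.head h4 (ex_star.1 h5)))
  obtain ⟨s6, h6, h7⟩ := ex_seq.1 h
  obtain ⟨h6, rfl⟩ := ex_prim.1 h6
  obtain ⟨h7, rfl⟩ := ex_prim.1 h7
  refine ⟨s3, f, _, E, D, g3.den ▸ hden, ?_, ?_, hE, i1, i5, ?_⟩
  · rw [Instance.word, ← hi, hf, ← h3.inp, i2, h6, List.append_nil]
  · rintro rfl
    obtain ⟨d, -, -, h8, -⟩ := ex_groupProg (s := s3) (g3.den ▸ hden)
      (by rw [h3.mem _ (by simp), m2, m1, hs]) (by rw [h3.mem _ (by simp), m2, m1, hs]) h4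
    rw [h6] at i2
    rw [i2] at h8
    simp [groupWord] at h8
  · rw [← hbound, coord, g3.den]
    have h8 := h3.bud
    rw [r2, i6] at h8
    rw [i3.off, g3.off] at h7
    have h9 : gridLength E + (D.map fun d => gridLength d.E).sum + s1.reg .off ≤ s1.reg .bud := by
      omega
    have h10 : ((gridLength E + (D.map fun d => gridLength d.E).sum : ℕ) : ℝ) + s1.reg .off ≤
        s1.reg .bud := by exact_mod_cast h9
    gcongr
    linarith

end

/-! ### Trees and growing processes -/

/-- The total length of edges of the plane. -/
noncomputable def totalLength (E : List ((ℝ × ℝ) × (ℝ × ℝ))) : ℝ :=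
  (E.map fun e => dist₁ e.1 e.2).sum

theorem dist₁_nonneg (x y : ℝ × ℝ) : 0 ≤ dist₁ x y := by unfold dist₁; positivity

theorem totalLength_le_of_sublist {E E' : List ((ℝ × ℝ) × (ℝ × ℝ))} (h : E'.Sublist E) :
    totalLength E' ≤ totalLength E := by
  refine (h.map _).sum_le_sum fun x hx => ?_
  obtain ⟨e, -, rfl⟩ := List.mem_map.1 hx
  exact dist₁_nonneg _ _

theorem Grows.edge_mem {α : Type*} {r : α} {l E} (h : Grows r l E) :
    ∀ e ∈ E, e.1 ∈ l ∧ e.2 ∈ l := by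
  induction h with
  | single => simp
  | step q _ hp ih =>
    rintro e (_ | ⟨_, he⟩)
    · exact ⟨List.mem_cons_of_mem _ hp, List.mem_cons_self⟩
    · exact ⟨List.mem_cons_of_mem _ (ih e he).1, List.mem_cons_of_mem _ (ih e he).2⟩

/-- Repeated vertices, together with the edges that lead to them, can be omitted. -/
theorem Grows.exists_nodup {α : Type*} {r : α} {l E} (h : Grows r l E) :
    ∃ l' E', Grows r l' E' ∧ l'.Nodup ∧ (∀ p, p ∈ l' ↔ p ∈ l) ∧ E'.Sublist E := by
  induction h with
  | single => exact ⟨[r], [], .single, by simp, by simp, by simp⟩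
  | @step l E p q _ hp ih =>
    obtain ⟨l', E', h1, h2, h3, h4⟩ := ih
    by_cases hq : q ∈ l'
    · refine ⟨l', E', h1, h2, fun x => ?_, h4.cons _⟩
      rw [h3, List.mem_cons]
      constructor
      · exact .inr
      · rintro (rfl | h)
        · exact (h3 _).1 hq
        · exact h
    · exact ⟨q :: l', (p, q) :: E', h1.step q ((h3 p).2 hp), List.nodup_cons.2 ⟨hq, h2⟩,
        fun x => by simp [h3], h4.cons_cons _⟩

/-- A connected graph can be grown along its edges, using no edge twice. -/
theorem exists_grows_of_connected {V : Type*} [Fintype V] {G : SimpleGraph V} (hG : G.Connected)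
    (r : V) : ∃ l E, Grows r l E ∧ (∀ v, v ∈ l) ∧ (∀ e ∈ E, G.Adj e.1 e.2) ∧
      (E.map fun e => s(e.1, e.2)).Nodup := by
  have key : ∀ n, ∃ l E, Grows r l E ∧ l.Nodup ∧ (n ≤ l.length ∨ ∀ v, v ∈ l) ∧
      (∀ e ∈ E, G.Adj e.1 e.2) ∧ (E.map fun e => s(e.1, e.2)).Nodup := by
    intro n
    induction n with
    | zero => exact ⟨[r], [], .single, by simp, by simp, by simp, by simp⟩
    | succ n ih =>
      obtain ⟨l, E, h1, h2, h3, h4, h5⟩ := ih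
      by_cases hl : ∀ v, v ∈ l
      · exact ⟨l, E, h1, h2, .inr hl, h4, h5⟩
      replace h3 := h3.resolve_right hl
      push Not at hl
      obtain ⟨v, hv⟩ := hl
      obtain ⟨w⟩ := hG.preconnected r v
      obtain ⟨d, -, hd1, hd2⟩ := w.exists_boundary_dart {x | x ∈ l} h1.root_mem hv
      refine ⟨d.snd :: l, (d.fst, d.snd) :: E, h1.step _ hd1, List.nodup_cons.2 ⟨hd2, h2⟩,
        .inl (by simpa using h3), ?_, ?_⟩
      · rintro e (_ | ⟨_, he⟩)
        · exact d.adj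
        · exact h4 e he
      · rw [List.map_cons, List.nodup_cons]
        refine ⟨fun h => ?_, h5⟩
        obtain ⟨e, he, h⟩ := List.mem_map.1 h
        -- the end of the new edge has not been a vertex before
        have := h1.edge_mem e he
        rcases Sym2.eq_iff.1 h with h | h
        · exact hd2 (h.2 ▸ this.2)
        · exact hd2 (h.1 ▸ this.1)
  obtain ⟨l, E, h1, h2, h3, h4, h5⟩ := key (Fintype.card V + 1)
  refine ⟨l, E, h1, h3.resolve_left fun h => ?_, h4, h5⟩
  have := h2.length_le_card
  omega

/-- A tree can be grown from each of its vertices. -/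
theorem PlaneTree.exists_grows (T : PlaneTree) {r : ℝ × ℝ} (hr : r ∈ T.verts) :
    ∃ l E, Grows r l E ∧ (∀ p ∈ T.verts, p ∈ l) ∧ totalLength E ≤ T.length := by
  classical
  obtain ⟨l, E, h1, h2, h3, h4⟩ := exists_grows_of_connected T.isTree.connected ⟨r, hr⟩
  refine ⟨_, _, h1.map Subtype.val, fun p hp => List.mem_map.2 ⟨⟨p, hp⟩, h2 _, rfl⟩, ?_⟩
  have e : totalLength (E.map (Prod.map Subtype.val Subtype.val)) =
      ∑ x ∈ (E.map fun e => s(e.1, e.2)).toFinset, edgeLength x := by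
    rw [List.sum_toFinset _ h4, totalLength]
    simp [List.map_map, Function.comp_def, edgeLength]
  rw [e, PlaneTree.length]
  refine Finset.sum_le_sum_of_subset_of_nonneg (fun x hx => ?_) fun x _ _ => ?_
  · obtain ⟨e, he, rfl⟩ := List.mem_map.1 (List.mem_toFinset.1 hx)
    simpa using h3 e he
  · induction x with
    | _ a b => exact dist₁_nonneg _ _

/-- A spanning tree of the grown graph is not longer, since each of its edges has been used. -/
theorem Grows.exists_planeTree {r : ℝ × ℝ} {l E} (h : Grows r l E) :
    ∃ T : PlaneTree, (∀ p ∈ l, p ∈ T.verts) ∧ T.length ≤ totalLength E := by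
  classical
  let G : SimpleGraph l.toFinset := .fromRel fun a b => ((a : ℝ × ℝ), (b : ℝ × ℝ)) ∈ E
  have reach : ∀ l' E', Grows r l' E' → (∀ p ∈ l', p ∈ l.toFinset) → E' ⊆ E →
      ∀ p hp hr, p ∈ l' → G.Reachable ⟨r, hr⟩ ⟨p, hp⟩ := by
    intro l' E' h'
    induction h' with
    | single =>
      intro _ _ p hp hr hpr
      obtain rfl : p = r := by simpa using hpr
      exact .rfl
    | @step l' E' p q _ hp' ih =>
      intro hl hE x hx hr hxl
      have ih' := ih (fun y hy => hl y (List.mem_cons_of_mem _ hy))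
        (fun y hy => hE (List.mem_cons_of_mem _ hy))
      rcases List.mem_cons.1 hxl with rfl | hxl
      · have hpl := hl p (List.mem_cons_of_mem _ hp')
        refine (ih' p hpl hr hp').trans ?_
        by_cases hpx : p = x
        · subst hpx; exact .rfl
        · refine SimpleGraph.Adj.reachable ((SimpleGraph.fromRel_adj _ _ _).2 ⟨?_, .inl ?_⟩)
          · simpa using hpx
          · exact hE List.mem_cons_self
      · exact ih' x hx hr hxl
  have hr : r ∈ l.toFinset := by simpa using h.root_mem
  have hconn : G.Connected := by
    have : Nonempty l.toFinset := ⟨⟨r, hr⟩⟩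
    have hrr : ∀ v : l.toFinset, G.Reachable ⟨r, hr⟩ v := fun v =>
      reach l E h (by simp) (fun _ h => h) v.1 v.2 hr (List.mem_toFinset.1 v.2)
    exact ⟨fun u v => (hrr u).symm.trans (hrr v)⟩
  obtain ⟨T, hT, hTree⟩ := hconn.exists_isTree_le
  refine ⟨⟨l.toFinset, T, hTree⟩, by simp, ?_⟩
  -- every edge of the spanning tree comes from a different member of `E`
  have hφ : ∀ x : Sym2 l.toFinset, x ∈ T.edgeFinset → ∃ e ∈ E, s(e.1, e.2) = x.map Subtype.val := by
    intro x hx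
    induction x with
    | _ a b =>
      have hab : G.Adj a b := hT (by simpa using hx)
      rcases ((SimpleGraph.fromRel_adj _ _ _).1 hab).2 with h | h
      · exact ⟨_, h, rfl⟩
      · exact ⟨_, h, Sym2.eq_swap⟩
  choose! φ hφ1 hφ2 using hφ
  have inj : Set.InjOn φ T.edgeFinset := by
    intro x hx y hy hxy
    refine Sym2.map.injective Subtype.val_injective ?_
    rw [← hφ2 x hx, ← hφ2 y hy, hxy]
  have len : ∀ x ∈ T.edgeFinset, edgeLength x = dist₁ (φ x).1 (φ x).2 := by
    intro x hx
    have h := hφ2 x hx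
    clear hx
    induction x with
    | _ a b =>
      change dist₁ a b = _
      rcases Sym2.eq_iff.1 h with h | h
      · rw [h.1, h.2]
      · rw [h.1, h.2, dist₁_comm]
  calc PlaneTree.length ⟨l.toFinset, T, hTree⟩
      = ∑ x ∈ T.edgeFinset, dist₁ (φ x).1 (φ x).2 := by
        unfold PlaneTree.length
        convert Finset.sum_congr rfl len
    _ = ∑ e ∈ T.edgeFinset.image φ, dist₁ e.1 e.2 :=
        (Finset.sum_image (f := fun e : (ℝ × ℝ) × (ℝ × ℝ) => dist₁ e.1 e.2) inj).symm
    _ ≤ ∑ e ∈ E.dedup.toFinset, dist₁ e.1 e.2 := by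
        refine Finset.sum_le_sum_of_subset_of_nonneg (fun e he => ?_) fun _ _ _ => dist₁_nonneg _ _
        obtain ⟨x, hx, rfl⟩ := Finset.mem_image.1 he
        simpa using hφ1 x hx
    _ = totalLength E.dedup := by rw [List.sum_toFinset _ E.nodup_dedup, totalLength]
    _ ≤ totalLength E := totalLength_le_of_sublist E.dedup_sublist

/-! ### Rounding to the grid of the terminals -/

/-- The total length of intervals. -/
noncomputable def lineLength (E : List (ℝ × ℝ)) : ℝ := (E.map fun e => |e.1 - e.2|).sum

/-- A coordinate `v` can be replaced by another coordinate without increasing the total length: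
as long as `v` moves between its neighbours among the other coordinates `S`, the total length is
an affine function of `v`. -/
theorem exists_moved_value {S : Finset ℝ} (hS : S.Nonempty) {v : ℝ} (hv : v ∉ S)
    {E : List (ℝ × ℝ)} (hE : ∀ e ∈ E, (e.1 = v ∨ e.1 ∈ S) ∧ (e.2 = v ∨ e.2 ∈ S)) :
    ∃ w ∈ S, lineLength (E.map (Prod.map (Function.update id v w) (Function.update id v w))) ≤
      lineLength E := by
  -- it suffices to compare the two summands that belong to an interval
  have ne : ∀ x ∈ S, x ≠ v := fun x hx h => hv (h ▸ hx)
  have single : ∀ w ∈ S, (∀ x ∈ S, |w - x| ≤ |v - x|) →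
      lineLength (E.map (Prod.map (Function.update id v w) (Function.update id v w))) ≤
      lineLength E := by
    intro w hw h
    simp only [lineLength, List.map_map]
    refine List.sum_le_sum fun e he => ?_
    obtain ⟨h1, h2⟩ := hE e he
    rcases h1 with h1 | h1 <;> rcases h2 with h2 | h2
    · simp [h1, h2]
    · simpa [h1, ne _ h2] using h _ h2
    · have := h _ h1
      rw [abs_sub_comm, abs_sub_comm v] at this
      simpa [h2, ne _ h1] using this
    · simp [ne _ h1, ne _ h2]
  by_cases hlo : ∃ x ∈ S, x < v
  · by_cases hup : ∃ x ∈ S, v < x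
    · obtain ⟨l, hl, hl'⟩ := (S.filter (· < v)).exists_max_image id
        (by simpa [Finset.Nonempty] using hlo)
      obtain ⟨u, hu, hu'⟩ := (S.filter (v < ·)).exists_min_image id
        (by simpa [Finset.Nonempty] using hup)
      simp only [Finset.mem_filter, id, and_imp] at hl hl' hu hu'
      have gap : ∀ x ∈ S, x ≤ l ∨ u ≤ x := fun x hx =>
        (lt_or_gt_of_ne (ne x hx)).imp (hl' x hx) (hu' x hx)
      have conv : ∀ x ∈ S, (u - v) * |l - x| + (v - l) * |u - x| ≤ (u - l) * |v - x| := by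
        intro x hx
        rcases gap x hx with h | h
        · rw [abs_of_nonneg (by linarith), abs_of_nonneg (by linarith),
            abs_of_nonneg (by linarith)]
          nlinarith
        · rw [abs_of_nonpos (by linarith), abs_of_nonpos (by linarith),
            abs_of_nonpos (by linarith)]
          nlinarith
      have total : (u - v) * lineLength (E.map (Prod.map (Function.update id v l)
          (Function.update id v l))) + (v - l) * lineLength (E.map (Prod.map
          (Function.update id v u) (Function.update id v u))) ≤ (u - l) * lineLength E := by
        simp only [lineLength, List.map_map, ← List.sum_map_mul_left, ← List.sum_map_add]
        refine List.sum_le_sum fun e he => ?_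
        obtain ⟨h1, h2⟩ := hE e he
        rcases h1 with h1 | h1 <;> rcases h2 with h2 | h2
        · simp [h1, h2]
        · simpa [h1, ne _ h2] using conv _ h2
        · have := conv _ h1
          rw [abs_sub_comm, abs_sub_comm u, abs_sub_comm v] at this
          simpa [h2, ne _ h1] using this
        · simp [ne _ h1, ne _ h2]
          nlinarith
      by_contra! hcon
      have c1 := hcon l hl.1
      have c2 := hcon u hu.1
      nlinarith [mul_lt_mul_of_pos_left c1 (sub_pos.2 hu.2),
        mul_lt_mul_of_pos_left c2 (sub_pos.2 hl.2)]
    · push Not at hup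
      obtain ⟨l, hl, hl'⟩ := S.exists_max_image id hS
      refine ⟨l, hl, single l hl fun x hx => ?_⟩
      have := hl' x hx
      have := hup l hl
      simp only [id] at *
      rw [abs_of_nonneg (by linarith), abs_of_nonneg (by linarith)]
      linarith
  · push Not at hlo
    obtain ⟨u, hu, hu'⟩ := S.exists_min_image id hS
    refine ⟨u, hu, single u hu fun x hx => ?_⟩
    have := hu' x hx
    have := hlo u hu
    simp only [id] at *
    rw [abs_of_nonpos (by linarith), abs_of_nonpos (by linarith)]
    linarith

/-- All coordinates can be rounded to those of the terminals, without increasing the total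
length. -/
theorem exists_rounding {A : Finset ℝ} (hA : A.Nonempty) (E : List (ℝ × ℝ)) :
    ∃ f : ℝ → ℝ, (∀ x, f x ∈ A) ∧ (∀ a ∈ A, f a = a) ∧
      lineLength (E.map (Prod.map f f)) ≤ lineLength E := by
  classical
  obtain ⟨V, hV⟩ : ∃ V : Finset ℝ, ∀ e ∈ E, (e.1 ∈ V ∨ e.1 ∈ A) ∧ (e.2 ∈ V ∨ e.2 ∈ A) :=
    ⟨(E.map Prod.fst).toFinset ∪ (E.map Prod.snd).toFinset, fun e he =>
      ⟨.inl (Finset.mem_union_left _ (List.mem_toFinset.2 (List.mem_map_of_mem he))),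
        .inl (Finset.mem_union_right _ (List.mem_toFinset.2 (List.mem_map_of_mem he)))⟩⟩
  induction V using Finset.induction_on generalizing E with
  | empty =>
    obtain ⟨a, ha⟩ := hA
    refine ⟨fun x => if x ∈ A then x else a, fun x => ?_, fun x hx => by simp [hx], le_of_eq ?_⟩
    · dsimp only
      split_ifs with h <;> assumption
    · congr 1
      conv_rhs => rw [← List.map_id E]
      refine List.map_congr_left fun e he => ?_
      have := hV e he
      simp only [Finset.notMem_empty, false_or] at this
      exact Prod.ext (by simp [this.1]) (by simp [this.2])
  | insert v V _ ih =>
    by_cases hv : v ∈ A ∪ V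
    · refine ih E fun e he => ?_
      have := hV e he
      simp only [Finset.mem_insert] at this
      constructor
      · rcases this.1 with (h | h) | h
        · rw [h]; exact (Finset.mem_union.1 hv).symm
        · exact .inl h
        · exact .inr h
      · rcases this.2 with (h | h) | h
        · rw [h]; exact (Finset.mem_union.1 hv).symm
        · exact .inl h
        · exact .inr h
    · have hV' : ∀ e ∈ E, (e.1 = v ∨ e.1 ∈ A ∪ V) ∧ (e.2 = v ∨ e.2 ∈ A ∪ V) := by
        intro e he
        have := hV e he
        simp only [Finset.mem_insert, Finset.mem_union] at this ⊢
        tauto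
      obtain ⟨w, hw, hle⟩ := exists_moved_value (hA.mono Finset.subset_union_left) hv hV'
      have upd : ∀ x, (x = v ∨ x ∈ A ∪ V) → Function.update id v w x ∈ A ∪ V := by
        rintro x (rfl | hx)
        · simpa using hw
        · by_cases h : x = v
          · subst h; simpa using hw
          · simpa [h] using hx
      obtain ⟨f, f1, f2, f3⟩ := ih (E.map (Prod.map (Function.update id v w)
        (Function.update id v w))) (by
        intro e' he'
        obtain ⟨e, he, rfl⟩ := List.mem_map.1 he'
        have h1 := upd _ (hV' e he).1
        have h2 := upd _ (hV' e he).2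
        rw [Finset.mem_union, or_comm] at h1 h2
        exact ⟨h1, h2⟩)
      refine ⟨f ∘ Function.update id v w, fun x => f1 _, fun a ha => ?_, ?_⟩
      · have : a ≠ v := fun h => hv (h ▸ Finset.mem_union_left _ ha)
        simp [this, f2 a ha]
      · rw [← Prod.map_comp_map, ← List.map_map]
        exact f3.trans hle

theorem totalLength_eq (E : List ((ℝ × ℝ) × (ℝ × ℝ))) : totalLength E =
    lineLength (E.map fun e => (e.1.1, e.2.1)) + lineLength (E.map fun e => (e.1.2, e.2.2)) := by
  simp only [totalLength, lineLength, List.map_map, ← List.sum_map_add]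
  rfl

/-- All points can be moved to the grid that is given by the finite set `A` of coordinates,
without increasing the total length. -/
theorem exists_rounding_plane {A : Finset ℝ} (hA : A.Nonempty)
    (E : List ((ℝ × ℝ) × (ℝ × ℝ))) : ∃ f : ℝ × ℝ → ℝ × ℝ, (∀ p, f p ∈ A ×ˢ A) ∧
      (∀ p ∈ A ×ˢ A, f p = p) ∧ totalLength (E.map (Prod.map f f)) ≤ totalLength E := by
  obtain ⟨f, f1, f2, f3⟩ := exists_rounding hA (E.map fun e => (e.1.1, e.2.1))
  obtain ⟨g, g1, g2, g3⟩ := exists_rounding hA (E.map fun e => (e.1.2, e.2.2))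
  refine ⟨Prod.map f g, fun p => by simp [f1, g1], fun p hp => ?_, ?_⟩
  · rw [Finset.mem_product] at hp
    exact Prod.ext (f2 _ hp.1) (g2 _ hp.2)
  · rw [totalLength_eq, totalLength_eq]
    simp only [List.map_map] at f3 g3 ⊢
    exact add_le_add f3 g3

/-! ### Accepted words are yes-instances -/

section

variable {s t : State}

theorem coord_injective (hs : 0 < s.reg .den) : Function.Injective (coord s) := by
  intro m n h
  have h1 : (0 : ℝ) < s.reg .den := by exact_mod_cast hs
  rw [coord, coord, div_left_inj' h1.ne', sub_left_inj] at h
  exact_mod_cast h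

theorem point_injective (hs : 0 < s.reg .den) : Function.Injective (point s) := fun _ _ h =>
  Prod.ext (coord_injective hs (Prod.mk.inj h).1) (coord_injective hs (Prod.mk.inj h).2)

theorem dist₁_point (p q : ℕ × ℕ) :
    dist₁ (point s p) (point s q) = (gridDist p q : ℝ) / s.reg .den := by
  have key : ∀ m n : ℕ, |coord s m - coord s n| = (((m : ℤ) - n).natAbs : ℝ) / s.reg .den := by
    intro m n
    rw [coord, coord, ← sub_div, abs_div, sub_sub_sub_cancel_right, Nat.abs_cast, Nat.cast_natAbs]
    push_cast
    rfl
  rw [dist₁, point, point, key, key, gridDist, ← add_div]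
  push_cast
  rfl

theorem totalLength_map_point (E : List ((ℕ × ℕ) × (ℕ × ℕ))) :
    totalLength (E.map (Prod.map (point s) (point s))) = (gridLength E : ℝ) / s.reg .den := by
  induction E with
  | nil => simp [totalLength, gridLength]
  | cons e E ih =>
    simp only [totalLength, gridLength, List.map_cons, List.sum_cons] at ih ⊢
    rw [ih, Prod.map_fst, Prod.map_snd, dist₁_point, ← add_div]
    push_cast
    rfl

/-- The lists of vertices and edges that occur in an accepting run contain a two-level tree. -/
theorem mem_problem_of_ex (hs : s.mem = fun _ => []) (h : Ex Op.sem mainProg s t) :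
    s.inp ∈ problem := by
  obtain ⟨u, f, r, E, D, hden, hw, hD, hE, hval, hdis, hle⟩ := ex_mainProg hs h
  let I : Instance := ⟨f, D.map (·.g)⟩
  have hlen : I.groups.length = D.length := by simp [I]
  let d : Fin I.groups.length → GroupData := fun i => D.get (i.cast hlen)
  have hd : ∀ i, d i ∈ D := fun i => List.get_mem _ _
  have hg : ∀ i, I.groups.get i = (d i).g := fun i => by simp [I, d]
  have hterm : ∀ i x, x ∈ I.terminals i ↔ ∃ p ∈ (d i).l, point u p = x := by
    intro i x
    have : x ∈ I.terminals i ↔ x ∈ (d i).g.map termPoint := by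
      simp only [Instance.terminals, hg, Set.mem_ofPred_eq, List.mem_map, termPoint, eq_comm]
    rw [this, ← (hval _ (hd i)).point_eq, List.mem_map]
  obtain ⟨top, top1, top2⟩ := (hE.map (point u)).exists_planeTree
  have hbot := fun i => ((hval _ (hd i)).grows.map (point u)).exists_planeTree
  choose bot bot1 bot2 using hbot
  refine ⟨I, ⟨?_, fun i => ?_, fun i j hij => ?_⟩,
    ⟨⟨top, bot, fun i => point u (d i).q, ?_, ?_⟩, ?_⟩, hw.symm⟩
  · simpa [I] using hD
  · obtain ⟨a, ha⟩ := List.exists_mem_of_ne_nil _ (hval _ (hd i)).nonempty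
    exact ⟨termPoint a, a, (hg i) ▸ ha, rfl⟩
  · change Disjoint _ _
    rw [Set.disjoint_left]
    intro x hx hx'
    obtain ⟨p, hp, rfl⟩ := (hterm i x).1 hx
    obtain ⟨p', hp', h⟩ := (hterm j _).1 hx'
    obtain rfl := point_injective hden h
    rw [List.pairwise_iff_get] at hdis
    rcases lt_or_gt_of_ne hij with h | h
    · exact hdis (i.cast hlen) (j.cast hlen) h _ hp hp'
    · exact hdis (j.cast hlen) (i.cast hlen) h _ hp' hp
  · rintro _ ⟨i, rfl⟩
    exact top1 _ (List.mem_map_of_mem (hval _ (hd i)).top)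
  · rintro i x (hx | hx)
    · obtain ⟨p, hp, rfl⟩ := (hterm i x).1 hx
      exact bot1 i _ (List.mem_map_of_mem ((hval _ (hd i)).subset p hp))
    · rw [Set.mem_singleton_iff] at hx
      exact hx ▸ bot1 i _ ((hval _ (hd i)).grows.map (point u)).root_mem
  · refine le_trans ?_ hle
    have h1 : ∑ i, (gridLength (d i).E : ℝ) = ((D.map fun d => gridLength d.E).sum : ℕ) := by
      rw [← Equiv.sum_comp (finCongr hlen.symm)]
      rw [← Fin.sum_univ_fun_getElem]
      push_cast
      rfl
    rw [totalLength_map_point] at top2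
    simp only [totalLength_map_point] at bot2
    rw [TwoLevelTree.length, Nat.cast_add, add_div, ← h1, Finset.sum_div]
    exact add_le_add top2 (Finset.sum_le_sum fun i _ => bot2 i)

end

/-! ### Completeness of the verifier -/

section

variable {c L : ℕ} {s t u : State}

theorem Bounded.pick (h : Bounded c L s) {m : Mem} {p : ℕ × ℕ} (hp : p ∈ s.mem m) :
    Bounded c L { s with reg := Function.update (Function.update s.reg .x p.1) .y p.2 } where
  reg r := by
    have h1 := h.reg r
    have h2 := h.pt m p hp
    cases r <;> simp_all
  pt := h.pt
  mem := h.mem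
  inp := h.inp

theorem Bounded.push (h : Bounded c L s) {m : Mem} (hm : (s.mem m).length < L) :
    Bounded c L
      { s with mem := Function.update s.mem m ((s.reg .x, s.reg .y) :: s.mem m) } where
  reg := h.reg
  pt j p hp := by
    by_cases hj : j = m
    · subst hj
      simp only [Function.update_self, List.mem_cons] at hp
      rcases hp with rfl | hp
      · exact ⟨h.reg _, h.reg _⟩
      · exact h.pt j p hp
    · simp only [ne_eq, hj, not_false_eq_true, Function.update_of_ne] at hp
      exact h.pt j p hp
  mem j := by
    by_cases hj : j = m
    · subst hj
      simpa using hm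
    · simpa [hj] using h.mem j
  inp := h.inp

theorem Bounded.update_reg (h : Bounded c L s) {r : Reg} {n : ℕ} (hn : n ≤ c) :
    Bounded c L { s with reg := Function.update s.reg r n } where
  reg r' := by
    by_cases hr : r' = r
    · subst hr; simpa using hn
    · simpa [hr] using h.reg r'
  pt := h.pt
  mem := h.mem
  inp := h.inp

theorem Bounded.inp_append (h : Bounded c L s) {i j : List Sym} (hi : s.inp = i ++ j) :
    Bounded c L { s with inp := j } where
  reg := h.reg
  pt := h.pt
  mem := h.mem
  inp := by
    have := h.inp
    rw [hi, List.length_append] at this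
    exact le_of_add_le_right this

theorem Bounded.next (h : Bounded c L s) (hL : (s.mem .new).length + (s.mem .old).length ≤ L) :
    Bounded c L { s with mem := Function.update (Function.update (Function.update s.mem
      .cur []) .old ((s.mem .new).reverse ++ s.mem .old)) .new [] } where
  reg := h.reg
  pt m p hp := by
    cases m
    · exact h.pt .top p (by simpa using hp)
    · simp at hp
    · simp only [ne_eq, reduceCtorEq, not_false_eq_true, Function.update_of_ne,
        Function.update_self, List.mem_append, List.mem_reverse] at hp
      exact hp.elim (h.pt .new p) (h.pt .old p)
    · simp at hp
  mem m := by
    have := h.mem .top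
    cases m <;> simp [this, hL]
  inp := h.inp

theorem Op.runLE {i : Op} (h : i.sem s t) (hs : Bounded c L s) (ht : Bounded c L t) :
    RunLE (Op.bsem c L) (prim i) s t 1 := .prim ⟨h, fun _ => hs, ht⟩

theorem Built.trans {m : Mem} {E E'} (h : Built m E s t) (h' : Built m E' t u) :
    Built m (E' ++ E) s u where
  toSameGrid := h.toSameGrid.trans h'.toSameGrid
  inp := h'.inp.trans h.inp
  mem j hj := (h'.mem j hj).trans (h.mem j hj)
  bud := by
    rw [h.bud, h'.bud, gridLength, gridLength, gridLength, List.map_append, List.sum_append]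
    ring

/-- An edge that is parallel to an axis can be added. -/
theorem runLE_edgeProg {m : Mem} (hs : Bounded c L s) {p q : ℕ × ℕ} (hp : p ∈ s.mem m)
    (hpq : q.1 = p.1 ∨ q.2 = p.2) (hq : q.1 ≤ c ∧ q.2 ≤ c) (hb : gridDist p q ≤ s.reg .bud)
    (hL : (s.mem m).length < L) :
    ∃ t, RunLE (Op.bsem c L) (edgeProg m) s t 5 ∧ Bounded c L t ∧ t.mem m = q :: s.mem m ∧
      Built m [(p, q)] s t := by
  obtain ⟨r, n, hr, hn, hgrow, hreg⟩ : ∃ r n, (r = .x ∨ r = .y) ∧ n ≤ c ∧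
      (n = Function.update (Function.update s.reg .x p.1) .y p.2 r + gridDist p q ∨
        Function.update (Function.update s.reg .x p.1) .y p.2 r = n + gridDist p q) ∧
      Function.update (Function.update (Function.update s.reg .x p.1) .y p.2) r n .x = q.1 ∧
      Function.update (Function.update (Function.update s.reg .x p.1) .y p.2) r n .y = q.2 := by
    rcases hpq with h | h
    · refine ⟨.y, q.2, .inr rfl, hq.2, ?_, by simp [h], by simp⟩
      simp [gridDist, h]
      omega
    · refine ⟨.x, q.1, .inl rfl, hq.1, ?_, by simp, by simp [h]⟩
      simp [gridDist, h]
      omega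
  have hr' : r ≠ .bud := by rintro rfl; simp at hr
  have b1 := hs.pick hp
  have b2 := (b1.update_reg (r := r) hn).update_reg (r := .bud) (n := s.reg .bud - gridDist p q)
    (by have := hs.reg .bud; omega)
  have b3 := b2.push (m := m) hL
  refine ⟨_, (Op.runLE (i := .pick m) ⟨p, hp, rfl⟩ hs b1).seq ((Op.runLE (i := .grow)
    ⟨r, n, gridDist p q, _, hr, hgrow, ?_, rfl⟩ b1 b2).seq (Op.runLE (i := .push m) rfl b2 b3)),
    b3, ?_, ⟨?_, ?_⟩, rfl, fun m' hm' => ?_, ?_⟩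
  · simp [hb]
  · simp [hreg]
  · rcases hr with rfl | rfl <;> simp
  · rcases hr with rfl | rfl <;> simp
  · simp [hm']
  · simp [gridLength, hb]

/-- Every edge can be added, if necessary with a bend. -/
theorem runLE_edge {m : Mem} (hs : Bounded c L s) {p q : ℕ × ℕ} (hp : p ∈ s.mem m)
    (hq : q.1 ≤ c ∧ q.2 ≤ c) (hb : gridDist p q ≤ s.reg .bud)
    (hL : (s.mem m).length + 2 ≤ L) :
    ∃ t E, RunLE (Op.bsem c L) (star (edgeProg m)) s t 13 ∧ Bounded c L t ∧ q ∈ t.mem m ∧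
      (t.mem m).length = (s.mem m).length + 2 ∧ s.mem m ⊆ t.mem m ∧ Built m E s t ∧
      gridLength E = gridDist p q := by
  have hpc := hs.pt m p hp
  have hd : gridDist p (q.1, p.2) + gridDist (q.1, p.2) q = gridDist p q := by simp [gridDist]
  obtain ⟨t, h1, h2, h3, h4⟩ := runLE_edgeProg hs hp (q := (q.1, p.2)) (.inr rfl) ⟨hq.1, hpc.2⟩
    (by omega) (by omega)
  have h5 := h4.bud
  simp only [gridLength, List.map_cons, List.map_nil, List.sum_cons, List.sum_nil] at h5
  obtain ⟨u, i1, i2, i3, i4⟩ := runLE_edgeProg h2 (p := (q.1, p.2)) (q := q) (by rw [h3]; simp)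
    (.inl rfl) hq (by omega) (by rw [h3, List.length_cons]; omega)
  refine ⟨u, _, h1.star_cons (i1.star_cons .star_nil), i2, by simp [i3], by simp [i3, h3],
    fun x hx => by simp [i3, h3, hx], h4.trans i4, ?_⟩
  simp [gridLength]
  omega

theorem runLE_treeProg {m : Mem} {r : ℕ × ℕ} {l E} (h : Grows r l E) (hs : Bounded c L s)
    (hm : s.mem m = []) (hr : r = (s.reg .x, s.reg .y)) (hl : ∀ p ∈ l, p.1 ≤ c ∧ p.2 ≤ c)
    (hL : 2 * l.length ≤ L) (hb : gridLength E ≤ s.reg .bud) :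
    ∃ t E', RunLE (Op.bsem c L) (treeProg m) s t (13 * L + 3) ∧ Bounded c L t ∧ l ⊆ t.mem m ∧
      Built m E' s t ∧ gridLength E' = gridLength E := by
  have hb1 := hs.push (m := m) (by
    have := h.root_mem
    have := List.length_pos_of_mem this
    rw [hm, List.length_nil]
    omega)
  suffices h : ∃ t E', RunLE (Op.bsem c L) (star (edgeProg m))
      { s with mem := Function.update s.mem m ((s.reg .x, s.reg .y) :: s.mem m) } t
        (13 * l.length + 1) ∧ Bounded c L t ∧ l ⊆ t.mem m ∧ (t.mem m).length ≤ 2 * l.length ∧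
      Built m E' s t ∧ gridLength E' = gridLength E by
    obtain ⟨t, E', h1, h2, h3, -, h4, h5⟩ := h
    exact ⟨t, E', ((Op.runLE (i := .push m) rfl hs hb1).seq h1).mono (by omega), h2, h3, h4, h5⟩
  induction h with
  | single =>
    exact ⟨_, [], RunLE.star_nil.mono (by simp), hb1, by simp [hm, hr], by simp [hm],
      ⟨⟨rfl, rfl⟩, rfl, fun m' hm' => by simp [hm'], rfl⟩, rfl⟩
  | @step l E p q h hp ih =>
    rw [List.length_cons] at hL
    have hE : gridLength ((p, q) :: E) = gridDist p q + gridLength E := by simp [gridLength]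
    obtain ⟨t, E', h1, h2, h3, h4, h5, h6⟩ := ih (fun x hx => hl x (List.mem_cons_of_mem _ hx))
      (by omega) (by omega)
    have h7 := h5.bud
    obtain ⟨u, E'', i1, i2, i3, i4, i5, i6, i7⟩ := runLE_edge h2 (h3 hp) (hl q (by simp))
      (by omega) (by omega)
    refine ⟨u, _, (h1.star_append i1).mono (by rw [List.length_cons]; omega), i2, ?_, ?_,
      h5.trans i6, ?_⟩
    · exact List.cons_subset.2 ⟨i3, fun x hx => i5 (h3 hx)⟩
    · rw [List.length_cons]
      omega
    · rw [hE, ← i7, ← h6]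
      simp [gridLength]

theorem eq_of_coord_eq_val {n : ℕ} {f : Frac} (hs : 0 < s.reg .den) (h : coord s n = f.val) :
    (f.den * n : ℤ) = f.den * s.reg .off + f.num * s.reg .den := by
  have h1 : (0 : ℝ) < s.reg .den := by exact_mod_cast hs
  have h2 : (0 : ℝ) < f.den := by exact_mod_cast f.den_pos
  rw [coord, Frac.val, div_eq_div_iff h1.ne' h2.ne'] at h
  have h3 : (f.den * n : ℝ) = f.den * s.reg .off + f.num * s.reg .den := by linarith
  exact_mod_cast h3

theorem runLE_read {r : Reg} {f : Frac} {i : List Sym} (hs : Bounded c L s)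
    (hi : s.inp = f.word ++ i)
    (hf : (f.den * s.reg r : ℤ) = f.den * s.reg .off + f.num * s.reg .den) :
    RunLE (Op.bsem c L) (prim (.read r)) s { s with inp := i } 1 :=
  Op.runLE (t := { s with inp := i }) ⟨f, hi, rfl, rfl, hf⟩ hs (hs.inp_append hi)

theorem runLE_terminalProg {a : Frac × Frac} {p : ℕ × ℕ} (hs : Bounded c L s)
    (hden : 0 < s.reg .den) (hp : p ∈ s.mem .cur) (hold : p ∉ s.mem .old) {i : List Sym}
    (hi : s.inp = a.1.word ++ a.2.word ++ i) (hpt : point s p = termPoint a)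
    (hL : (s.mem .new).length < L) :
    ∃ t, RunLE (Op.bsem c L) terminalProg s t 9 ∧ Bounded c L t ∧ t.inp = i ∧
      TerminalsRead [a] [p] s t := by
  have hpt' := Prod.mk.inj hpt
  rw [List.append_assoc] at hi
  have b1 := hs.pick hp
  have b2 := b1.inp_append (i := a.1.word) (j := a.2.word ++ i) hi
  have b3 := b2.inp_append (i := a.2.word) (j := i) rfl
  have b4 := b3.push (m := .new) hL
  refine ⟨_, (Op.runLE (i := .pick .cur) ⟨p, hp, rfl⟩ hs b1).seq
    ((runLE_read (r := .x) b1 hi ?_).seq ((runLE_read (r := .y) b2 rfl ?_).seq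
    ((Op.runLE (i := .avoid) ⟨?_, rfl⟩ b3 b3).seq (Op.runLE (i := .push .new) rfl b3 b4)))), b4,
    rfl, ⟨?_, ?_⟩, ?_, fun m hm => ?_, ?_, ?_, ?_, ?_, ?_⟩
  · simpa using eq_of_coord_eq_val hden hpt'.1
  · simpa using eq_of_coord_eq_val hden hpt'.2
  · simpa using hold
  · simp
  · simp
  · simpa using hi
  · simp [hm]
  · simp
  · simp
  · simp [hpt]
  · simpa using hp
  · simpa using hold

theorem runLE_star_terminalProg {g : List (Frac × Frac)} {l : List (ℕ × ℕ)} (hs : Bounded c L s)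
    (hden : 0 < s.reg .den) (hl : ∀ p ∈ l, p ∈ s.mem .cur ∧ p ∉ s.mem .old) {i : List Sym}
    (hi : s.inp = g.flatMap (fun a => a.1.word ++ a.2.word) ++ i)
    (hpt : l.map (point s) = g.map termPoint) (hL : (s.mem .new).length + l.length ≤ L) :
    ∃ t, RunLE (Op.bsem c L) (star terminalProg) s t (10 * l.length + 1) ∧ Bounded c L t ∧
      t.inp = i ∧ TerminalsRead g l s t := by
  induction g generalizing s l with
  | nil =>
    obtain rfl : l = [] := by simpa using hpt
    exact ⟨s, .star_nil, hs, hi, ⟨rfl, rfl⟩, by simp, fun _ _ => rfl, by simp, rfl, rfl, by simp,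
      by simp⟩
  | cons a g ih =>
    cases l with
    | nil => simp at hpt
    | cons p l =>
      simp only [List.map_cons, List.cons.injEq] at hpt
      rw [List.length_cons] at hL
      obtain ⟨t, h1, h2, h3, h4⟩ := runLE_terminalProg (a := a) (p := p)
        (i := g.flatMap (fun a => a.1.word ++ a.2.word) ++ i) hs hden (hl p (by simp)).1
        (hl p (by simp)).2 (by rw [hi]; simp) hpt.1 (by omega)
      obtain ⟨u, i1, i2, i3, i4⟩ := ih (s := t) (l := l) h2 (h4.den ▸ hden) (by
        rw [h4.mem .cur (by simp), h4.mem .old (by simp)]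
        exact fun q hq => hl q (List.mem_cons_of_mem _ hq)) h3
        (by rw [h4.toSameGrid.point_eq, hpt.2]) (by rw [h4.new]; simp; omega)
      exact ⟨u, (h1.star_cons i1).mono (by rw [List.length_cons]; omega), i2, i3, h4.trans i4⟩

/-- The certificate for a group is small. -/
structure GroupData.Small (d : GroupData) (c L : ℕ) : Prop where
  pt : ∀ p ∈ d.verts, p.1 ≤ c ∧ p.2 ≤ c
  length : 2 * d.verts.length ≤ L

theorem runLE_groupProg {d : GroupData} (hd : d.Valid s) (hd' : d.Small c L) (hs : Bounded c L s)
    (hden : 0 < s.reg .den) (hcur : s.mem .cur = []) (hnew : s.mem .new = []) {i : List Sym}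
    (hi : s.inp = groupWord d.g ++ i) (hold : ∀ p ∈ d.l, p ∉ s.mem .old)
    (hL : d.l.length + (s.mem .old).length ≤ L) (hb : gridLength d.E ≤ s.reg .bud) :
    ∃ t, RunLE (Op.bsem c L) groupProg s t (23 * L + 20) ∧ Bounded c L t ∧ t.inp = i ∧
      SameGrid s t ∧ t.mem .cur = [] ∧ t.mem .new = [] ∧ s.mem .top ⊆ t.mem .top ∧
      t.mem .old = d.l ++ s.mem .old ∧ s.reg .bud = t.reg .bud + gridLength d.E := by
  obtain ⟨g, q, verts, E, l⟩ := d
  obtain ⟨hne, htop, hgrows, hsub, hpt⟩ := hd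
  simp only at *
  have b1 := hs.pick htop
  obtain ⟨s2, E', h1, h2, h3, h4, h5⟩ := runLE_treeProg hgrows b1 (m := .cur) hcur (by simp)
    hd'.pt hd'.length (by simpa using hb)
  have e0 := h4.inp
  have e1 := h4.mem .old (by simp)
  have e2 := h4.mem .top (by simp)
  have e3 := h4.mem .new (by simp)
  have e4 := h4.den
  have e5 := h4.bud
  have hg : SameGrid s s2 := ⟨by simpa using e4, by simpa using h4.off⟩
  simp only [ne_eq, reduceCtorEq, not_false_eq_true, Function.update_of_ne] at e0 e1 e2 e3 e4 e5
  cases g with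
  | nil => exact absurd rfl hne
  | cons a g =>
  cases l with
  | nil => simp at hpt
  | cons p l =>
  simp only [List.map_cons, List.cons.injEq] at hpt
  rw [List.length_cons] at hL
  have hden2 : 0 < s2.reg .den := e4 ▸ hden
  obtain ⟨s3, h6, h7, h8, h9⟩ := runLE_terminalProg (a := a) (p := p)
    (i := g.flatMap (fun a => a.1.word ++ a.2.word) ++ ([.semicolon] ++ i)) h2 hden2
    (h3 (hsub p (by simp))) (by rw [e1]; exact hold p (by simp)) (by
      rw [e0, hi]; simp [groupWord]) (by rw [hg.point_eq, hpt.1]) (by rw [e3, hnew]; simp; omega)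
  obtain ⟨s4, h10, h11, h12, h13⟩ := runLE_star_terminalProg (s := s3) (g := g) (l := l)
    (i := [.semicolon] ++ i) h7 (h9.den ▸ hden2) (by
      rw [h9.mem .cur (by simp), h9.mem .old (by simp), e1]
      exact fun x hx => ⟨h3 (hsub x (by simp [hx])), hold x (by simp [hx])⟩) h8
    (by rw [h9.toSameGrid.point_eq, hg.point_eq, hpt.2]) (by
      rw [h9.new, e3, hnew]; simp; omega)
  have h14 := h9.trans h13
  have e6 := h14.new
  have e7 := h14.mem .old (by simp)
  rw [e3, hnew] at e6
  have b5 := h11.inp_append h12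
  have b6 := b5.next (by
    simp only [e6, e7, e1]
    simp
    omega)
  refine ⟨_, ((Op.runLE (i := .pick .top) ⟨q, htop, rfl⟩ hs b1).seq (h1.seq (h6.seq (h10.seq
    ((Op.runLE (i := .inp .semicolon) ⟨i, h12, rfl⟩ h11 b5).seq
      (Op.runLE (i := .next) rfl b5 b6)))))).mono ?_, b6, rfl, ?_, ?_, ?_, ?_, ?_, ?_⟩
  · omega
  · exact ⟨h14.den.trans hg.den, h14.off.trans hg.off⟩
  · simp
  · simp
  · have := h14.mem .top (by simp)
    simp [this, e2]
  · simp [e6, e7, e1]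
  · have := h14.bud
    simp only [this]
    omega

theorem runLE_star_groupProg {D : List GroupData} (hD : ∀ d ∈ D, d.Valid s ∧ d.Small c L)
    (hs : Bounded c L s) (hden : 0 < s.reg .den) (hcur : s.mem .cur = [])
    (hnew : s.mem .new = []) {i : List Sym} (hi : s.inp = (D.map (·.g)).flatMap groupWord ++ i)
    (hold : ∀ d ∈ D, ∀ p ∈ d.l, p ∉ s.mem .old)
    (hdis : D.Pairwise (fun d d' => ∀ p ∈ d.l, p ∉ d'.l))
    (hL : (D.map (·.l.length)).sum + (s.mem .old).length ≤ L)
    (hb : (D.map fun d => gridLength d.E).sum ≤ s.reg .bud) :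
    ∃ t, RunLE (Op.bsem c L) (star groupProg) s t ((23 * L + 21) * D.length + 1) ∧
      Bounded c L t ∧ t.inp = i ∧ SameGrid s t ∧
      s.reg .bud = t.reg .bud + (D.map fun d => gridLength d.E).sum := by
  induction D generalizing s with
  | nil => exact ⟨s, .star_nil, hs, hi, ⟨rfl, rfl⟩, rfl⟩
  | cons d D ih =>
    rw [List.map_cons, List.sum_cons] at hL hb
    obtain ⟨hdis1, hdis2⟩ := List.pairwise_cons.1 hdis
    obtain ⟨t, h1, h2, h3, h4, h5, h6, h7, h8, h9⟩ := runLE_groupProg (d := d)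
      (i := (D.map (·.g)).flatMap groupWord ++ i) (hD d (by simp)).1 (hD d (by simp)).2 hs hden
      hcur hnew (by rw [hi]; simp) (hold d (by simp)) (by omega) (by omega)
    have hD' : ∀ e ∈ D, e.Valid t ∧ e.Small c L := by
      intro e he
      obtain ⟨⟨v1, v2, v3, v4, v5⟩, v6⟩ := hD e (List.mem_cons_of_mem _ he)
      exact ⟨⟨v1, h7 v2, v3, v4, by rw [h4.point_eq, v5]⟩, v6⟩
    have hold' : ∀ e ∈ D, ∀ p ∈ e.l, p ∉ t.mem .old := by
      intro e he p hp hp'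
      rw [h8, List.mem_append] at hp'
      rcases hp' with hp' | hp'
      · exact hdis1 e he p hp' hp
      · exact hold e (List.mem_cons_of_mem _ he) p hp hp'
    obtain ⟨u, i1, i2, i3, i4, i5⟩ := ih hD' h2 (h4.den ▸ hden) h5 h6 h3 hold' hdis2
      (by rw [h8, List.length_append]; omega) (by omega)
    exact ⟨u, (h1.star_cons i1).mono (by rw [List.length_cons, mul_add]; omega), i2, i3,
      h4.trans i4, by rw [h9, i5, List.map_cons, List.sum_cons]; ring⟩

/-- What is needed for an accepting run of the verifier. The state `u` is the one that is reached
after guessing the values of the main registers. -/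
theorem runLE_mainProg {f : Frac} {r : ℕ × ℕ} {l E} {D : List GroupData}
    (hmem : u.mem = fun _ => []) (hu : Bounded c L u) (hden : 0 < u.reg .den)
    (hf : coord u (u.reg .bud) = f.val) (hi : u.inp = Instance.word ⟨f, D.map (·.g)⟩)
    (hD : D ≠ []) (hE : Grows r l E) (hr : r = (u.reg .x, u.reg .y))
    (hl : ∀ p ∈ l, p.1 ≤ c ∧ p.2 ≤ c) (hlL : 2 * l.length ≤ L)
    (hval : ∀ d ∈ D, d.Valid { u with mem := fun _ => l } ∧ d.Small c L)
    (hdis : D.Pairwise (fun d d' => ∀ p ∈ d.l, p ∉ d'.l))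
    (hL : (D.map (·.l.length)).sum ≤ L)
    (hb : gridLength E + (D.map fun d => gridLength d.E).sum + u.reg .off ≤ u.reg .bud)
    (hs : s.mem = fun _ => []) (hsi : s.inp = u.inp) :
    ∃ t, RunLE (Op.bsem c L) mainProg s t ((23 * L + 30) * (D.length + 1)) := by
  have r1 : RunLE (Op.bsem c L) (prim .start) s u 1 :=
    .prim ⟨⟨hden, by rw [hmem, hs], hsi.symm⟩, by simp, hu⟩
  change u.inp = f.word ++ (D.map (·.g)).flatMap groupWord at hi
  have b2 := hu.inp_append hi
  obtain ⟨s3, E', h1, h2, h3, h4, h5⟩ := runLE_treeProg hE b2 (m := .top) (by simp [hmem]) hr hl hlL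
    (by simp only; omega)
  have hg : SameGrid u s3 := ⟨h4.den, h4.off⟩
  have e0 := h4.inp
  have e1 := h4.bud
  have mem : ∀ m ≠ .top, s3.mem m = [] := fun m hm => by rw [h4.mem m hm]; simp [hmem]
  simp only at e0 e1
  have hval' : ∀ d ∈ D, d.Valid s3 ∧ d.Small c L := by
    intro d hd
    obtain ⟨⟨v1, v2, v3, v4, v5⟩, v6⟩ := hval d hd
    exact ⟨⟨v1, h3 v2, v3, v4, by rw [hg.point_eq, ← v5]; rfl⟩, v6⟩
  obtain ⟨d, D, rfl⟩ := List.exists_cons_of_ne_nil hD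
  rw [List.map_cons, List.sum_cons] at hb hL
  obtain ⟨hdis1, hdis2⟩ := List.pairwise_cons.1 hdis
  obtain ⟨s4, i1, i2, i3, i4, i5, i6, i7, i8, i9⟩ := runLE_groupProg (d := d)
    (i := (D.map (·.g)).flatMap groupWord ++ []) (hval' d (by simp)).1 (hval' d (by simp)).2 h2
    (hg.den ▸ hden) (mem _ (by simp)) (mem _ (by simp)) (by rw [e0]; simp)
    (by simp [mem]) (by simp [mem]; omega) (by omega)
  have hD' : ∀ e ∈ D, e.Valid s4 ∧ e.Small c L := by
    intro e he
    obtain ⟨⟨v1, v2, v3, v4, v5⟩, v6⟩ := hval' e (List.mem_cons_of_mem _ he)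
    exact ⟨⟨v1, i7 v2, v3, v4, by rw [i4.point_eq, v5]⟩, v6⟩
  rw [mem .old (by simp), List.append_nil] at i8
  obtain ⟨s5, j1, j2, j3, j4, j5⟩ := runLE_star_groupProg hD' i2 ((hg.trans i4).den ▸ hden) i5 i6 i3
    (fun e he p hp hp' => hdis1 e he p (i8 ▸ hp') hp) hdis2 (by rw [i8]; omega) (by omega)
  have off := (hg.trans (i4.trans j4)).off
  refine ⟨s5, (r1.seq ((runLE_read hu hi (eq_of_coord_eq_val hden hf)).seq (h1.seq (i1.seq
    (j1.seq ((Op.runLE (i := .inpEnd) ⟨j3, rfl⟩ j2 j2).seq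
      (Op.runLE (i := .check) ⟨?_, rfl⟩ j2 j2))))))).mono ?_⟩
  · omega
  · have e2 : (23 * L + 30) * ((d :: D).length + 1) =
        (23 * L + 21) * D.length + 9 * D.length + 2 * (23 * L + 30) := by
      rw [List.length_cons]; ring
    omega

end

/-! ### The grid of an instance -/

/-- The coordinates of the terminals of an instance. -/
def Instance.coords (I : Instance) : List Frac := I.groups.flatten.flatMap fun a => [a.1, a.2]

theorem Instance.length_word (I : Instance) : I.word.length =
    I.bound.word.length + (I.coords.map (·.word.length)).sum + I.groups.length := by
  have key : ∀ g : List (Frac × Frac), (groupWord g).length =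
      ((g.flatMap fun a => [a.1, a.2]).map (·.word.length)).sum + 1 := by
    intro g
    induction g with
    | nil => simp [groupWord]
    | cons a g ih =>
      simp only [groupWord, List.length_append, List.flatMap_cons] at ih ⊢
      simp at ih ⊢
      omega
  have : ∀ G : List (List (Frac × Frac)), (G.flatMap groupWord).length =
      ((G.flatten.flatMap fun a => [a.1, a.2]).map (·.word.length)).sum + G.length := by
    intro G
    induction G with
    | nil => simp
    | cons g G ih =>
      rw [List.flatMap_cons, List.length_append, ih, key, List.flatten_cons, List.flatMap_append,
        List.map_append, List.sum_append, List.length_cons]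
      omega
  rw [Instance.word, List.length_append, this, Instance.coords]
  omega

theorem Instance.length_coords (I : Instance) : I.coords.length = 2 * I.groups.flatten.length := by
  rw [Instance.coords, List.length_flatMap, List.map_congr_left (g := fun _ => 2) (by simp),
    List.map_const', List.sum_replicate, smul_eq_mul, mul_comm]

theorem Instance.length_coords_le (I : Instance) : I.coords.length ≤ I.word.length := by
  have h := List.card_nsmul_le_sum (I.coords.map (·.word.length)) 1 (by
    simp only [List.mem_map]
    rintro _ ⟨f, -, rfl⟩
    simp [Frac.word]
    omega)
  rw [I.length_word]
  simp at h ⊢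
  omega

theorem Frac.den_lt (f : Frac) : f.den < 2 ^ f.word.length :=
  (lt_two_pow_length_natWord _).trans_le
    (Nat.pow_le_pow_right (by norm_num) (by simp [Frac.word]; omega))

theorem Frac.natAbs_num_lt (f : Frac) : f.num.natAbs < 2 ^ f.word.length :=
  (lt_two_pow_length_natWord _).trans_le
    (Nat.pow_le_pow_right (by norm_num) (by simp [Frac.word]; omega))

theorem prod_den_le (fs : List Frac) :
    (fs.map (·.den)).prod ≤ 2 ^ (fs.map (·.word.length)).sum := by
  induction fs with
  | nil => simp
  | cons f fs ih =>
    rw [List.map_cons, List.map_cons, List.prod_cons, List.sum_cons, pow_add]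
    exact Nat.mul_le_mul f.den_lt.le ih

/-- Fractions have a common denominator `d` of polynomial length. After adding a suitable number
`m`, their numerators are natural numbers. -/
theorem exists_common_grid (fs : List Frac) {n : ℕ} (h : (fs.map (·.word.length)).sum ≤ n) :
    ∃ d m : ℕ, 0 < d ∧ d ≤ 2 ^ (2 * n + 1) ∧ m ≤ 2 ^ (2 * n + 1) ∧
      ∀ f ∈ fs, ∃ k : ℕ, k ≤ 2 ^ (2 * n + 1) ∧ ((k : ℝ) - m) / d = f.val := by
  have hd : (fs.map (·.den)).prod ≤ 2 ^ n :=
    (prod_den_le fs).trans (Nat.pow_le_pow_right (by norm_num) h)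
  have hd0 : 0 < (fs.map (·.den)).prod := List.prod_pos (by
    simp only [List.mem_map]
    rintro _ ⟨f, -, rfl⟩
    exact f.den_pos)
  have hpow : 2 ^ (2 * n + 1) = 2 ^ (2 * n) + 2 ^ (2 * n) := by ring
  have hpow' : 2 ^ n ≤ 2 ^ (2 * n) := Nat.pow_le_pow_right (by norm_num) (by omega)
  refine ⟨(fs.map (·.den)).prod, 2 ^ (2 * n), hd0, by omega, by omega, fun f hf => ?_⟩
  set d := (fs.map (·.den)).prod
  obtain ⟨e, he⟩ : f.den ∣ d := List.dvd_prod (List.mem_map_of_mem hf)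
  have he' : e ≤ 2 ^ n := (Nat.le_mul_of_pos_left e f.den_pos).trans (he ▸ hd)
  have hnum : f.num.natAbs ≤ 2 ^ n := f.natAbs_num_lt.le.trans (Nat.pow_le_pow_right (by norm_num)
    ((List.le_sum_of_mem (List.mem_map_of_mem hf)).trans h))
  have habs : (f.num * e).natAbs ≤ 2 ^ (2 * n) := by
    rw [Int.natAbs_mul, Int.natAbs_natCast, two_mul, pow_add]
    exact Nat.mul_le_mul hnum he'
  refine ⟨(2 ^ (2 * n) + f.num * e).toNat, ?_, ?_⟩
  · have : ((2 : ℤ) ^ (2 * n)) = ((2 ^ (2 * n) : ℕ) : ℤ) := by push_cast; rfl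
    rw [this, hpow]
    omega
  · have h1 : (((2 ^ (2 * n) + f.num * e).toNat : ℤ) : ℝ) = 2 ^ (2 * n) + f.num * e := by
      rw [Int.toNat_of_nonneg (by
        have : ((2 : ℤ) ^ (2 * n)) = ((2 ^ (2 * n) : ℕ) : ℤ) := by push_cast; rfl
        omega)]
      push_cast
      rfl
    rw [Int.cast_natCast] at h1
    have h2 : (f.den : ℝ) ≠ 0 := by exact_mod_cast f.den_pos.ne'
    have h3 : (e : ℝ) ≠ 0 := by
      rintro h
      rw [Nat.cast_eq_zero] at h
      simp [h] at he
      omega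
    rw [h1, he, Frac.val]
    push_cast
    field_simp
    ring

/-! ### Moving trees to the grid -/

theorem gridLength_le_of_sublist {E E' : List ((ℕ × ℕ) × (ℕ × ℕ))} (h : E'.Sublist E) :
    gridLength E' ≤ gridLength E := (h.map _).sum_le_sum (by simp)

/-- A tree whose vertices are mapped to a finite set `S` becomes a tree with at most `S.card`
vertices that is not longer. -/
theorem Grows.exists_map {r : ℝ × ℝ} {l E} (h : Grows r l E) {φ : ℝ × ℝ → ℕ × ℕ}
    {S : Finset (ℕ × ℕ)} (hφ : ∀ p, φ p ∈ S) : ∃ l' E', Grows (φ r) l' E' ∧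
      l'.length ≤ S.card ∧ (∀ p ∈ l', p ∈ S) ∧ (∀ p ∈ l, φ p ∈ l') ∧
      gridLength E' ≤ gridLength (E.map (Prod.map φ φ)) := by
  obtain ⟨l', E', h1, h2, h3, h4⟩ := (h.map φ).exists_nodup
  have hS : ∀ p ∈ l', p ∈ S := by
    intro p hp
    obtain ⟨x, -, rfl⟩ := List.mem_map.1 ((h3 p).1 hp)
    exact hφ x
  refine ⟨l', E', h1, ?_, hS, fun p hp => (h3 _).2 (List.mem_map_of_mem hp),
    gridLength_le_of_sublist h4⟩
  rw [← List.toFinset_card_of_nodup h2]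
  exact Finset.card_le_card fun p hp => hS p (List.mem_toFinset.1 hp)

theorem totalLength_append (E E' : List ((ℝ × ℝ) × (ℝ × ℝ))) :
    totalLength (E ++ E') = totalLength E + totalLength E' := by
  simp [totalLength]

theorem totalLength_flatten_ofFn {k : ℕ} (E : Fin k → List ((ℝ × ℝ) × (ℝ × ℝ))) :
    totalLength (List.ofFn E).flatten = ∑ i, totalLength (E i) := by
  rw [← List.sum_ofFn]
  generalize hF : List.ofFn E = F
  have : List.ofFn (fun i => totalLength (E i)) = F.map totalLength := by
    rw [← hF, List.map_ofFn]
    rfl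
  rw [this]
  clear this hF
  induction F with
  | nil => simp [totalLength]
  | cons e F ih => rw [List.flatten_cons, totalLength_append, ih, List.map_cons, List.sum_cons]

/-- A two-level tree can be moved to the grid that is defined by a set `A` containing all
coordinates of terminals. Here `N` assigns to the elements of `A` the natural numbers that represent
them. -/
theorem TwoLevelTree.exists_grid {k : ℕ} {P : Fin k → Set (ℝ × ℝ)} (T : TwoLevelTree P) (i₀ : Fin k)
    {A : Finset ℝ} (hA : A.Nonempty) (hP : ∀ i, ∀ p ∈ P i, p ∈ A ×ˢ A) {u : State} {c : ℕ}
    {N : ℝ → ℕ} (hN : ∀ a ∈ A, N a ≤ c ∧ coord u (N a) = a) :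
    ∃ (r : ℕ × ℕ) (l : _) (E : _) (q : Fin k → ℕ × ℕ) (v : Fin k → List (ℕ × ℕ))
      (F : Fin k → List ((ℕ × ℕ) × (ℕ × ℕ))),
      Grows r l E ∧ l.length ≤ A.card ^ 2 ∧ (∀ p ∈ l, p.1 ≤ c ∧ p.2 ≤ c) ∧
      (∀ i, q i ∈ l ∧ Grows (q i) (v i) (F i) ∧ (v i).length ≤ A.card ^ 2 ∧
        (∀ p ∈ v i, p.1 ≤ c ∧ p.2 ≤ c) ∧ ∀ p ∈ P i, (N p.1, N p.2) ∈ v i) ∧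
      ((gridLength E + ∑ i, gridLength (F i) : ℕ) : ℝ) / u.reg .den ≤ T.length := by
  obtain ⟨top, bottom, q, hq, hb⟩ := T
  obtain ⟨l, E, h1, h2, h3⟩ := top.exists_grows (hq ⟨i₀, rfl⟩)
  choose v F g1 g2 g3 using fun i => (bottom i).exists_grows (hb i (Set.mem_union_right _ rfl))
  obtain ⟨f, f1, f2, f3⟩ := exists_rounding_plane hA (E ++ (List.ofFn F).flatten)
  have key : ∀ p, point u (Prod.map N N (f p)) = f p := fun p =>
    have hp := Finset.mem_product.1 (f1 p)
    Prod.ext (hN _ hp.1).2 (hN _ hp.2).2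
  have hS : ∀ p, Prod.map N N (f p) ∈ (A ×ˢ A).image (Prod.map N N) := fun p =>
    Finset.mem_image_of_mem _ (f1 p)
  have hcard : ((A ×ˢ A).image (Prod.map N N)).card ≤ A.card ^ 2 :=
    Finset.card_image_le.trans (by rw [Finset.card_product, sq])
  have hsmall : ∀ p ∈ (A ×ˢ A).image (Prod.map N N), p.1 ≤ c ∧ p.2 ≤ c := by
    intro p hp
    obtain ⟨x, hx, rfl⟩ := Finset.mem_image.1 hp
    exact ⟨(hN _ (Finset.mem_product.1 hx).1).1, (hN _ (Finset.mem_product.1 hx).2).1⟩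
  have hlen : ∀ E : List ((ℝ × ℝ) × (ℝ × ℝ)), (gridLength (E.map (Prod.map
      (fun p => Prod.map N N (f p)) (fun p => Prod.map N N (f p)))) : ℝ) / u.reg .den =
        totalLength (E.map (Prod.map f f)) := by
    intro E
    rw [← totalLength_map_point, List.map_map]
    congr 2
    funext e
    exact Prod.ext (key _) (key _)
  obtain ⟨l', E', h4, h5, h6, h7, h8⟩ := h1.exists_map hS
  choose v' F' g4 g5 g6 g7 g8 using fun i => (g1 i).exists_map hS
  refine ⟨_, l', E', fun i => Prod.map N N (f (q i)), v', F', h4, h5.trans hcard,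
    fun p hp => hsmall p (h6 p hp), fun i => ⟨h7 _ (h2 _ (hq ⟨i, rfl⟩)), g4 i, (g5 i).trans hcard,
      fun p hp => hsmall p (g6 i p hp), fun p hp => ?_⟩, ?_⟩
  · have := g7 i p (g2 i p (hb i (Set.mem_union_left _ hp)))
    rwa [f2 p (hP i p hp)] at this
  · calc _ ≤ ((gridLength (E.map (Prod.map (fun p => Prod.map N N (f p))
            (fun p => Prod.map N N (f p)))) + ∑ i, gridLength ((F i).map (Prod.map
            (fun p => Prod.map N N (f p)) (fun p => Prod.map N N (f p)))) : ℕ) : ℝ) /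
            u.reg .den := by
          gcongr with i
          exact g8 i
      _ = totalLength ((E ++ (List.ofFn F).flatten).map (Prod.map f f)) := by
          rw [List.map_append, totalLength_append, List.map_flatten, List.map_ofFn,
            totalLength_flatten_ofFn]
          push_cast
          rw [add_div, Finset.sum_div, hlen]
          simp only [hlen]
          rfl
      _ ≤ totalLength (E ++ (List.ofFn F).flatten) := f3
      _ ≤ _ := by
          rw [totalLength_append, totalLength_flatten_ofFn, TwoLevelTree.length]
          gcongr with i
          exact g3 i

/-! ### Accepting runs for yes-instances -/

theorem Instance.mem_coords {I : Instance} {g : List (Frac × Frac)} (hg : g ∈ I.groups)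
    {a : Frac × Frac} (ha : a ∈ g) : a.1 ∈ I.coords ∧ a.2 ∈ I.coords := by
  have : a ∈ I.groups.flatten := List.mem_flatten.2 ⟨g, hg, ha⟩
  exact ⟨List.mem_flatMap.2 ⟨a, this, by simp⟩, List.mem_flatMap.2 ⟨a, this, by simp⟩⟩

/-- If a word `x` of length `n` describes a yes-instance, then it is accepted by a run with numbers
up to `2 ^ (2 * n + 1)` and with lists of length at most `2 * n ^ 2 + n`. -/
theorem runLE_of_mem_problem {x : List Sym} (hx : x ∈ problem) {s : State}
    (hs : s.mem = fun _ => []) (hi : s.inp = x) :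
    ∃ t, RunLE (Op.bsem (2 ^ (2 * x.length + 1)) (2 * x.length ^ 2 + x.length)) mainProg s t
      ((23 * (2 * x.length ^ 2 + x.length) + 30) * (x.length + 1)) := by
  classical
  obtain ⟨I, ⟨hI1, hI2, hI3⟩, ⟨T, hT⟩, rfl⟩ := hx
  set n := I.word.length with hn
  have len := I.length_word
  have len1 := I.length_coords
  have len2 := I.length_coords_le
  obtain ⟨d, m, hd0, hd, hm, hgrid⟩ := exists_common_grid (n := n) (I.bound :: I.coords)
    (by rw [List.map_cons, List.sum_cons]; omega)
  obtain ⟨b, hb, hbv⟩ := hgrid _ List.mem_cons_self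
  set c := 2 ^ (2 * n + 1)
  -- The state after guessing the registers. The root `r` of the top tree is to be chosen.
  let u : ℕ × ℕ → State := fun r =>
    ⟨fun | .den => d | .off => m | .bud => b | .x => r.1 | .y => r.2, fun _ => [], I.word⟩
  set A : Finset ℝ := (I.coords.map Frac.val).toFinset
  have hAcard : A.card ≤ n := (List.toFinset_card_le _).trans (by simpa using len2)
  have hAcard2 : A.card ^ 2 ≤ n ^ 2 := Nat.pow_le_pow_left hAcard 2
  have hmemA : ∀ g ∈ I.groups, ∀ a ∈ g, termPoint a ∈ A ×ˢ A := by
    intro g hg a ha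
    have := I.mem_coords hg ha
    exact Finset.mem_product.2 ⟨List.mem_toFinset.2 (List.mem_map_of_mem this.1),
      List.mem_toFinset.2 (List.mem_map_of_mem this.2)⟩
  have hAN : ∀ a ∈ A, ∃ k : ℕ, k ≤ c ∧ coord (u 0) k = a := by
    intro a ha
    obtain ⟨f, hf, rfl⟩ := List.mem_map.1 (List.mem_toFinset.1 ha)
    exact hgrid f (List.mem_cons_of_mem _ hf)
  choose! N hN using hAN
  have i₀ : Fin I.groups.length := ⟨0, List.length_pos_iff.2 hI1⟩
  have hne : ∀ i : Fin I.groups.length, I.groups.get i ≠ [] := by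
    intro i h
    obtain ⟨_, a, ha, -⟩ := hI2 i
    rw [h] at ha
    simp at ha
  obtain ⟨a₀, ha₀⟩ := List.exists_mem_of_ne_nil _ (hne i₀)
  have hA : A.Nonempty := ⟨_, (Finset.mem_product.1 (hmemA _ (List.get_mem _ i₀) _ ha₀)).1⟩
  obtain ⟨r, l, E, q, v, F, h1, h2, h3, h4, h5⟩ := T.exists_grid i₀ hA (by
    rintro i _ ⟨a, ha, rfl⟩
    exact hmemA _ (List.get_mem _ i) _ ha) hN
  have hpt : ∀ p ∈ A ×ˢ A, point (u 0) (N p.1, N p.2) = p := fun p hp =>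
    have hp := Finset.mem_product.1 hp
    Prod.ext (hN _ hp.1).2 (hN _ hp.2).2
  let D : Fin I.groups.length → GroupData := fun i => ⟨I.groups.get i, q i, v i, F i,
    (I.groups.get i).map fun a => (N a.1.val, N a.2.val)⟩
  have hDg : (List.ofFn D).map (·.g) = I.groups := by
    rw [List.map_ofFn]
    exact List.ofFn_get _
  have hDl : ∀ i, ∀ p ∈ (D i).l, point (u 0) p ∈ I.terminals i ∧ p ∈ v i := by
    intro i p hp
    obtain ⟨a, ha, rfl⟩ := List.mem_map.1 hp
    exact ⟨⟨a, ha, hpt _ (hmemA _ (List.get_mem _ i) _ ha)⟩, (h4 i).2.2.2.2 _ ⟨a, ha, rfl⟩⟩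
  have hu : Bounded c (2 * n ^ 2 + n) (u r) := by
    refine ⟨fun r' => ?_, by simp [u], by simp [u], by simp only [u]; omega⟩
    cases r'
    exacts [hd, hm, (h3 _ h1.root_mem).1, (h3 _ h1.root_mem).2, hb]
  obtain ⟨t, ht⟩ := runLE_mainProg (u := u r) (s := s) (D := List.ofFn D) (l := l) rfl hu hd0 hbv
    (by rw [hDg]) (by simpa using hI1) h1 rfl h3 (by omega)
    (by
      intro e he
      obtain ⟨i, rfl⟩ := (List.mem_ofFn' _ _).1 he
      obtain ⟨j1, j2, j3, j4, -⟩ := h4 i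
      refine ⟨⟨hne i, j1, j2, fun p hp => (hDl i p hp).2, ?_⟩, ⟨j4, ?_⟩⟩
      · simp only [D, List.map_map]
        exact List.map_congr_left fun a ha => hpt _ (hmemA _ (List.get_mem _ i) _ ha)
      · simp only [D]
        omega)
    (by
      rw [List.pairwise_ofFn]
      intro i j hij p hp hp'
      exact Set.disjoint_left.1 (hI3 hij.ne) (hDl i p hp).1 (hDl j p hp').1)
    (by
      have : (List.ofFn D).map (·.l.length) = I.groups.map List.length := by
        refine Eq.trans ?_ (congrArg (List.map List.length) hDg)
        rw [List.map_map, List.map_ofFn, List.map_ofFn]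
        simp [D, Function.comp_def]
      rw [this, ← List.length_flatten]
      omega)
    (by
      rw [List.map_ofFn, List.sum_ofFn]
      have h6 := h5.trans (hT.trans_eq hbv.symm)
      have h7 : (0 : ℝ) < d := by exact_mod_cast hd0
      have h8 := (div_le_div_iff_of_pos_right h7).1 h6
      have h9 := le_sub_iff_add_le.1 h8
      exact_mod_cast h9)
    hs hi
  refine ⟨t, ht.mono ?_⟩
  rw [List.length_ofFn]
  gcongr
  omega

end TwoLevelSteiner

theorem mainTheorem8 : InNP TwoLevelSteiner.problem := by
  refine TwoLevelSteiner.inNP_of_op_program _ TwoLevelSteiner.mainProg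
    ((23 * (2 * .X ^ 2 + .X) + 30) * (.X + 1)) (2 * .X + 1) (2 * .X ^ 2 + .X)
    (fun s t hs h => TwoLevelSteiner.mem_problem_of_ex hs h) fun x hx s hs hi => ?_
  simpa using TwoLevelSteiner.runLE_of_mem_problem hx hs hi
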